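/- Let $n\ge 1$ be an integer, $\alpha\in(0,n)$, $\beta\in(0,2]$, $p>1$, and put $$p_{\mathrm{Fuj}}=1+\frac{\beta+\alpha}{n-\alpha},\qquad q_{\mathrm{sc}}=\frac{n(p-1)}{\beta+\alpha}.$$ Consider the problem $$u_t+(-\Delta)^{\beta/2}u=I_\alpha(|u|^p)\ \text{ in } (0,\infty)\times\mathbb R^n,\qquad u(0)=u_0, \tag{P}$$ where $$I_\alpha f(x)=A_\alpha\int_{\mathbb R^n}\frac{f(y)}{|x-y|^{n-\alpha}}\,dy,\qquad A_\alpha=\frac{\Gamma(\frac{n-\alpha}{2})}{\Gamma(\frac{\alpha}{2})\,\pi^{n/2}\,2^{\alpha}}.$$ For $t>0$ let $S_\beta(t)v=S_\beta(t,\cdot)*v$ with $S_\beta(t,x)=(2\pi)^{-n}\int_{\mathbb R^n}e^{ix\cdot\xi-t|\xi|^\beta}\,d\xi$. For $\frac{n}{n-\alpha}<s<\frac{n(p-1)}{\alpha}$ and $u_0\in L^s(\mathbb R^n)\cap L^\infty(\mathbb R^n)$, a mild solution of (P) on $[0,T)$, $0<T\le\infty$, is a real-valued function $u\in C([0,T),L^s(\mathbb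 R^n))$, bounded in $L^\infty(\mathbb R^n)$ on every compact subinterval of $[0,T)$, with $u(0)=u_0$ and $$u(t)=S_\beta(t)u_0+\int_0^tS_\beta(t-\tau)\,I_\alpha(|u(\tau)|^p)\,d\tau\quad\text{a.e. in }\mathbb R^n,\qquad 0<t<T.$$ A mild solution $u$ on $[0,T_{\max})$ is called the maximal mild solution if every mild solution $v$ of (P) (with the same $s$ and $u_0$) on an interval $[0,T')$ satisfies $T'\le T_{\max}$ and $v=u$ on $[0,T')$. (i) Suppose $\frac{n}{n-\alpha}<p\le p_{\mathrm{Fuj}}$, $u_0\in L^1(\mathbb R^n)\cap L^\infty(\mathbb R^n)$, $u_0\ge0$ and $\int_{\mathbb R^n}u_0\,dx>0$. Then, for every $s\in\left(\frac{n}{n-\alpha},\frac{n(p-1)}{\alpha}\right)$, the maximal mild solution $u$ of (P) exists and blows up in finite time: $0<T_{\max}<\infty$ and $$\lim_{t\to T_{\max}^-}\left(\|u(t)\|_{L^\infty}+\|u(t)\|_{L^s}\right)=+\infty.$$ (ii) Suppose $p>p_{\mathrm{Fuj}}$. Then there is $\varepsilon>0$, depending only on $n,\alpha,\beta,p$, such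 that for every $u_0\in L^{q_{\mathrm{sc}}}(\mathbb R^n)\cap L^\infty(\mathbb R^n)$ with $\|u_0\|_{L^{q_{\mathrm{sc}}}}\le\varepsilon$ and every $s\in\left(\frac{n}{n-\alpha},\frac{n(p-1)}{\alpha}\right)$ with $u_0\in L^s(\mathbb R^n)$ (for instance $s=q_{\mathrm{sc}}$), the maximal mild solution $u$ of (P) exists and is global, $T_{\max}=\infty$, and $\sup_{t>0}\|u(t)\|_{L^\infty}<\infty$, that is, $u\in L^\infty((0,\infty),L^\infty(\mathbb R^n))$. -/

import Mathlib

open MeasureTheory Filter Topology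
open scoped ENNReal NNReal

noncomputable section

/-- The exponent `1 + (β + α) / (n - α)`. -/
def fujitaExponent (n : ℕ) (β α : ℝ) : ℝ := 1 + (β + α) / (n - α)

/-- The scaling-invariant Lebesgue exponent `n (p - 1) / (β + α)`. -/
def scalingExponent (n : ℕ) (β α p : ℝ) : ℝ := n * (p - 1) / (β + α)

/-- The normalization constant
`A_α = Γ((n - α) / 2) / (Γ(α / 2) π ^ (n / 2) 2 ^ α)` of the Riesz potential. -/
def rieszConstant (n : ℕ) (α : ℝ) : ℝ :=
  Real.Gamma ((n - α) / 2) /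
    (Real.Gamma (α / 2) * Real.pi ^ ((n : ℝ) / 2) * (2 : ℝ) ^ α)

/-- The Riesz potential `I_α f (x) = A_α ∫ f(y) / |x - y| ^ (n - α) dy`. -/
def rieszPotential {n : ℕ} (α : ℝ) (f : EuclideanSpace ℝ (Fin n) → ℝ)
    (x : EuclideanSpace ℝ (Fin n)) : ℝ :=
  rieszConstant n α * ∫ y, f y / ‖x - y‖ ^ ((n : ℝ) - α)

/-- The fundamental solution of `u_t + (-Δ)^(β/2) u = 0`, for `t > 0`:
`S_β(t, x) = (2π)^(-n) ∫ exp(i x·ξ - t |ξ|^β) dξ`. The integral is real, because its integrand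
at `-ξ` is the conjugate of its integrand at `ξ`. -/
def fracHeatKernel {n : ℕ} (β t : ℝ) (x : EuclideanSpace ℝ (Fin n)) : ℝ :=
  ((2 * Real.pi) ^ n)⁻¹ *
    (∫ ξ : EuclideanSpace ℝ (Fin n),
      Complex.exp (Complex.I * ((inner ℝ x ξ : ℝ) : ℂ) - ((t * ‖ξ‖ ^ β : ℝ) : ℂ))).re

/-- The semigroup `S_β(t) v = S_β(t, ·) ∗ v`, for `t > 0`. -/
def fracHeatSemigroup {n : ℕ} (β t : ℝ) (v : EuclideanSpace ℝ (Fin n) → ℝ)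
    (x : EuclideanSpace ℝ (Fin n)) : ℝ :=
  ∫ y, fracHeatKernel β t (x - y) * v y

/-- The function `τ ↦ S_β(t - τ) I_α(|u(τ)|^p) (x)`, whose integral over `(0, t)` is the Duhamel
term. It does not depend on the representatives of the classes `u(τ)`. -/
def duhamelIntegrand {n : ℕ} (α β p : ℝ) (u : ℝ → EuclideanSpace ℝ (Fin n) → ℝ)
    (t : ℝ) (x : EuclideanSpace ℝ (Fin n)) (τ : ℝ) : ℝ :=
  fracHeatSemigroup β (t - τ) (rieszPotential α (fun y => |u τ y| ^ p)) x

/-- `u` is a mild solution of `u_t + (-Δ)^(β/2) u = I_α(|u|^p)`, `u(0) = u₀`, on the time interval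
`[0, T)`, `T ≤ ∞`, in the class `C([0,T), L^s) ∩ L^∞_loc([0,T), L^∞)`. When `0 < α < n` and
`n / (n - α) < s < n (p - 1) / α`, all space integrals in the integral equation converge absolutely
for `u` in this class. -/
structure IsMildSolution {n : ℕ} (α β p s : ℝ) (u₀ : EuclideanSpace ℝ (Fin n) → ℝ)
    (T : ℝ≥0∞) (u : ℝ → EuclideanSpace ℝ (Fin n) → ℝ) : Prop where
  /-- `u(0) = u₀`. -/
  initial : u 0 =ᵐ[volume] u₀
  /-- `u(t) ∈ L^s`. -/
  memLp : ∀ t : ℝ, 0 ≤ t → ENNReal.ofReal t < T → MemLp (u t) (ENNReal.ofReal s) volume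
  /-- `u` is continuous from `[0, T)` to `L^s`. -/
  continuous : ∀ t : ℝ, 0 ≤ t → ENNReal.ofReal t < T →
    Tendsto (fun τ => eLpNorm (u τ - u t) (ENNReal.ofReal s) volume)
      (𝓝[{τ : ℝ | 0 ≤ τ ∧ ENNReal.ofReal τ < T}] t) (𝓝 0)
  /-- `u` is bounded in `L^∞` on compact subintervals of `[0, T)`. -/
  bounded : ∀ T' : ℝ, ENNReal.ofReal T' < T →
    ∃ M : ℝ≥0, ∀ t ∈ Set.Icc (0 : ℝ) T', eLpNorm (u t) ∞ volume ≤ M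
  /-- `u(t) = S_β(t) u₀ + ∫_0^t S_β(t - τ) I_α(|u(τ)|^p) dτ` almost everywhere. -/
  equation : ∀ t : ℝ, 0 < t → ENNReal.ofReal t < T → ∀ᵐ x ∂volume,
    IntervalIntegrable (duhamelIntegrand α β p u t x) volume 0 t ∧
      u t x = fracHeatSemigroup β t u₀ x + ∫ τ in (0 : ℝ)..t, duhamelIntegrand α β p u t x τ

/-- `u` is the maximal mild solution and `T = T_max`: every mild solution with the same datum (in
the same class) lives on a subinterval of `[0, T)` and coincides with `u` there. -/
def IsMaximalMildSolution {n : ℕ} (α β p s : ℝ) (u₀ : EuclideanSpace ℝ (Fin n) → ℝ)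
    (T : ℝ≥0∞) (u : ℝ → EuclideanSpace ℝ (Fin n) → ℝ) : Prop :=
  IsMildSolution α β p s u₀ T u ∧
    ∀ (T' : ℝ≥0∞) (v : ℝ → EuclideanSpace ℝ (Fin n) → ℝ), IsMildSolution α β p s u₀ T' v →
      T' ≤ T ∧ ∀ t : ℝ, 0 ≤ t → ENNReal.ofReal t < T' → v t =ᵐ[volume] u t

end

/-! All estimates are made for functions with values in `[0, ∞]`. For a datum `f₀ ≥ 0` the Picard
iterates started at `0` increase, and by monotone convergence their supremum `minSol` solves the
integral equation with no integrability hypothesis, the value `∞` being allowed. Both halves of the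
theorem become the question whether `minSol` stays bounded in `L^∞ ∩ L^s`.

Kernels. The heat kernel is nonnegative, radially nonincreasing, self-similar and of mass one, and
it satisfies the semigroup law. Sign and monotonicity come from `λ ^ (β/2) = C⁻¹ ∫ (1 - exp (-sλ)) s
^ (-1 - β/2) ds`: the symbol `exp (-t |ξ| ^ β)` is a limit of positive superpositions of Gaussians,
whose transforms are again Gaussians. The Riesz kernel is the sum of an integrable part near `0` and
a far part in `L^a`, `a > n/(n-α)`. With Hölder and Young this bounds `I_α (v^(p-1) w)` in `L^∞` and
in `L^s`; the window `n/(n-α) < s < n(p-1)/α` is what leaves room for the Hölder exponents. Local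
existence with a lifespan depending only on the norms, uniqueness by an iterated Gronwall argument,
and the blow-up alternative follow. A solution of changing sign is a limit of signed Picard
iterates: convexity of `x ^ p` bounds their increments by those of the positive iterates with datum
`|u₀|`.

Blow-up for `p ≤ p_Fuj`. Positive mass gives `S_β(t) f₀ ≥ c t^(-n/β)` on a ball of radius `ρ
t^(1/β)`. Inserted in the Duhamel term, the slowly decaying Riesz kernel improves this to `c
t^(-(n-α)/β)` on `|x| ≤ t^(1/β)` (`exists_le_minSol`), and a second insertion gains a factor `log
(t/t₁)`, precisely because `p (n-α) ≤ n + β` (`exists_log_le_minSol`). Since `S_β(t) I_α ≥ c t^(α/β)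
S_β(t)` (`exists_mul_heatK_le_forceK`), Jensen's inequality shows that `J(τ) = S_β(t-τ) U(t+τ) (0)`
satisfies `J(τ) ≥ a + b ∫₀^τ J^p` on `(0, t/2]`, with `a ~ t^(-(n-α)/β) log (t/t₁)` and `b ~
t^(α/β)`. Such a `J` is infinite after a time of order `a^(1-p)/b`, and this is less than `t/2` for
large `t`; in the critical case only the logarithm ensures it.

Global existence for `p > p_Fuj`. In an auxiliary space `L^r` the iterates obey `‖U(t)‖_r ≤ M
t^(-σ)`, where `σ` is the decay of the heat flow from `L^{q_sc}` to `L^r`, and `S_β(t) I_α(v^p)`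
costs `t^(-θ)`. The relation `θ + σ(p-1) = 1` expresses scaling invariance, so smallness in
`L^{q_sc}` closes the induction for all times. The same weights integrate to a constant in the `L^∞`
estimate, whence `U ≤ 2 ‖f₀‖_∞`; the `L^s` norm then grows at most exponentially. -/

noncomputable section

/-! ### Functions with a nonnegative, radially nonincreasing cosine transform -/

section CosTransform

variable {V : Type*} [NormedAddCommGroup V] [InnerProductSpace ℝ V] [FiniteDimensional ℝ V]
  [MeasurableSpace V] [BorelSpace V]

/-- The cosine transform. -/
def cosTransform (φ : V → ℝ) (x : V) : ℝ := ∫ ξ, Real.cos (inner ℝ x ξ) * φ ξ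

/-- `φ` is integrable and its cosine transform is nonnegative and radially nonincreasing. -/
def HasUnimodalCosTransform (φ : V → ℝ) : Prop :=
  Integrable φ ∧ ∀ x y : V, ‖x‖ ≤ ‖y‖ →
    0 ≤ cosTransform φ y ∧ cosTransform φ y ≤ cosTransform φ x

lemma integrable_cos_mul {φ : V → ℝ} (h : Integrable φ) (x : V) :
    Integrable (fun ξ => Real.cos (inner ℝ x ξ) * φ ξ) := by
  refine h.bdd_mul (c := 1) ?_ (ae_of_all _ fun ξ => ?_)
  · exact (by fun_prop : Continuous fun ξ : V => Real.cos (inner ℝ x ξ)).aestronglyMeasurable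
  · exact Real.abs_cos_le_one _

/-- Dominated convergence carries the pointwise inequalities between transforms to the limit.
Together with sums and nonnegative multiples, this is the closure property that leads from Gaussians
to the fractional symbol. -/
lemma HasUnimodalCosTransform.of_tendsto {φ : ℕ → V → ℝ} {ψ g : V → ℝ}
    (hφ : ∀ k, HasUnimodalCosTransform (φ k)) (hg : Integrable g)
    (hb : ∀ k ξ, |φ k ξ| ≤ g ξ) (hlim : ∀ ξ, Tendsto (fun k => φ k ξ) atTop (𝓝 (ψ ξ))) :
    HasUnimodalCosTransform ψ := by
  have hψm : AEStronglyMeasurable ψ volume :=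
    aestronglyMeasurable_of_tendsto_ae atTop (fun k => (hφ k).1.aestronglyMeasurable)
      (ae_of_all _ hlim)
  have hψ : Integrable ψ := hg.mono' hψm
    (ae_of_all _ fun ξ => le_of_tendsto (hlim ξ).abs (Eventually.of_forall fun k => hb k ξ))
  have key : ∀ x, Tendsto (fun k => cosTransform (φ k) x) atTop (𝓝 (cosTransform ψ x)) := by
    intro x
    refine tendsto_integral_of_dominated_convergence g
      (fun k => (integrable_cos_mul (hφ k).1 x).aestronglyMeasurable) hg
      (fun k => ae_of_all _ fun ξ => ?_) (ae_of_all _ fun ξ => (hlim ξ).const_mul _)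
    rw [norm_mul]
    calc ‖Real.cos (inner ℝ x ξ)‖ * ‖φ k ξ‖ ≤ 1 * g ξ :=
          mul_le_mul (Real.abs_cos_le_one _) (hb k ξ) (norm_nonneg _) zero_le_one
      _ = g ξ := one_mul _
  refine ⟨hψ, fun x y hxy => ⟨?_, ?_⟩⟩
  · exact ge_of_tendsto' (key y) fun k => ((hφ k).2 x y hxy).1
  · exact le_of_tendsto_of_tendsto' (key y) (key x) fun k => ((hφ k).2 x y hxy).2

lemma HasUnimodalCosTransform.const_mul {φ : V → ℝ} (h : HasUnimodalCosTransform φ) {c : ℝ}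
    (hc : 0 ≤ c) : HasUnimodalCosTransform (fun ξ => c * φ ξ) := by
  have e : ∀ x, cosTransform (fun ξ => c * φ ξ) x = c * cosTransform φ x := by
    intro x
    simp only [cosTransform]
    rw [← integral_const_mul]
    congr 1; ext ξ; ring
  refine ⟨h.1.const_mul c, fun x y hxy => ?_⟩
  rw [e, e]
  exact ⟨mul_nonneg hc (h.2 x y hxy).1, mul_le_mul_of_nonneg_left (h.2 x y hxy).2 hc⟩

lemma HasUnimodalCosTransform.add {φ ψ : V → ℝ} (h : HasUnimodalCosTransform φ)
    (h' : HasUnimodalCosTransform ψ) : HasUnimodalCosTransform (fun ξ => φ ξ + ψ ξ) := by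
  have e : ∀ x, cosTransform (fun ξ => φ ξ + ψ ξ) x = cosTransform φ x + cosTransform ψ x := by
    intro x
    simp only [cosTransform]
    rw [← integral_add (integrable_cos_mul h.1 x) (integrable_cos_mul h'.1 x)]
    congr 1; ext ξ; ring
  refine ⟨h.1.add h'.1, fun x y hxy => ?_⟩
  rw [e, e]
  exact ⟨add_nonneg (h.2 x y hxy).1 (h'.2 x y hxy).1,
    add_le_add (h.2 x y hxy).2 (h'.2 x y hxy).2⟩

lemma integrable_exp_neg_mul_norm_sq {δ : ℝ} (hδ : 0 < δ) :
    Integrable (fun ξ : V => Real.exp (-δ * ‖ξ‖ ^ 2)) := by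
  have := (GaussianFourier.integrable_cexp_neg_mul_sq_norm_add (V := V) (b := (δ : ℂ))
    (by simpa using hδ) 0 0).re
  refine this.congr (ae_of_all _ fun ξ => ?_)
  have : (-(δ : ℂ) * (‖ξ‖ : ℂ) ^ 2 + 0 * ((inner ℝ (0 : V) ξ : ℝ) : ℂ))
      = ((-δ * ‖ξ‖ ^ 2 : ℝ) : ℂ) := by push_cast; ring
  simp only [this]
  exact Complex.exp_ofReal_re _

lemma cosTransform_gaussian {δ : ℝ} (hδ : 0 < δ) (x : V) :
    cosTransform (fun ξ : V => Real.exp (-δ * ‖ξ‖ ^ 2)) x =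
      (Real.pi / δ) ^ (Module.finrank ℝ V / 2 : ℝ) * Real.exp (-(‖x‖ ^ 2 / (4 * δ))) := by
  have hb : 0 < (δ : ℂ).re := by simpa using hδ
  have h := GaussianFourier.integral_cexp_neg_mul_sq_norm_add (V := V) hb Complex.I x
  have hi := GaussianFourier.integrable_cexp_neg_mul_sq_norm_add (V := V) hb Complex.I x
  have h2 := congrArg Complex.re h
  have e1 : (∫ v : V, Complex.exp (-(δ : ℂ) * (‖v‖ : ℂ) ^ 2
      + Complex.I * ((inner ℝ x v : ℝ) : ℂ))).re
      = cosTransform (fun ξ : V => Real.exp (-δ * ‖ξ‖ ^ 2)) x := by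
    have : (∫ v : V, Complex.exp (-(δ : ℂ) * (‖v‖ : ℂ) ^ 2
        + Complex.I * ((inner ℝ x v : ℝ) : ℂ))).re = ∫ v : V, (Complex.exp (-(δ : ℂ) * (‖v‖ : ℂ) ^ 2
        + Complex.I * ((inner ℝ x v : ℝ) : ℂ))).re := (integral_re hi).symm
    rw [this]
    refine integral_congr_ae (ae_of_all _ fun v => ?_)
    simp only
    have : (-(δ : ℂ) * (‖v‖ : ℂ) ^ 2 + Complex.I * ((inner ℝ x v : ℝ) : ℂ))
      = ((-δ * ‖v‖ ^ 2 : ℝ) : ℂ) + ((inner ℝ x v : ℝ) : ℂ) * Complex.I := by push_cast; ring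
    rw [this, Complex.exp_add, ← Complex.ofReal_exp, Complex.re_ofReal_mul,
      Complex.exp_ofReal_mul_I_re]
    ring
  rw [e1] at h2
  rw [h2]
  have e2 : ((Real.pi : ℂ) / (δ : ℂ)) ^ ((Module.finrank ℝ V : ℂ) / 2) =
      (((Real.pi / δ) ^ (Module.finrank ℝ V / 2 : ℝ) : ℝ) : ℂ) := by
    rw [Complex.ofReal_cpow (by positivity)]; push_cast; rfl
  have e3 : Complex.I ^ 2 * (‖x‖ : ℂ) ^ 2 / (4 * (δ : ℂ)) = ((-(‖x‖ ^ 2 / (4 * δ)) : ℝ) : ℂ) := by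
    rw [Complex.I_sq]; push_cast; ring
  rw [e2, e3, Complex.re_ofReal_mul, Complex.exp_ofReal_re]

lemma hasUnimodalCosTransform_gaussian {δ : ℝ} (hδ : 0 < δ) :
    HasUnimodalCosTransform (fun ξ : V => Real.exp (-δ * ‖ξ‖ ^ 2)) := by
  refine ⟨integrable_exp_neg_mul_norm_sq hδ, fun x y hxy => ?_⟩
  rw [cosTransform_gaussian hδ, cosTransform_gaussian hδ]
  refine ⟨by positivity, ?_⟩
  gcongr

/-- The Laplace transform of the finite measure `s ^ (-1 - γ) ds` on `(ε, ∞)`. -/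
def truncLaplace (γ ε l : ℝ) : ℝ := ∫ s in Set.Ioi ε, Real.exp (-s * l) * s ^ (-1 - γ)

lemma integrableOn_rpow_neg_one_sub {γ ε : ℝ} (hγ : 0 < γ) (hε : 0 < ε) :
    IntegrableOn (fun s : ℝ => s ^ (-1 - γ)) (Set.Ioi ε) :=
  integrableOn_Ioi_rpow_of_lt (by linarith) hε

lemma integrableOn_exp_mul_rpow {γ ε l : ℝ} (hγ : 0 < γ) (hε : 0 < ε) (hl : 0 ≤ l) :
    IntegrableOn (fun s : ℝ => Real.exp (-s * l) * s ^ (-1 - γ)) (Set.Ioi ε) := by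
  refine Integrable.bdd_mul (c := 1) (integrableOn_rpow_neg_one_sub hγ hε) ?_ ?_
  · exact (by fun_prop : Continuous fun s : ℝ => Real.exp (-s * l)).aestronglyMeasurable
  · refine (ae_restrict_iff' measurableSet_Ioi).2 (ae_of_all _ fun s hs => ?_)
    rw [Real.norm_eq_abs, Real.abs_exp, Real.exp_le_one_iff]
    have : 0 < s := hε.trans hs
    nlinarith

lemma truncLaplace_nonneg {γ ε l : ℝ} (hε : 0 < ε) : 0 ≤ truncLaplace γ ε l := by
  refine setIntegral_nonneg measurableSet_Ioi fun s hs => ?_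
  have : 0 < s := hε.trans hs
  positivity

lemma truncLaplace_le {γ ε l : ℝ} (hγ : 0 < γ) (hε : 0 < ε) (hl : 0 ≤ l) :
    truncLaplace γ ε l ≤ truncLaplace γ ε 0 := by
  refine setIntegral_mono_on (integrableOn_exp_mul_rpow hγ hε hl)
    (integrableOn_exp_mul_rpow hγ hε le_rfl) measurableSet_Ioi fun s hs => ?_
  have : 0 < s := hε.trans hs
  exact mul_le_mul_of_nonneg_right (Real.exp_le_exp.2 (by nlinarith)) (by positivity)

lemma measurable_truncLaplace {γ ε : ℝ} : Measurable (truncLaplace γ ε) := by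
  have : StronglyMeasurable (fun p : ℝ × ℝ => Real.exp (-p.2 * p.1) * p.2 ^ (-1 - γ)) :=
    Measurable.stronglyMeasurable (by fun_prop)
  exact (this.integral_prod_right (ν := volume.restrict (Set.Ioi ε))).measurable

/-- The factor `truncLaplace γ ε (‖ξ‖ ^ 2)` superposes, with the positive weights `s ^ (-1 - γ)`,
the functions in which the Gaussian parameter `δ` has become `δ + s`. By Fubini the transform is a
positive integral of unimodal ones. This is why the hypothesis is required for every `δ > 0`. -/
lemma HasUnimodalCosTransform.mul_truncLaplace {φ : V → ℝ} {C γ ε : ℝ} (hγ : 0 < γ) (hε : 0 < ε)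
    (hφm : Measurable φ) (hφ : ∀ ξ, |φ ξ| ≤ C)
    (h : ∀ δ > 0, HasUnimodalCosTransform (fun ξ : V => φ ξ * Real.exp (-δ * ‖ξ‖ ^ 2)))
    {δ : ℝ} (hδ : 0 < δ) :
    HasUnimodalCosTransform
      (fun ξ : V => (φ ξ * truncLaplace γ ε (‖ξ‖ ^ 2)) * Real.exp (-δ * ‖ξ‖ ^ 2)) := by
  have hint : Integrable
      (fun ξ : V => (φ ξ * truncLaplace γ ε (‖ξ‖ ^ 2)) * Real.exp (-δ * ‖ξ‖ ^ 2)) := by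
    refine (integrable_exp_neg_mul_norm_sq hδ).bdd_mul (c := C * truncLaplace γ ε 0) ?_
      (ae_of_all _ fun ξ => ?_)
    · exact (hφm.mul (measurable_truncLaplace.comp (by fun_prop))).aestronglyMeasurable
    · rw [norm_mul]
      refine mul_le_mul (hφ ξ) ?_ (norm_nonneg _) ((abs_nonneg _).trans (hφ ξ))
      rw [Real.norm_eq_abs, abs_of_nonneg (truncLaplace_nonneg hε)]
      exact truncLaplace_le hγ hε (by positivity)
  have key : ∀ x : V, cosTransform
      (fun ξ : V => (φ ξ * truncLaplace γ ε (‖ξ‖ ^ 2)) * Real.exp (-δ * ‖ξ‖ ^ 2)) x =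
      ∫ s in Set.Ioi ε, s ^ (-1 - γ) *
        cosTransform (fun ξ : V => φ ξ * Real.exp (-(δ + s) * ‖ξ‖ ^ 2)) x ∧
      IntegrableOn (fun s => s ^ (-1 - γ) *
        cosTransform (fun ξ : V => φ ξ * Real.exp (-(δ + s) * ‖ξ‖ ^ 2)) x) (Set.Ioi ε) := by
    intro x
    set F : V → ℝ → ℝ := fun ξ s => Real.cos (inner ℝ x ξ) * φ ξ * Real.exp (-s * ‖ξ‖ ^ 2) *
      (Real.exp (-δ * ‖ξ‖ ^ 2) * s ^ (-1 - γ)) with hF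
    have hFi : Integrable (Function.uncurry F) (volume.prod (volume.restrict (Set.Ioi ε))) := by
      refine ((integrable_exp_neg_mul_norm_sq hδ).mul_prod
        (integrableOn_rpow_neg_one_sub hγ hε)).bdd_mul (c := C) ?_ ?_
      · exact Measurable.aestronglyMeasurable (by fun_prop)
      · have : ∀ᵐ z : V × ℝ ∂(volume.prod (volume.restrict (Set.Ioi ε))), z.2 ∈ Set.Ioi ε :=
          Measure.quasiMeasurePreserving_snd.ae (ae_restrict_mem measurableSet_Ioi)
        filter_upwards [this] with z hz
        have hz' : 0 < z.2 := hε.trans hz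
        rw [norm_mul, norm_mul]
        have h1 : ‖Real.cos (inner ℝ x z.1)‖ ≤ 1 := Real.abs_cos_le_one _
        have h2 : ‖Real.exp (-z.2 * ‖z.1‖ ^ 2)‖ ≤ 1 := by
          rw [Real.norm_eq_abs, Real.abs_exp, Real.exp_le_one_iff]
          have := mul_nonneg hz'.le (sq_nonneg ‖z.1‖)
          linarith
        have h3 : ‖φ z.1‖ ≤ C := hφ z.1
        have hC : 0 ≤ C := (norm_nonneg _).trans h3
        calc _ ≤ 1 * C * 1 := by gcongr
          _ = C := by ring
    have e2 : ∀ s, ∫ ξ, F ξ s = s ^ (-1 - γ) *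
        cosTransform (fun ξ : V => φ ξ * Real.exp (-(δ + s) * ‖ξ‖ ^ 2)) x := by
      intro s
      rw [cosTransform, ← integral_const_mul]
      congr 1; ext ξ
      rw [show -(δ + s) * ‖ξ‖ ^ 2 = -s * ‖ξ‖ ^ 2 + -δ * ‖ξ‖ ^ 2 by ring, Real.exp_add]
      simp only [hF]; ring
    constructor
    · have e1 : ∀ ξ, Real.cos (inner ℝ x ξ) *
          ((φ ξ * truncLaplace γ ε (‖ξ‖ ^ 2)) * Real.exp (-δ * ‖ξ‖ ^ 2)) =
          ∫ s in Set.Ioi ε, F ξ s := by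
        intro ξ
        rw [truncLaplace, ← integral_const_mul, ← integral_mul_const, ← integral_const_mul]
        congr 1; ext s; simp only [hF]; ring
      rw [cosTransform]
      simp_rw [e1]
      rw [integral_integral_swap hFi]
      simp_rw [e2]
    · have := hFi.integral_prod_right
      simp only [Function.uncurry] at this
      simp_rw [e2] at this
      exact this
  refine ⟨hint, fun x y hxy => ?_⟩
  rw [(key x).1, (key y).1]
  constructor
  · refine setIntegral_nonneg measurableSet_Ioi fun s hs => ?_
    have hs' : 0 < s := hε.trans hs
    exact mul_nonneg (by positivity) ((h (δ + s) (by linarith)).2 x y hxy).1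
  · refine setIntegral_mono_on (key y).2 (key x).2 measurableSet_Ioi fun s hs => ?_
    have hs' : 0 < s := hε.trans hs
    exact mul_le_mul_of_nonneg_left ((h (δ + s) (by linarith)).2 x y hxy).2 (by positivity)

lemma hasUnimodalCosTransform_truncLaplace_pow {γ ε : ℝ} (hγ : 0 < γ) (hε : 0 < ε) (k : ℕ)
    {δ : ℝ} (hδ : 0 < δ) :
    HasUnimodalCosTransform
      (fun ξ : V => truncLaplace γ ε (‖ξ‖ ^ 2) ^ k * Real.exp (-δ * ‖ξ‖ ^ 2)) := by
  induction k generalizing δ with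
  | zero => simpa using hasUnimodalCosTransform_gaussian hδ
  | succ k ih =>
    simp_rw [pow_succ]
    refine HasUnimodalCosTransform.mul_truncLaplace (C := truncLaplace γ ε 0 ^ k) hγ hε ?_ ?_
      (fun δ hδ => ih hδ) hδ
    · exact (measurable_truncLaplace.comp (by fun_prop)).pow_const k
    · intro ξ
      rw [abs_pow, abs_of_nonneg (truncLaplace_nonneg hε)]
      exact pow_le_pow_left₀ (truncLaplace_nonneg hε) (truncLaplace_le hγ hε (by positivity)) k

/-- The partial sums of the exponential series are nonnegative combinations of the powers treated
above. The cut-off `ε > 0` keeps `truncLaplace` bounded, so a multiple of the Gaussian dominates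
them all. -/
lemma hasUnimodalCosTransform_exp_truncLaplace {γ ε c δ : ℝ} (hγ : 0 < γ) (hε : 0 < ε)
    (hc : 0 ≤ c) (hδ : 0 < δ) :
    HasUnimodalCosTransform (fun ξ : V =>
      Real.exp (c * truncLaplace γ ε (‖ξ‖ ^ 2)) * Real.exp (-δ * ‖ξ‖ ^ 2)) := by
  set m : V → ℝ := fun ξ => c * truncLaplace γ ε (‖ξ‖ ^ 2)
  have hm : ∀ ξ, 0 ≤ m ξ := fun ξ => mul_nonneg hc (truncLaplace_nonneg hε)
  have hm' : ∀ ξ, m ξ ≤ c * truncLaplace γ ε 0 := fun ξ =>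
    mul_le_mul_of_nonneg_left (truncLaplace_le hγ hε (by positivity)) hc
  refine HasUnimodalCosTransform.of_tendsto
    (φ := fun N ξ => (∑ k ∈ Finset.range N, m ξ ^ k / k.factorial) * Real.exp (-δ * ‖ξ‖ ^ 2))
    (g := fun ξ => Real.exp (c * truncLaplace γ ε 0) * Real.exp (-δ * ‖ξ‖ ^ 2)) ?_
    ((integrable_exp_neg_mul_norm_sq hδ).const_mul _) ?_ ?_
  · intro N
    induction N with
    | zero =>
      simpa using (hasUnimodalCosTransform_gaussian (V := V) hδ).const_mul le_rfl
    | succ N ih =>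
      have := ih.add ((hasUnimodalCosTransform_truncLaplace_pow (V := V) hγ hε N hδ).const_mul
        (c := c ^ N / N.factorial) (by positivity))
      convert this using 2 with ξ
      rw [Finset.sum_range_succ]
      simp only [m]
      rw [mul_pow]; ring
  · intro N ξ
    have h0 : 0 ≤ ∑ k ∈ Finset.range N, m ξ ^ k / k.factorial :=
      Finset.sum_nonneg fun k _ => div_nonneg (pow_nonneg (hm ξ) k) (by positivity)
    rw [abs_of_nonneg (mul_nonneg h0 (Real.exp_pos _).le)]
    gcongr
    exact (Real.sum_le_exp_of_nonneg (hm ξ) N).trans (Real.exp_le_exp.2 (hm' ξ))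
  · intro ξ
    refine Tendsto.mul_const _ ?_
    have := (NormedSpace.expSeries_div_hasSum_exp (𝔸 := ℝ) (m ξ)).tendsto_sum_nat
    rwa [← Real.exp_eq_exp_ℝ] at this

end CosTransform

/-! ### The fractional exponential has a unimodal cosine transform -/

/-- Near `0` the bound `1 - exp (-s l) ≤ s l` leaves `s ^ (-γ)`, integrable since `γ < 1`; at
infinity `s ^ (-1 - γ)` is integrable since `γ > 0`. -/
lemma integrableOn_one_sub_exp_mul_rpow {γ l : ℝ} (hγ : 0 < γ) (hγ1 : γ < 1) (hl : 0 ≤ l) :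
    IntegrableOn (fun s : ℝ => (1 - Real.exp (-s * l)) * s ^ (-1 - γ)) (Set.Ioi 0) := by
  have hm : Measurable (fun s : ℝ => (1 - Real.exp (-s * l)) * s ^ (-1 - γ)) := by fun_prop
  rw [← Set.Ioc_union_Ioi_eq_Ioi (zero_le_one' ℝ), integrableOn_union]
  constructor
  · have h1 : IntegrableOn (fun s : ℝ => l * s ^ (-γ)) (Set.Ioc 0 1) := by
      have := (intervalIntegral.intervalIntegrable_rpow' (a := 0) (b := 1)
        (show -1 < -γ by linarith)).const_mul l
      rwa [intervalIntegrable_iff_integrableOn_Ioc_of_le zero_le_one] at this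
    refine Integrable.mono' h1 hm.aestronglyMeasurable ?_
    refine (ae_restrict_iff' measurableSet_Ioc).2 (ae_of_all _ fun s hs => ?_)
    have hs0 : 0 < s := hs.1
    have hsl : 0 ≤ s * l := by positivity
    have h2 : 0 ≤ 1 - Real.exp (-s * l) := by
      rw [sub_nonneg, Real.exp_le_one_iff]; linarith
    have h3 : 1 - Real.exp (-s * l) ≤ s * l := by
      have := Real.add_one_le_exp (-s * l); linarith
    rw [Real.norm_eq_abs, abs_of_nonneg (by positivity)]
    calc (1 - Real.exp (-s * l)) * s ^ (-1 - γ) ≤ (s * l) * s ^ (-1 - γ) := by gcongr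
      _ = l * (s ^ (1 : ℝ) * s ^ (-1 - γ)) := by rw [Real.rpow_one]; ring
      _ = l * s ^ (-γ) := by rw [← Real.rpow_add hs0]; congr 2; ring
  · refine Integrable.mono' (integrableOn_rpow_neg_one_sub hγ one_pos)
      hm.aestronglyMeasurable ?_
    refine (ae_restrict_iff' measurableSet_Ioi).2 (ae_of_all _ fun s hs => ?_)
    have hs0 : 0 < s := one_pos.trans hs
    have hsl : 0 ≤ s * l := by positivity
    have h2 : 0 ≤ 1 - Real.exp (-s * l) := by
      rw [sub_nonneg, Real.exp_le_one_iff]; linarith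
    rw [Real.norm_eq_abs, abs_of_nonneg (by positivity)]
    have h3 : 1 - Real.exp (-s * l) ≤ 1 := by linarith [Real.exp_pos (-s * l)]
    calc (1 - Real.exp (-s * l)) * s ^ (-1 - γ) ≤ 1 * s ^ (-1 - γ) := by gcongr
      _ = _ := one_mul _

/-- The substitution `s ↦ l * s` extracts `l ^ γ`. This represents a fractional power through
exponentials, which become Gaussians for `l = ‖ξ‖ ^ 2`. -/
lemma integral_one_sub_exp_mul_rpow {γ l : ℝ} (hγ : 0 < γ) (hl : 0 ≤ l) :
    ∫ s in Set.Ioi (0 : ℝ), (1 - Real.exp (-s * l)) * s ^ (-1 - γ) =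
      l ^ γ * ∫ s in Set.Ioi (0 : ℝ), (1 - Real.exp (-s)) * s ^ (-1 - γ) := by
  rcases hl.eq_or_lt with rfl | hl
  · simp [Real.zero_rpow hγ.ne']
  have := integral_comp_mul_left_Ioi
    (fun s : ℝ => l ^ (1 + γ) * ((1 - Real.exp (-s)) * s ^ (-1 - γ))) 0 hl
  rw [mul_zero, integral_const_mul, integral_const_mul, smul_eq_mul, ← mul_assoc] at this
  have e : l⁻¹ * l ^ (1 + γ) = l ^ γ := by
    rw [Real.rpow_add hl, Real.rpow_one, ← mul_assoc, inv_mul_cancel₀ hl.ne', one_mul]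
  rw [e] at this
  rw [← this, ← integral_const_mul]
  refine setIntegral_congr_fun measurableSet_Ioi fun s hs => ?_
  have hs0 : 0 < s := hs
  have e2 : l ^ (1 + γ) * l ^ (-1 - γ) = 1 := by
    rw [← Real.rpow_add hl]; simp
  rw [Real.mul_rpow hl.le hs0.le, show -s * l = -(l * s) by ring]
  linear_combination (-(1 - Real.exp (-(l * s))) * s ^ (-1 - γ)) * e2

lemma integral_one_sub_exp_pos {γ : ℝ} (hγ : 0 < γ) (hγ1 : γ < 1) :
    0 < ∫ s in Set.Ioi (0 : ℝ), (1 - Real.exp (-s)) * s ^ (-1 - γ) := by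
  have hi := integrableOn_one_sub_exp_mul_rpow hγ hγ1 zero_le_one
  simp only [mul_one] at hi
  have hpos : ∀ s ∈ Set.Ioi (0 : ℝ), 0 < (1 - Real.exp (-s)) * s ^ (-1 - γ) := fun s hs => by
    have hs0 : 0 < s := hs
    have : 0 < 1 - Real.exp (-s) := by rw [sub_pos, Real.exp_lt_one_iff]; linarith
    positivity
  rw [setIntegral_pos_iff_support_of_nonneg_ae
    ((ae_restrict_iff' measurableSet_Ioi).2 (ae_of_all _ fun s hs => (hpos s hs).le)) hi]
  have : Set.Ioi (0 : ℝ) ⊆ Function.support (fun s : ℝ => (1 - Real.exp (-s)) * s ^ (-1 - γ)) :=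
    fun s hs => (hpos s hs).ne'
  rw [Set.inter_eq_self_of_subset_right this]
  simp

/-- The difference is the integral of `(1 - exp (-s l)) s ^ (-1 - γ)` over `s > 1 / (k + 1)`. Each
term alone diverges as the cut-off is removed; only the difference has a limit. -/
lemma tendsto_truncLaplace {γ l : ℝ} (hγ : 0 < γ) (hγ1 : γ < 1) (hl : 0 ≤ l) :
    Tendsto (fun k : ℕ => truncLaplace γ (1 / ((k : ℝ) + 1)) 0 - truncLaplace γ (1 / ((k :
        ℝ) + 1)) l)
      atTop (𝓝 (l ^ γ * ∫ s in Set.Ioi (0 : ℝ), (1 - Real.exp (-s)) * s ^ (-1 - γ))) := by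
  rw [← integral_one_sub_exp_mul_rpow hγ hl]
  have hU : (⋃ k : ℕ, Set.Ioi (1 / ((k : ℝ) + 1))) = Set.Ioi (0 : ℝ) := by
    ext s
    simp only [Set.mem_iUnion, Set.mem_Ioi]
    exact ⟨fun ⟨k, hk⟩ => lt_trans (by positivity) hk, fun hs => exists_nat_one_div_lt hs⟩
  have h := tendsto_setIntegral_of_monotone (μ := volume) (s := fun k : ℕ => Set.Ioi (1 / ((k :
      ℝ) + 1)))
    (f := fun s : ℝ => (1 - Real.exp (-s * l)) * s ^ (-1 - γ))
    (fun k => measurableSet_Ioi)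
    (fun i j hij => Set.Ioi_subset_Ioi (by gcongr))
    (by rw [hU]; exact integrableOn_one_sub_exp_mul_rpow hγ hγ1 hl)
  rw [hU] at h
  refine h.congr fun k => ?_
  have hk : (0 : ℝ) < 1 / ((k : ℝ) + 1) := by positivity
  rw [truncLaplace, truncLaplace, ← integral_sub (integrableOn_exp_mul_rpow hγ hk le_rfl)
    (integrableOn_exp_mul_rpow hγ hk hl)]
  congr 1; ext s
  simp; ring

section Fractional

variable {V : Type*} [NormedAddCommGroup V] [InnerProductSpace ℝ V] [FiniteDimensional ℝ V]
  [MeasurableSpace V] [BorelSpace V]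

/-- With `γ = β / 2 < 1` and a suitable `c`, the exponent `-t ‖ξ‖ ^ β` is the limit of `c
(truncLaplace (‖ξ‖ ^ 2) - truncLaplace 0)`. Its second term contributes only a positive constant
factor. For `β = 2`, where `γ = 1` makes the formula fail, the function is itself a Gaussian. -/
lemma hasUnimodalCosTransform_exp_rpow_mul_gaussian {β t δ : ℝ} (hβ : 0 < β) (hβ2 : β ≤ 2)
    (ht : 0 < t) (hδ : 0 < δ) :
    HasUnimodalCosTransform
      (fun ξ : V => Real.exp (-(t * ‖ξ‖ ^ β)) * Real.exp (-δ * ‖ξ‖ ^ 2)) := by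
  rcases hβ2.eq_or_lt with rfl | hβ2
  · convert hasUnimodalCosTransform_gaussian (V := V) (add_pos ht hδ) using 2 with ξ
    rw [← Real.exp_add, Real.rpow_two]; ring_nf
  set γ := β / 2 with hγdef
  have hγ : 0 < γ := by positivity
  have hγ1 : γ < 1 := by rw [hγdef]; linarith
  set C := ∫ s in Set.Ioi (0 : ℝ), (1 - Real.exp (-s)) * s ^ (-1 - γ) with hC
  have hCpos : 0 < C := integral_one_sub_exp_pos hγ hγ1
  set c := t / C with hcdef
  have hc : 0 < c := by positivity
  refine HasUnimodalCosTransform.of_tendsto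
    (φ := fun (k : ℕ) ξ => Real.exp (-(c * truncLaplace γ (1 / ((k : ℝ) + 1)) 0)) *
      (Real.exp (c * truncLaplace γ (1 / ((k : ℝ) + 1)) (‖ξ‖ ^ 2)) * Real.exp (-δ * ‖ξ‖ ^ 2)))
    (g := fun ξ => Real.exp (-δ * ‖ξ‖ ^ 2)) ?_ (integrable_exp_neg_mul_norm_sq hδ) ?_ ?_
  · intro k
    exact (hasUnimodalCosTransform_exp_truncLaplace hγ (by positivity) hc.le hδ).const_mul
      (Real.exp_pos _).le
  · intro k ξ
    rw [abs_of_nonneg (by positivity), ← mul_assoc, ← Real.exp_add]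
    have h := truncLaplace_le hγ (show (0 : ℝ) < 1 / ((k : ℝ) + 1) by positivity)
      (show (0 : ℝ) ≤ ‖ξ‖ ^ 2 by positivity)
    calc _ ≤ 1 * Real.exp (-δ * ‖ξ‖ ^ 2) := by
          gcongr
          rw [Real.exp_le_one_iff]
          have := mul_le_mul_of_nonneg_left h hc.le
          linarith
      _ = _ := one_mul _
  · intro ξ
    simp_rw [← mul_assoc, ← Real.exp_add]
    refine (Real.continuous_exp.tendsto _).comp (Tendsto.add_const _ ?_)
    have h := ((tendsto_truncLaplace hγ hγ1 (show (0 : ℝ) ≤ ‖ξ‖ ^ 2 by positivity)).const_mul c).neg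
    have e : -(c * ((‖ξ‖ ^ 2) ^ γ * C)) = -(t * ‖ξ‖ ^ β) := by
      rw [hcdef, ← Real.rpow_natCast, ← Real.rpow_mul (norm_nonneg _), hγdef]
      rw [show ((2 : ℕ) : ℝ) * (β / 2) = β by push_cast; ring]
      field_simp
    rw [e] at h
    refine h.congr fun k => ?_
    ring

lemma integrable_exp_neg_mul_norm_rpow [Nontrivial V] {β t : ℝ} (hβ : 0 < β) (ht : 0 < t) :
    Integrable (fun ξ : V => Real.exp (-(t * ‖ξ‖ ^ β))) := by
  refine (integrable_fun_norm_addHaar volume (f := fun r => Real.exp (-(t * r ^ β)))).2 ?_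
  have h := integrableOn_rpow_mul_exp_neg_mul_rpow (p := β) (b := t)
    (s := ((Module.finrank ℝ V - 1 : ℕ) : ℝ)) (by
      have : (0 : ℝ) ≤ ((Module.finrank ℝ V - 1 : ℕ) : ℝ) := by positivity
      linarith) hβ ht
  refine h.congr_fun (fun r hr => ?_) measurableSet_Ioi
  simp only [Real.rpow_natCast, smul_eq_mul, neg_mul]

lemma hasUnimodalCosTransform_exp_rpow [Nontrivial V] {β t : ℝ} (hβ : 0 < β) (hβ2 : β ≤ 2)
    (ht : 0 < t) :
    HasUnimodalCosTransform (fun ξ : V => Real.exp (-(t * ‖ξ‖ ^ β))) := by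
  refine HasUnimodalCosTransform.of_tendsto
    (φ := fun (k : ℕ) ξ => Real.exp (-(t * ‖ξ‖ ^ β)) * Real.exp (-(1 / ((k : ℝ) + 1)) * ‖ξ‖ ^ 2))
    (g := fun ξ => Real.exp (-(t * ‖ξ‖ ^ β))) ?_ (integrable_exp_neg_mul_norm_rpow hβ ht) ?_ ?_
  · exact fun k => hasUnimodalCosTransform_exp_rpow_mul_gaussian hβ hβ2 ht (by positivity)
  · intro k ξ
    rw [abs_of_nonneg (by positivity)]
    refine mul_le_of_le_one_right (Real.exp_pos _).le ?_
    rw [Real.exp_le_one_iff]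
    have : (0 : ℝ) ≤ (1 / ((k : ℝ) + 1)) * ‖ξ‖ ^ 2 := by positivity
    linarith
  · intro ξ
    have h : Tendsto (fun k : ℕ => -(1 / ((k : ℝ) + 1)) * ‖ξ‖ ^ 2) atTop (𝓝 0) := by
      simpa using (tendsto_one_div_add_atTop_nhds_zero_nat (𝕜 := ℝ)).neg.mul_const (‖ξ‖ ^ 2)
    have := ((Real.continuous_exp.tendsto 0).comp h).const_mul (Real.exp (-(t * ‖ξ‖ ^ β)))
    simpa using this

end Fractional

/-! ### The fractional heat kernel -/

section CosInversion

variable {V : Type*} [NormedAddCommGroup V] [InnerProductSpace ℝ V] [FiniteDimensional ℝ V]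
  [MeasurableSpace V] [BorelSpace V]

lemma integrable_sin_mul {φ : V → ℝ} (h : Integrable φ) (x : V) :
    Integrable (fun ξ => Real.sin (inner ℝ x ξ) * φ ξ) := by
  refine h.bdd_mul (c := 1) ?_ (ae_of_all _ fun ξ => ?_)
  · exact (by fun_prop : Continuous fun ξ : V => Real.sin (inner ℝ x ξ)).aestronglyMeasurable
  · exact Real.abs_sin_le_one _

lemma integral_sin_mul_eq_zero {φ : V → ℝ} (he : ∀ ξ, φ (-ξ) = φ ξ) (x : V) :
    ∫ ξ, Real.sin (inner ℝ x ξ) * φ ξ = 0 := by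
  have h := integral_neg_eq_self (fun ξ => Real.sin (inner ℝ x ξ) * φ ξ) (volume : Measure V)
  simp only [inner_neg_right, Real.sin_neg, he, neg_mul, integral_neg] at h
  linarith

lemma integral_cexp_mul_eq_cosTransform {φ : V → ℝ} (h : Integrable φ) (he : ∀ ξ, φ (-ξ) = φ ξ)
    (x : V) :
    ∫ ξ, Complex.exp (((inner ℝ x ξ : ℝ) : ℂ) * Complex.I) * (φ ξ : ℂ) = cosTransform φ x := by
  have e : ∀ ξ, Complex.exp (((inner ℝ x ξ : ℝ) : ℂ) * Complex.I) * (φ ξ : ℂ) =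
      ((Real.cos (inner ℝ x ξ) * φ ξ : ℝ) : ℂ) +
        ((Real.sin (inner ℝ x ξ) * φ ξ : ℝ) : ℂ) * Complex.I := by
    intro ξ
    rw [Complex.exp_mul_I]; push_cast; ring
  simp_rw [e]
  rw [integral_add (integrable_cos_mul h x).ofReal ((integrable_sin_mul h x).ofReal.mul_const _),
    integral_mul_const, integral_complex_ofReal, integral_complex_ofReal,
    integral_sin_mul_eq_zero he]
  simp [cosTransform]

lemma cosTransform_neg (φ : V → ℝ) (x : V) : cosTransform φ (-x) = cosTransform φ x := by
  simp [cosTransform, inner_neg_left]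

lemma continuous_cosTransform {φ : V → ℝ} (h : Integrable φ) : Continuous (cosTransform φ) := by
  refine continuous_of_dominated (bound := fun ξ => |φ ξ|)
    (fun x => (integrable_cos_mul h x).aestronglyMeasurable) (fun x => ae_of_all _ fun ξ => ?_)
    h.abs (ae_of_all _ fun ξ => by fun_prop)
  rw [norm_mul]
  exact mul_le_of_le_one_left (norm_nonneg _) (Real.abs_cos_le_one _)

/-- Fubini moves the transform onto the Gaussian, and `φ ≤ 1` leaves a full Gaussian integral in
which the powers of `ε` cancel. The uniformity in `ε` is the point. -/
lemma integral_cosTransform_mul_gaussian_le {φ : V → ℝ} (h : Integrable φ) (h0 : ∀ ξ, 0 ≤ φ ξ)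
    (h1 : ∀ ξ, φ ξ ≤ 1) {ε : ℝ} (hε : 0 < ε) :
    ∫ x, cosTransform φ x * Real.exp (-ε * ‖x‖ ^ 2) ≤ (4 * Real.pi ^ 2) ^ (Module.finrank ℝ V / 2 :
        ℝ) := by
  have hF : Integrable (Function.uncurry fun x ξ : V =>
      Real.cos (inner ℝ x ξ) * (Real.exp (-ε * ‖x‖ ^ 2) * φ ξ)) (volume.prod volume) := by
    refine ((integrable_exp_neg_mul_norm_sq hε).mul_prod h).bdd_mul (c := 1) ?_
      (ae_of_all _ fun z => Real.abs_cos_le_one _)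
    exact (by fun_prop : Continuous fun z : V × V => Real.cos
        (inner ℝ z.1 z.2)).aestronglyMeasurable
  have e1 : ∀ x, cosTransform φ x * Real.exp (-ε * ‖x‖ ^ 2) =
      ∫ ξ, Real.cos (inner ℝ x ξ) * (Real.exp (-ε * ‖x‖ ^ 2) * φ ξ) := by
    intro x
    rw [cosTransform, ← integral_mul_const]
    congr 1; ext ξ; ring
  simp_rw [e1]
  rw [integral_integral_swap hF]
  have e2 : ∀ ξ, ∫ x, Real.cos (inner ℝ x ξ) * (Real.exp (-ε * ‖x‖ ^ 2) * φ ξ) =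
      φ ξ * ((Real.pi / ε) ^ (Module.finrank ℝ V / 2 : ℝ) *
        Real.exp (-(1 / (4 * ε)) * ‖ξ‖ ^ 2)) := by
    intro ξ
    have := cosTransform_gaussian hε ξ
    rw [show -(1 / (4 * ε)) * ‖ξ‖ ^ 2 = -(‖ξ‖ ^ 2 / (4 * ε)) by ring, ← this, cosTransform,
      ← integral_const_mul]
    congr 1; ext x; rw [real_inner_comm]; ring
  simp_rw [e2]
  have hg := (integrable_exp_neg_mul_norm_sq (V := V) (show 0 < 1 /
      (4 * ε) by positivity)).const_mul
      ((Real.pi / ε) ^ (Module.finrank ℝ V / 2 : ℝ))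
  calc _ ≤ ∫ ξ : V, (Real.pi / ε) ^ (Module.finrank ℝ V / 2 : ℝ) *
        Real.exp (-(1 / (4 * ε)) * ‖ξ‖ ^ 2) := by
        refine integral_mono_of_nonneg (ae_of_all _ fun ξ => mul_nonneg (h0 ξ) (by positivity)) hg
          (ae_of_all _ fun ξ => mul_le_of_le_one_left (by positivity) (h1 ξ))
    _ = _ := by
        rw [integral_const_mul, GaussianFourier.integral_rexp_neg_mul_sq_norm (by positivity),
          ← Real.mul_rpow (by positivity) (by positivity)]
        congr 1; field_simp

/-- For a nonnegative transform, Fatou's lemma removes the Gaussian regularisation from the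
preceding uniform bound. Integrability is what Fourier inversion needs. -/
lemma integrable_cosTransform {φ : V → ℝ} (h : Integrable φ) (h0 : ∀ ξ, 0 ≤ φ ξ)
    (h1 : ∀ ξ, φ ξ ≤ 1) (hpos : ∀ x, 0 ≤ cosTransform φ x) : Integrable (cosTransform φ) := by
  have hc := continuous_cosTransform h
  refine ⟨hc.aestronglyMeasurable, ?_⟩
  rw [hasFiniteIntegral_iff_ofReal (ae_of_all _ hpos)]
  have hlim : ∀ x : V, Tendsto (fun k : ℕ => ENNReal.ofReal
      (cosTransform φ x * Real.exp (-(1 / ((k : ℝ) + 1)) * ‖x‖ ^ 2))) atTop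
      (𝓝 (ENNReal.ofReal (cosTransform φ x))) := by
    intro x
    refine ENNReal.tendsto_ofReal ?_
    have h : Tendsto (fun k : ℕ => -(1 / ((k : ℝ) + 1)) * ‖x‖ ^ 2) atTop (𝓝 0) := by
      simpa using (tendsto_one_div_add_atTop_nhds_zero_nat (𝕜 := ℝ)).neg.mul_const (‖x‖ ^ 2)
    simpa using ((Real.continuous_exp.tendsto 0).comp h).const_mul (cosTransform φ x)
  have hle : ∀ k : ℕ, ∫⁻ x : V, ENNReal.ofReal
      (cosTransform φ x * Real.exp (-(1 / ((k : ℝ) + 1)) * ‖x‖ ^ 2)) ≤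
      ENNReal.ofReal ((4 * Real.pi ^ 2) ^ (Module.finrank ℝ V / 2 : ℝ)) := by
    intro k
    have hk : (0 : ℝ) < 1 / ((k : ℝ) + 1) := by positivity
    rw [← ofReal_integral_eq_lintegral_ofReal]
    · exact ENNReal.ofReal_le_ofReal (integral_cosTransform_mul_gaussian_le h h0 h1 hk)
    · refine (integrable_exp_neg_mul_norm_sq hk).bdd_mul (c := ∫ ξ, φ ξ) hc.aestronglyMeasurable
        (ae_of_all _ fun x => ?_)
      refine (norm_integral_le_integral_norm _).trans (integral_mono_of_nonneg
        (ae_of_all _ fun ξ => norm_nonneg _) h (ae_of_all _ fun ξ => ?_))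
      simp only [norm_mul, Real.norm_eq_abs, abs_of_nonneg (h0 ξ)]
      exact mul_le_of_le_one_left (h0 ξ) (Real.abs_cos_le_one _)
    · exact ae_of_all _ fun x => mul_nonneg (hpos x) (Real.exp_pos _).le
  calc ∫⁻ x, ENNReal.ofReal (cosTransform φ x)
      = ∫⁻ x : V, liminf (fun k : ℕ => ENNReal.ofReal
        (cosTransform φ x * Real.exp (-(1 / ((k : ℝ) + 1)) * ‖x‖ ^ 2))) atTop := by
        congr 1; ext x; exact (hlim x).liminf_eq.symm
    _ ≤ liminf (fun k : ℕ => ∫⁻ x : V, ENNReal.ofReal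
        (cosTransform φ x * Real.exp (-(1 / ((k : ℝ) + 1)) * ‖x‖ ^ 2))) atTop :=
        lintegral_liminf_le fun k => (by fun_prop)
    _ ≤ ENNReal.ofReal ((4 * Real.pi ^ 2) ^ (Module.finrank ℝ V / 2 : ℝ)) :=
        liminf_le_of_le (by isBoundedDefault) fun b hb => by
          obtain ⟨k, hk⟩ := hb.exists
          exact hk.trans (hle k)
    _ < ∞ := ENNReal.ofReal_lt_top

open FourierTransform in
-- Fourier inversion. Evenness kills the sine parts, and the dilation by `2 * π` between the two
-- conventions for the frequency produces the constant.
lemma cosTransform_cosTransform {φ : V → ℝ} (hφ : Continuous φ) (h : Integrable φ)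
    (he : ∀ ξ, φ (-ξ) = φ ξ) (hi : Integrable (cosTransform φ)) (ξ : V) :
    cosTransform (cosTransform φ) ξ = (2 * Real.pi) ^ Module.finrank ℝ V * φ ξ := by
  have hπ : (0 : ℝ) < 2 * Real.pi := by positivity
  set f : V → ℂ := fun ξ => (φ ξ : ℂ) with hf
  have hF : ∀ w, 𝓕 f w = (cosTransform φ ((2 * Real.pi) • w) : ℂ) := by
    intro w
    rw [Real.fourier_eq', ← cosTransform_neg, ← integral_cexp_mul_eq_cosTransform h he]
    congr 1; ext v
    simp only [smul_eq_mul, hf]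
    congr 3
    rw [inner_neg_left, inner_smul_left, real_inner_comm]
    simp
  have hi' : Integrable (fun w : V => cosTransform φ ((2 * Real.pi) • w)) :=
    hi.comp_smul hπ.ne'
  have hinv : 𝓕⁻ (𝓕 f) ξ = f ξ := by
    refine h.ofReal.fourierInv_fourier_eq ?_ (by fun_prop)
    rw [show 𝓕 f = fun w => (cosTransform φ ((2 * Real.pi) • w) : ℂ) from funext hF]
    exact hi'.ofReal
  rw [Real.fourierInv_eq'] at hinv
  have e : ∫ v : V, Complex.exp (↑(2 * Real.pi * inner ℝ v ξ) * Complex.I) • 𝓕 f v =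
      (cosTransform (fun w : V => cosTransform φ ((2 * Real.pi) • w)) ((2 * Real.pi) • ξ) : ℂ) := by
    rw [← integral_cexp_mul_eq_cosTransform hi' (fun w => by rw [smul_neg, cosTransform_neg])]
    congr 1; ext v
    rw [hF, smul_eq_mul, inner_smul_left, real_inner_comm]
    simp
  rw [e] at hinv
  have e2 : cosTransform (fun w : V => cosTransform φ ((2 * Real.pi) • w))
      ((2 * Real.pi) • ξ) = φ ξ := by
    exact Complex.ofReal_injective hinv
  rw [← e2]
  have := Measure.integral_comp_smul (volume : Measure V)
    (fun x => Real.cos (inner ℝ ξ x) * cosTransform φ x) (2 * Real.pi)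
  simp only [smul_eq_mul] at this
  have e3 : cosTransform (fun w : V => cosTransform φ ((2 * Real.pi) • w)) ((2 * Real.pi) • ξ)
      = ∫ x : V, Real.cos (inner ℝ ξ ((2 * Real.pi) • x)) * cosTransform φ ((2 * Real.pi) • x) := by
    rw [cosTransform]
    congr 1; ext x
    rw [inner_smul_left, inner_smul_right]; simp
  rw [e3, this, abs_of_nonneg (by positivity), ← mul_assoc, mul_inv_cancel₀ (by positivity),
      one_mul]
  rfl

end CosInversion

/-! ### The kernel on `ℝⁿ`: sign, monotonicity, mass, scaling, semigroup law. -/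

section HeatKernel

variable {n : ℕ}

/-- The Euclidean space `ℝⁿ`. -/
abbrev Euc (n : ℕ) := EuclideanSpace ℝ (Fin n)

/-- The symbol `exp (-t |ξ| ^ β)`. -/
def heatSymbol (β t : ℝ) (ξ : Euc n) : ℝ := Real.exp (-(t * ‖ξ‖ ^ β))

lemma heatSymbol_neg (β t : ℝ) (ξ : Euc n) : heatSymbol β t (-ξ) = heatSymbol β t ξ := by
  simp [heatSymbol]

lemma heatSymbol_pos (β t : ℝ) (ξ : Euc n) : 0 < heatSymbol β t ξ := Real.exp_pos _

lemma heatSymbol_le_one {β t : ℝ} (ht : 0 ≤ t) (ξ : Euc n) : heatSymbol β t ξ ≤ 1 := by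
  rw [heatSymbol, Real.exp_le_one_iff]
  have : 0 ≤ t * ‖ξ‖ ^ β := by positivity
  linarith

lemma continuous_heatSymbol {β : ℝ} (hβ : 0 < β) (t : ℝ) :
    Continuous (heatSymbol β t : Euc n → ℝ) := by
  unfold heatSymbol
  have : Continuous fun ξ : Euc n => ‖ξ‖ ^ β := continuous_norm.rpow_const fun _ => Or.inr hβ.le
  fun_prop

lemma integrable_heatSymbol [NeZero n] {β t : ℝ} (hβ : 0 < β) (ht : 0 < t) :
    Integrable (heatSymbol β t : Euc n → ℝ) :=
  integrable_exp_neg_mul_norm_rpow hβ ht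

lemma fracHeatKernel_eq [NeZero n] {β t : ℝ} (hβ : 0 < β) (ht : 0 < t) (x : Euc n) :
    fracHeatKernel β t x = ((2 * Real.pi) ^ n)⁻¹ * cosTransform (heatSymbol β t) x := by
  rw [fracHeatKernel]
  congr 1
  have := integral_cexp_mul_eq_cosTransform (integrable_heatSymbol (n := n) hβ ht)
    (heatSymbol_neg β t) x
  have e : ∀ ξ : Euc n,
      Complex.exp (Complex.I * ((inner ℝ x ξ : ℝ) : ℂ) - ((t * ‖ξ‖ ^ β : ℝ) : ℂ)) =
      Complex.exp (((inner ℝ x ξ : ℝ) : ℂ) * Complex.I) * (heatSymbol β t ξ : ℂ) := by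
    intro ξ
    rw [heatSymbol, Complex.ofReal_exp, ← Complex.exp_add]
    congr 1; push_cast; ring
  simp_rw [e]
  rw [this, Complex.ofReal_re]

lemma fracHeatKernel_eq_fun [NeZero n] {β t : ℝ} (hβ : 0 < β) (ht : 0 < t) :
    (fracHeatKernel β t : Euc n → ℝ) =
      fun x => ((2 * Real.pi) ^ n)⁻¹ * cosTransform (heatSymbol β t) x :=
  funext fun x => fracHeatKernel_eq hβ ht x

lemma fracHeatKernel_nonneg [NeZero n] {β t : ℝ} (hβ : 0 < β) (hβ2 : β ≤ 2) (ht : 0 < t)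
    (x : Euc n) : 0 ≤ fracHeatKernel β t x := by
  rw [fracHeatKernel_eq hβ ht]
  exact mul_nonneg (by positivity)
    ((hasUnimodalCosTransform_exp_rpow (V := Euc n) hβ hβ2 ht).2 x x le_rfl).1

lemma fracHeatKernel_anti [NeZero n] {β t : ℝ} (hβ : 0 < β) (hβ2 : β ≤ 2) (ht : 0 < t)
    {x y : Euc n} (h : ‖x‖ ≤ ‖y‖) : fracHeatKernel β t y ≤ fracHeatKernel β t x := by
  rw [fracHeatKernel_eq hβ ht, fracHeatKernel_eq hβ ht]
  exact mul_le_mul_of_nonneg_left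
    ((hasUnimodalCosTransform_exp_rpow (V := Euc n) hβ hβ2 ht).2 x y h).2 (by positivity)

lemma fracHeatKernel_neg [NeZero n] {β t : ℝ} (hβ : 0 < β) (ht : 0 < t)
    (x : Euc n) : fracHeatKernel β t (-x) = fracHeatKernel β t x := by
  rw [fracHeatKernel_eq hβ ht, fracHeatKernel_eq hβ ht, cosTransform_neg]

lemma continuous_fracHeatKernel [NeZero n] {β t : ℝ} (hβ : 0 < β) (ht : 0 < t) :
    Continuous (fracHeatKernel β t : Euc n → ℝ) := by
  rw [fracHeatKernel_eq_fun hβ ht]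
  exact (continuous_cosTransform (integrable_heatSymbol hβ ht)).const_mul _

lemma integrable_fracHeatKernel [NeZero n] {β t : ℝ} (hβ : 0 < β) (hβ2 : β ≤ 2) (ht : 0 < t) :
    Integrable (fracHeatKernel β t : Euc n → ℝ) := by
  rw [fracHeatKernel_eq_fun hβ ht]
  exact (integrable_cosTransform (integrable_heatSymbol hβ ht) (fun ξ => (heatSymbol_pos β t ξ).le)
    (heatSymbol_le_one ht.le)
    (fun x => ((hasUnimodalCosTransform_exp_rpow (V :=
        Euc n) hβ hβ2 ht).2 x x le_rfl).1)).const_mul _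

lemma cosTransform_fracHeatKernel [NeZero n] {β t : ℝ} (hβ : 0 < β) (hβ2 : β ≤ 2) (ht : 0 < t)
    (ξ : Euc n) : cosTransform (fracHeatKernel β t) ξ = heatSymbol β t ξ := by
  have hi := integrable_cosTransform (integrable_heatSymbol (n := n) hβ ht)
    (fun ξ => (heatSymbol_pos β t ξ).le) (heatSymbol_le_one ht.le)
    (fun x => ((hasUnimodalCosTransform_exp_rpow (V := Euc n) hβ hβ2 ht).2 x x le_rfl).1)
  have h := cosTransform_cosTransform (continuous_heatSymbol hβ t) (integrable_heatSymbol (n :=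
      n) hβ ht)
    (heatSymbol_neg β t) hi ξ
  rw [finrank_euclideanSpace_fin] at h
  have e : cosTransform (fracHeatKernel β t) ξ =
      ((2 * Real.pi) ^ n)⁻¹ * cosTransform (cosTransform (heatSymbol β t)) ξ := by
    rw [fracHeatKernel_eq_fun hβ ht, cosTransform, cosTransform, ← integral_const_mul]
    congr 1; ext x; ring
  rw [e, h, ← mul_assoc, inv_mul_cancel₀ (by positivity), one_mul]

lemma integral_fracHeatKernel [NeZero n] {β t : ℝ} (hβ : 0 < β) (hβ2 : β ≤ 2) (ht : 0 < t) :
    ∫ x : Euc n, fracHeatKernel β t x = 1 := by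
  have := cosTransform_fracHeatKernel (n := n) hβ hβ2 ht 0
  simpa [cosTransform, heatSymbol, Real.zero_rpow hβ.ne'] using this

lemma fracHeatKernel_zero_pos [NeZero n] {β t : ℝ} (hβ : 0 < β) (ht : 0 < t) :
    0 < fracHeatKernel β t (0 : Euc n) := by
  rw [fracHeatKernel_eq hβ ht]
  refine mul_pos (by positivity) ?_
  simp only [cosTransform, inner_zero_left, Real.cos_zero, one_mul]
  exact integral_exp_pos (integrable_heatSymbol (n := n) hβ ht)

lemma fracHeatKernel_scaling [NeZero n] {β t : ℝ} (hβ : 0 < β) (ht : 0 < t) (x : Euc n) :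
    fracHeatKernel β t x =
      t ^ (-((n : ℝ) / β)) * fracHeatKernel β 1 (t ^ (-(1 / β)) • x) := by
  rw [fracHeatKernel_eq hβ ht, fracHeatKernel_eq hβ one_pos]
  set R := t ^ (1 / β) with hR
  have hRpos : 0 < R := Real.rpow_pos_of_pos ht _
  have h := Measure.integral_comp_smul (volume : Measure (Euc n))
    (fun ξ => Real.cos (inner ℝ (t ^ (-(1 / β)) • x) ξ) * heatSymbol β 1 ξ) R
  have e : ∀ ξ : Euc n, Real.cos (inner ℝ (t ^ (-(1 / β)) • x) (R • ξ)) * heatSymbol β 1 (R • ξ)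
      = Real.cos (inner ℝ x ξ) * heatSymbol β t ξ := by
    intro ξ
    congr 1
    · congr 1
      rw [inner_smul_left, inner_smul_right, ← mul_assoc]
      simp only [conj_trivial]
      rw [hR, ← Real.rpow_add ht]; simp
    · rw [heatSymbol, heatSymbol, norm_smul, Real.norm_of_nonneg hRpos.le, Real.mul_rpow hRpos.le
          (norm_nonneg _), hR,
        ← Real.rpow_mul ht.le, one_div, inv_mul_cancel₀ hβ.ne', Real.rpow_one, one_mul]
  simp_rw [e] at h
  rw [finrank_euclideanSpace_fin, smul_eq_mul, abs_of_nonneg (by positivity)] at h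
  change cosTransform (heatSymbol β t) x = _ * cosTransform (heatSymbol β 1) _ at h
  rw [h]
  have e2 : (R ^ n)⁻¹ = t ^ (-((n : ℝ) / β)) := by
    rw [hR, ← Real.rpow_natCast, ← Real.rpow_mul ht.le, ← Real.rpow_neg ht.le]
    congr 1; ring
  rw [e2]; ring

lemma integral_fracHeatKernel_sub_mul_cos [NeZero n] {β t : ℝ} (hβ : 0 < β) (hβ2 : β ≤ 2)
    (ht : 0 < t) (x ξ : Euc n) :
    ∫ y, fracHeatKernel β t (x - y) * Real.cos (inner ℝ y ξ) =
      Real.cos (inner ℝ x ξ) * heatSymbol β t ξ := by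
  have hi := integrable_fracHeatKernel (n := n) hβ hβ2 ht
  have h1 := integral_sub_left_eq_self
    (fun z : Euc n => fracHeatKernel β t z * Real.cos (inner ℝ (x - z) ξ)) volume x
  simp only [sub_sub_cancel] at h1
  rw [h1]
  have e : ∀ z : Euc n, fracHeatKernel β t z * Real.cos (inner ℝ (x - z) ξ) =
      Real.cos (inner ℝ x ξ) * (Real.cos (inner ℝ ξ z) * fracHeatKernel β t z) +
      Real.sin (inner ℝ x ξ) * (Real.sin (inner ℝ ξ z) * fracHeatKernel β t z) := by
    intro z
    rw [inner_sub_left, Real.cos_sub, real_inner_comm z ξ]; ring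
  simp_rw [e]
  rw [integral_add ((integrable_cos_mul hi ξ).const_mul _) ((integrable_sin_mul hi ξ).const_mul _),
    integral_const_mul, integral_const_mul, integral_sin_mul_eq_zero (fracHeatKernel_neg hβ ht),
    mul_zero, add_zero]
  congr 1
  exact cosTransform_fracHeatKernel hβ hβ2 ht ξ

/-- Only the second kernel is written as a transform: the first is integrable in space and the
symbol in frequency, so Fubini applies, and the symbols multiply. -/
lemma integral_fracHeatKernel_mul_fracHeatKernel [NeZero n] {β s t : ℝ} (hβ : 0 < β) (hβ2 : β ≤ 2)
    (hs : 0 < s) (ht : 0 < t) (x : Euc n) :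
    ∫ y, fracHeatKernel β s (x - y) * fracHeatKernel β t y = fracHeatKernel β (s + t) x := by
  have hi : Integrable (fun y : Euc n => fracHeatKernel β s (x - y)) :=
    (integrable_fracHeatKernel hβ hβ2 hs).comp_sub_left x
  set c := ((2 * Real.pi) ^ n)⁻¹ with hc
  have hF : Integrable (Function.uncurry fun y ξ : Euc n => Real.cos (inner ℝ y ξ) *
      (fracHeatKernel β s (x - y) * (heatSymbol β t ξ))) (volume.prod volume) := by
    refine (hi.mul_prod (integrable_heatSymbol hβ ht)).bdd_mul (c := 1) ?_
      (ae_of_all _ fun z => Real.abs_cos_le_one _)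
    exact (by fun_prop : Continuous fun z : Euc n × Euc n =>
      Real.cos (inner ℝ z.1 z.2)).aestronglyMeasurable
  have e1 : ∀ y, fracHeatKernel β s (x - y) * fracHeatKernel β t y = c * ∫ ξ,
      Real.cos (inner ℝ y ξ) * (fracHeatKernel β s (x - y) * (heatSymbol β t ξ)) := by
    intro y
    rw [fracHeatKernel_eq hβ ht, ← hc, cosTransform, mul_left_comm, ← integral_const_mul]
    congr 2; ext ξ; ring
  simp_rw [e1]
  rw [integral_const_mul, integral_integral_swap hF, fracHeatKernel_eq hβ (add_pos hs ht), ← hc,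
    cosTransform]
  congr 2; ext ξ
  have := integral_fracHeatKernel_sub_mul_cos hβ hβ2 hs x ξ
  have e2 : heatSymbol β (s + t) ξ = heatSymbol β s ξ * heatSymbol β t ξ := by
    simp only [heatSymbol]
    rw [← Real.exp_add]; congr 1; ring
  rw [e2, ← mul_assoc, ← this, ← integral_mul_const]
  congr 1; ext y; ring

end HeatKernel

/-! ### Lebesgue norms and convolutions of functions with values in `[0, ∞]` -/

section LpNorm

variable {X : Type*} [MeasurableSpace X] {μ : Measure X}

/-- The `L^s` norm of a function with values in `[0, ∞]`. -/
def lpNrm (μ : Measure X) (s : ℝ) (f : X → ℝ≥0∞) : ℝ≥0∞ := (∫⁻ x, f x ^ s ∂μ) ^ (1 / s)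

lemma lpNrm_rpow {s : ℝ} (hs : 0 < s) (f : X → ℝ≥0∞) : lpNrm μ s f ^ s = ∫⁻ x, f x ^ s ∂μ := by
  rw [lpNrm, ← ENNReal.rpow_mul, one_div, inv_mul_cancel₀ hs.ne', ENNReal.rpow_one]

lemma lpNrm_le_iff {s : ℝ} (hs : 0 < s) {f : X → ℝ≥0∞} {M : ℝ≥0∞} :
    lpNrm μ s f ≤ M ↔ ∫⁻ x, f x ^ s ∂μ ≤ M ^ s := by
  rw [← lpNrm_rpow hs, ENNReal.rpow_le_rpow_iff hs]

lemma lpNrm_mono_ae {s : ℝ} (hs : 0 < s) {f g : X → ℝ≥0∞} (h : f ≤ᵐ[μ] g) :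
    lpNrm μ s f ≤ lpNrm μ s g := by
  unfold lpNrm
  gcongr 1
  exact lintegral_mono_ae (h.mono fun x hx => ENNReal.rpow_le_rpow hx hs.le)

lemma lpNrm_mono {s : ℝ} (hs : 0 < s) {f g : X → ℝ≥0∞} (h : ∀ x, f x ≤ g x) :
    lpNrm μ s f ≤ lpNrm μ s g := lpNrm_mono_ae hs (ae_of_all _ h)

lemma lpNrm_congr_ae {s : ℝ} {f g : X → ℝ≥0∞} (h : f =ᵐ[μ] g) :
    lpNrm μ s f = lpNrm μ s g := by
  unfold lpNrm
  congr 1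
  exact lintegral_congr_ae (h.mono fun x hx => by simp only [hx])

lemma lpNrm_const_mul {s : ℝ} (hs : 0 < s) {f : X → ℝ≥0∞} (hf : Measurable f) (c : ℝ≥0∞) :
    lpNrm μ s (fun x => c * f x) = c * lpNrm μ s f := by
  unfold lpNrm
  simp_rw [ENNReal.mul_rpow_of_nonneg _ _ hs.le]
  rw [lintegral_const_mul _ (hf.pow_const s), ENNReal.mul_rpow_of_nonneg _ _ (by positivity),
    ← ENNReal.rpow_mul, mul_one_div, div_self hs.ne', ENNReal.rpow_one]

lemma lpNrm_add_le {s : ℝ} (hs : 1 ≤ s) {f g : X → ℝ≥0∞} (hf : Measurable f) (hg : Measurable g) :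
    lpNrm μ s (fun x => f x + g x) ≤ lpNrm μ s f + lpNrm μ s g :=
  ENNReal.lintegral_Lp_add_le hf.aemeasurable hg.aemeasurable hs

lemma lintegral_mul_le_lpNrm {a b : ℝ} (hab : a.HolderConjugate b) {f g : X → ℝ≥0∞}
    (hf : Measurable f) (hg : Measurable g) :
    ∫⁻ x, f x * g x ∂μ ≤ lpNrm μ a f * lpNrm μ b g :=
  ENNReal.lintegral_mul_le_Lp_mul_Lq μ hab hf.aemeasurable hg.aemeasurable

lemma lpNrm_rpow_left {s c : ℝ} (hc : 0 < c) (f : X → ℝ≥0∞) :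
    lpNrm μ s (fun x => f x ^ c) = lpNrm μ (c * s) f ^ c := by
  unfold lpNrm
  simp_rw [← ENNReal.rpow_mul]
  congr 1
  field_simp

/-- Interpolation between `L^a` and `L^∞`, from `f ^ b = f ^ (b - a) * f ^ a`. -/
lemma lpNrm_le_of_le_of_le {a b : ℝ} (ha : 0 < a) (hab : a ≤ b) {f : X → ℝ≥0∞}
    (hf : Measurable f) {M N : ℝ≥0∞} (hM : ∀ᵐ x ∂μ, f x ≤ M) (hN : lpNrm μ a f ≤ N) :
    lpNrm μ b f ≤ M ^ (1 - a / b) * N ^ (a / b) := by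
  have hb : 0 < b := ha.trans_le hab
  have hba : 0 ≤ b - a := sub_nonneg.2 hab
  have hab' : a / b ≤ 1 := (div_le_one hb).2 hab
  rw [lpNrm_le_iff hb, ENNReal.mul_rpow_of_nonneg _ _ hb.le, ← ENNReal.rpow_mul,
    ← ENNReal.rpow_mul, sub_mul, one_mul, div_mul_cancel₀ _ hb.ne']
  calc ∫⁻ x, f x ^ b ∂μ ≤ ∫⁻ x, M ^ (b - a) * f x ^ a ∂μ := by
        refine lintegral_mono_ae (hM.mono fun x hx => ?_)
        calc f x ^ b = f x ^ (b - a) * f x ^ a := by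
              rw [← ENNReal.rpow_add_of_nonneg _ _ hba ha.le, sub_add_cancel]
          _ ≤ _ := by gcongr
    _ = M ^ (b - a) * ∫⁻ x, f x ^ a ∂μ := lintegral_const_mul _ (hf.pow_const a)
    _ ≤ _ := by gcongr; exact (lpNrm_le_iff ha).1 hN

/-- Minkowski's integral inequality, for a family with norms bounded by `w`. -/
lemma lpNrm_lintegral_le {T : Type*} [MeasurableSpace T] {ν : Measure T} [SFinite ν] [SFinite μ]
    {s : ℝ} (hs : 1 < s) {f : T → X → ℝ≥0∞} (hf : Measurable (Function.uncurry f))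
    {w : T → ℝ≥0∞} (hw : Measurable w) (hw0 : ∀ᵐ τ ∂ν, w τ ≠ 0) (hwt : ∀ᵐ τ ∂ν, w τ ≠ ∞)
    (h : ∀ᵐ τ ∂ν, lpNrm μ s (f τ) ≤ w τ) :
    lpNrm μ s (fun x => ∫⁻ τ, f τ x ∂ν) ≤ ∫⁻ τ, w τ ∂ν := by
  have hs0 : 0 < s := one_pos.trans hs
  rw [lpNrm_le_iff hs0]
  set W := ∫⁻ τ, w τ ∂ν with hW
  set θ : ℝ := 1 - 1 / s with hθ
  have hθ0 : 0 < θ := by rw [hθ, sub_pos, div_lt_one hs0]; exact hs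
  have hmeas : Measurable (Function.uncurry fun τ x => w τ ^ (1 - s) * f τ x ^ s) :=
    ((hw.comp measurable_fst).pow_const _).mul (hf.pow_const _)
  -- Hölder in `τ` for the factorisation of `f` into `w ^ (1 - 1/s)` and `(w ^ (1 - s) * f ^ s) ^
  -- (1/s)`. Knowing a majorant `w` of the norms makes duality unnecessary; `w ≠ 0` and `w ≠ ∞`
  -- allow its powers to cancel.
  have key : ∀ x, (∫⁻ τ, f τ x ∂ν) ^ s ≤ W ^ (s - 1) * ∫⁻ τ, w τ ^ (1 - s) * f τ x ^ s ∂ν := by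
    intro x
    have hfx : Measurable fun τ => f τ x := hf.comp (measurable_id.prodMk measurable_const)
    have h1 : ∫⁻ τ, f τ x ∂ν ≤ W ^ θ * (∫⁻ τ, w τ ^ (1 - s) * f τ x ^ s ∂ν) ^ (1 / s) := by
      refine le_trans (lintegral_mono_ae ?_) (ENNReal.lintegral_mul_norm_pow_le hw.aemeasurable
        ((hw.pow_const (1 - s)).mul (hfx.pow_const s)).aemeasurable hθ0.le (by positivity)
        (by rw [hθ]; ring))
      filter_upwards [hw0, hwt] with τ h0 ht
      rw [Pi.mul_apply, ENNReal.mul_rpow_of_nonneg _ _ (by positivity : 0 ≤ 1 / s),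
          ← ENNReal.rpow_mul,
        ← ENNReal.rpow_mul, mul_one_div, mul_one_div, div_self hs0.ne', ENNReal.rpow_one,
            ← mul_assoc,
        ← ENNReal.rpow_add _ _ h0 ht]
      have : θ + (1 - s) / s = 0 := by rw [hθ]; field_simp; ring
      rw [this, ENNReal.rpow_zero, one_mul]
    calc (∫⁻ τ, f τ x ∂ν) ^ s
        ≤ (W ^ θ * (∫⁻ τ, w τ ^ (1 - s) * f τ x ^ s ∂ν) ^ (1 / s)) ^ s :=
          ENNReal.rpow_le_rpow h1 hs0.le
      _ = _ := by
          rw [ENNReal.mul_rpow_of_nonneg _ _ hs0.le, ← ENNReal.rpow_mul, ← ENNReal.rpow_mul]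
          have e1 : θ * s = s - 1 := by rw [hθ]; field_simp
          rw [e1, one_div, inv_mul_cancel₀ hs0.ne', ENNReal.rpow_one]
  calc ∫⁻ x, (∫⁻ τ, f τ x ∂ν) ^ s ∂μ
      ≤ ∫⁻ x, W ^ (s - 1) * ∫⁻ τ, w τ ^ (1 - s) * f τ x ^ s ∂ν ∂μ := lintegral_mono key
    _ = W ^ (s - 1) * ∫⁻ x, ∫⁻ τ, w τ ^ (1 - s) * f τ x ^ s ∂ν ∂μ :=
        lintegral_const_mul _ (Measurable.lintegral_prod_left' hmeas)
    _ = W ^ (s - 1) * ∫⁻ τ, ∫⁻ x, w τ ^ (1 - s) * f τ x ^ s ∂μ ∂ν := by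
        rw [lintegral_lintegral_swap (f := fun τ x => w τ ^ (1 - s) * f τ x ^ s) hmeas.aemeasurable]
    _ ≤ W ^ (s - 1) * ∫⁻ τ, w τ ∂ν := by
        gcongr 1
        refine lintegral_mono_ae ?_
        filter_upwards [hw0, hwt, h] with τ h0 ht hτ
        have hfτ : Measurable (f τ) := hf.comp (measurable_const.prodMk measurable_id)
        rw [lintegral_const_mul _ (hfτ.pow_const s)]
        calc w τ ^ (1 - s) * ∫⁻ x, f τ x ^ s ∂μ ≤ w τ ^ (1 - s) * w τ ^ s := by
              gcongr; exact (lpNrm_le_iff hs0).1 hτ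
          _ = w τ := by
              rw [← ENNReal.rpow_add _ _ h0 ht, sub_add_cancel, ENNReal.rpow_one]
    _ = W ^ s := by
        rw [← hW]
        conv_lhs => rw [← ENNReal.rpow_one W, ← ENNReal.rpow_mul, one_mul]
        rw [← ENNReal.rpow_add_of_nonneg _ _ (by linarith) zero_le_one, sub_add_cancel]

end LpNorm

/-! ### Convolution on `ℝⁿ` and Young's inequality. -/

section Conv

variable {n : ℕ}

/-- The convolution of functions with values in `[0, ∞]`. -/
def conv (f g : Euc n → ℝ≥0∞) (x : Euc n) : ℝ≥0∞ := ∫⁻ y, f (x - y) * g y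

lemma conv_comm (f g : Euc n → ℝ≥0∞) : conv f g = conv g f := by
  ext x
  have := lintegral_sub_left_eq_self (fun y => f (x - y) * g y) x (μ := (volume : Measure (Euc n)))
  simp only [sub_sub_cancel] at this
  rw [conv, ← this, conv]
  congr 1; ext y; rw [mul_comm]

lemma measurable_conv {f g : Euc n → ℝ≥0∞} (hf : Measurable f) (hg : Measurable g) :
    Measurable (conv f g) := by
  unfold conv
  exact Measurable.lintegral_prod_right' (f := fun z : Euc n × Euc n => f (z.1 - z.2) * g z.2)
    (by fun_prop)

lemma measurable_conv_param {T : Type*} [MeasurableSpace T] {f g : T → Euc n → ℝ≥0∞}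
    (hf : Measurable (Function.uncurry f)) (hg : Measurable (Function.uncurry g)) :
    Measurable (Function.uncurry fun τ => conv (f τ) (g τ)) := by
  have : Measurable fun z : (T × Euc n) × Euc n => f z.1.1 (z.1.2 - z.2) * g z.1.1 z.2 :=
    (hf.comp (f := fun z : (T × Euc n) × Euc n => (z.1.1, z.1.2 - z.2)) (by fun_prop)).mul
      (hg.comp (f := fun z : (T × Euc n) × Euc n => (z.1.1, z.2)) (by fun_prop))
  exact this.lintegral_prod_right'

lemma conv_assoc {f g h : Euc n → ℝ≥0∞} (hf : Measurable f) (hg : Measurable g)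
    (hh : Measurable h) : conv (conv f g) h = conv f (conv g h) := by
  ext x
  simp only [conv]
  have e1 : ∀ y, (∫⁻ z, f (x - y - z) * g z) * h y = ∫⁻ z, f (x - z) * g (z - y) * h y := by
    intro y
    rw [← lintegral_mul_const _ (by fun_prop)]
    have := lintegral_add_right_eq_self (fun z => f (x - z) * g (z - y) * h y) y
      (μ := (volume : Measure (Euc n)))
    rw [← this]
    congr 1; ext z
    rw [add_sub_cancel_right, sub_sub, add_comm y z]
  simp_rw [e1]
  rw [lintegral_lintegral_swap (Measurable.aemeasurable (by unfold Function.uncurry; fun_prop))]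
  congr 1; ext z
  rw [← lintegral_const_mul _ (by fun_prop)]
  simp_rw [mul_assoc]

lemma conv_mono {f f' g g' : Euc n → ℝ≥0∞} (hf : ∀ x, f x ≤ f' x) (hg : ∀ x, g x ≤ g' x)
    (x : Euc n) : conv f g x ≤ conv f' g' x :=
  lintegral_mono fun _ => mul_le_mul' (hf _) (hg _)

lemma conv_mono_ae {f g g' : Euc n → ℝ≥0∞} (hg : g ≤ᵐ[volume] g')
    (x : Euc n) : conv f g x ≤ conv f g' x :=
  lintegral_mono_ae (hg.mono fun _ hy => mul_le_mul' le_rfl hy)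

lemma conv_congr_ae {f g g' : Euc n → ℝ≥0∞} (hg : g =ᵐ[volume] g') : conv f g = conv f g' := by
  ext x
  exact lintegral_congr_ae (hg.mono fun _ hy => by simp only [hy])

lemma conv_add {f g g' : Euc n → ℝ≥0∞} (hf : Measurable f) (hg : Measurable g) (x : Euc n) :
    conv f (fun y => g y + g' y) x = conv f g x + conv f g' x := by
  simp only [conv, mul_add]
  exact lintegral_add_left (by fun_prop) _

lemma conv_const (f : Euc n → ℝ≥0∞) (hf : Measurable f) (c : ℝ≥0∞) (x : Euc n) :
    conv f (fun _ => c) x = (∫⁻ y, f y) * c := by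
  simp only [conv]
  rw [lintegral_mul_const _ (by fun_prop), lintegral_sub_left_eq_self (fun y => f y) x]

lemma conv_iSup {f : Euc n → ℝ≥0∞} {g : ℕ → Euc n → ℝ≥0∞} (hf : Measurable f)
    (hg : ∀ k, Measurable (g k)) (hm : ∀ y, Monotone fun k => g k y) (x : Euc n) :
    conv f (fun y => ⨆ k, g k y) x = ⨆ k, conv f (g k) x := by
  simp only [conv, ENNReal.mul_iSup]
  exact lintegral_iSup (fun k => by have := hg k; fun_prop)
    (fun i j hij y => mul_le_mul' le_rfl (hm y hij))

lemma conv_lintegral {T : Type*} [MeasurableSpace T] {ν : Measure T} [SFinite ν]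
    {f : Euc n → ℝ≥0∞} (hf : Measurable f) {g : T → Euc n → ℝ≥0∞}
    (hg : Measurable (Function.uncurry g)) (x : Euc n) :
    conv f (fun y => ∫⁻ τ, g τ y ∂ν) x = ∫⁻ τ, conv f (g τ) x ∂ν := by
  simp only [conv]
  have hm : Measurable fun z : Euc n × T => f (x - z.1) * g z.2 z.1 :=
    (hf.comp (by fun_prop)).mul (hg.comp measurable_swap)
  rw [← lintegral_lintegral_swap (f := fun y τ => f (x - y) * g τ y) hm.aemeasurable]
  congr 1; ext y
  rw [lintegral_const_mul]
  exact hg.comp (measurable_id.prodMk measurable_const)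

lemma conv_le_of_le {f g : Euc n → ℝ≥0∞} (hf : Measurable f) {M : ℝ≥0∞}
    (hg : ∀ᵐ y, g y ≤ M) (x : Euc n) : conv f g x ≤ (∫⁻ y, f y) * M := by
  rw [← conv_const f hf M x]
  exact conv_mono_ae hg x

/-- Hölder against the measure `f (x - y) dy` bounds `(f * g) ^ s` pointwise by `‖f‖₁ ^ (s - 1)`
times `f * g ^ s`; the integral of the latter is a product by translation invariance. -/
lemma lintegral_conv_rpow_le {f g : Euc n → ℝ≥0∞} (hf : Measurable f) (hg : Measurable g)
    {s : ℝ} (hs : 1 ≤ s) :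
    ∫⁻ x, conv f g x ^ s ≤ (∫⁻ x, f x) ^ s * ∫⁻ x, g x ^ s := by
  have hs0 : 0 < s := one_pos.trans_le hs
  set F := ∫⁻ x, f x with hF
  have key : ∀ x, conv f g x ^ s ≤ F ^ (s - 1) * conv f (fun y => g y ^ s) x := by
    intro x
    have h1 : conv f g x ≤ F ^ (1 - 1 / s) * (conv f (fun y => g y ^ s) x) ^ (1 / s) := by
      have h2 := ENNReal.lintegral_mul_norm_pow_le (μ := (volume : Measure (Euc n)))
        (f := fun y => f (x - y)) (g := fun y => f (x - y) * g y ^ s)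
        (by fun_prop) (by fun_prop) (p := 1 - 1 / s) (q := 1 / s)
        (by rw [sub_nonneg, div_le_one hs0]; exact hs) (by positivity) (by ring)
      rw [lintegral_sub_left_eq_self (fun y => f y) x] at h2
      refine le_trans (le_of_eq ?_) h2
      rw [conv]
      congr 1; ext y
      rw [ENNReal.mul_rpow_of_nonneg _ _ (by positivity : 0 ≤ 1 / s), ← ENNReal.rpow_mul,
        mul_one_div, div_self hs0.ne', ENNReal.rpow_one, ← mul_assoc,
        ← ENNReal.rpow_add_of_nonneg _ _ (by rw [sub_nonneg, div_le_one hs0]; exact hs)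
          (by positivity), sub_add_cancel, ENNReal.rpow_one]
    calc conv f g x ^ s ≤ (F ^ (1 - 1 / s) * (conv f (fun y => g y ^ s) x) ^ (1 / s)) ^ s :=
          ENNReal.rpow_le_rpow h1 hs0.le
      _ = _ := by
          rw [ENNReal.mul_rpow_of_nonneg _ _ hs0.le, ← ENNReal.rpow_mul, ← ENNReal.rpow_mul]
          rw [show (1 - 1 / s) * s = s - 1 by field_simp, one_div, inv_mul_cancel₀ hs0.ne',
            ENNReal.rpow_one]
  have hconv : ∫⁻ x, conv f (fun y => g y ^ s) x = F * ∫⁻ x, g x ^ s := by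
    simp only [conv]
    rw [lintegral_lintegral_swap (Measurable.aemeasurable (by unfold Function.uncurry; fun_prop))]
    rw [← lintegral_const_mul _ (by fun_prop)]
    congr 1; ext y
    rw [lintegral_mul_const _ (by fun_prop), lintegral_sub_right_eq_self (fun x => f x) y]
  calc ∫⁻ x, conv f g x ^ s ≤ ∫⁻ x, F ^ (s - 1) * conv f (fun y => g y ^ s) x := lintegral_mono key
    _ = F ^ (s - 1) * (F * ∫⁻ x, g x ^ s) := by
        rw [lintegral_const_mul _ (measurable_conv hf (hg.pow_const s)), hconv]
    _ = F ^ s * ∫⁻ x, g x ^ s := by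
        rw [← mul_assoc]
        congr 1
        conv_lhs => rw [← ENNReal.rpow_one F, ← ENNReal.rpow_mul, one_mul]
        rw [← ENNReal.rpow_add_of_nonneg _ _ (by linarith) zero_le_one, sub_add_cancel]

lemma lpNrm_conv_le {f g : Euc n → ℝ≥0∞} (hf : Measurable f) (hg : Measurable g)
    {s : ℝ} (hs : 1 ≤ s) :
    lpNrm volume s (conv f g) ≤ (∫⁻ x, f x) * lpNrm volume s g := by
  have hs0 : 0 < s := one_pos.trans_le hs
  rw [lpNrm_le_iff hs0, ENNReal.mul_rpow_of_nonneg _ _ hs0.le, lpNrm_rpow hs0]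
  exact lintegral_conv_rpow_le hf hg hs

/-- Hölder puts `v` alone in `L^b` and the kernel times `w` in `L^a`; the `a`-th powers of these
still form a convolution, to which the `L^1` form of Young's inequality applies. In the applications
`v` is a `(p - 1)`-st power, or a power of the datum. -/
lemma conv_mul_le_rpow {k v w : Euc n → ℝ≥0∞} (hk : Measurable k) (hv : Measurable v)
    (hw : Measurable w) {a b : ℝ} (hab : a.HolderConjugate b) (x : Euc n) :
    conv k (fun y => v y * w y) x ≤
      lpNrm volume b v * conv (fun y => k y ^ a) (fun y => w y ^ a) x ^ (1 / a) := by
  have h := lintegral_mul_le_lpNrm (μ := (volume : Measure (Euc n))) hab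
    (f := fun y => k (x - y) * w y) (g := v) (by fun_prop) hv
  rw [mul_comm (lpNrm volume b v)]
  refine le_trans (le_of_eq ?_) (h.trans (le_of_eq ?_))
  · rw [conv]; congr 1; ext y; ring
  · congr 1
    rw [lpNrm, conv]
    simp_rw [ENNReal.mul_rpow_of_nonneg _ _ hab.nonneg]

/-- A form of Young's inequality. -/
lemma lpNrm_conv_mul_le {k v w : Euc n → ℝ≥0∞} (hk : Measurable k) (hv : Measurable v)
    (hw : Measurable w) {a b s : ℝ} (hab : a.HolderConjugate b) (has : a ≤ s) :
    lpNrm volume s (conv k (fun y => v y * w y)) ≤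
      lpNrm volume a k * lpNrm volume b v * lpNrm volume s w := by
  have ha0 : 0 < a := hab.pos
  have hs0 : 0 < s := ha0.trans_le has
  have h1 := lpNrm_mono (μ := volume) hs0 (conv_mul_le_rpow hk hv hw hab)
  rw [lpNrm_const_mul hs0 ((measurable_conv (by fun_prop) (by fun_prop)).pow_const _),
    lpNrm_rpow_left (by positivity)] at h1
  refine h1.trans ?_
  rw [mul_comm (lpNrm volume a k), mul_assoc]
  gcongr 1
  -- Young's inequality for the `a`-th powers at the exponent `s / a`, at least `1` because `a ≤ s`.
  have h2 := lpNrm_conv_le (f := fun y => k y ^ a) (g := fun y => w y ^ a) (by fun_prop)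
    (by fun_prop) (s := 1 / a * s) (by rw [one_div, inv_mul_eq_div, one_le_div ha0]; exact has)
  refine (ENNReal.rpow_le_rpow h2 (by positivity : 0 ≤ 1 / a)).trans (le_of_eq ?_)
  rw [ENNReal.mul_rpow_of_nonneg _ _ (by positivity), lpNrm_rpow_left ha0, ← ENNReal.rpow_mul,
    mul_one_div, div_self ha0.ne', ENNReal.rpow_one, ← mul_assoc, mul_one_div, div_self ha0.ne',
    one_mul]
  rfl

lemma conv_mul_le {k v w : Euc n → ℝ≥0∞} (hk : Measurable k) (hv : Measurable v)
    {a b : ℝ} (hab : a.HolderConjugate b) {M : ℝ≥0∞}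
    (hM : ∀ᵐ y, w y ≤ M) (x : Euc n) :
    conv k (fun y => v y * w y) x ≤ lpNrm volume a k * lpNrm volume b v * M := by
  have ha0 : 0 < a := hab.pos
  refine (conv_mono_ae (g' := fun y => v y * M) (hM.mono fun _ hy =>
      mul_le_mul' le_rfl hy) x).trans ?_
  refine (conv_mul_le_rpow hk hv measurable_const hab x).trans (le_of_eq ?_)
  rw [conv_const _ (by fun_prop), ENNReal.mul_rpow_of_nonneg _ _ (by positivity),
      ← ENNReal.rpow_mul,
    mul_one_div, div_self ha0.ne', ENNReal.rpow_one, ← mul_assoc, mul_comm (lpNrm volume b v)]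
  rfl

end Conv

/-! ### The heat kernel and the Riesz kernel with values in `[0, ∞]` -/

section Kernels

variable {n : ℕ}

lemma lintegral_comp_smul_euc (f : Euc n → ℝ≥0∞) (hf : Measurable f) {c : ℝ} (hc : 0 < c) :
    ∫⁻ x, f (c • x) = ENNReal.ofReal (c ^ (-(n : ℝ))) * ∫⁻ x, f x := by
  have h := Measure.map_addHaar_smul (volume : Measure (Euc n)) hc.ne'
  rw [finrank_euclideanSpace_fin, abs_of_nonneg (by positivity)] at h
  rw [← lintegral_map hf (measurable_const_smul c), h, lintegral_smul_measure, smul_eq_mul,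
    Real.rpow_neg hc.le, Real.rpow_natCast]

lemma lpNrm_comp_smul (f : Euc n → ℝ≥0∞) (hf : Measurable f) {c a : ℝ} (hc : 0 < c) (ha : 0 < a) :
    lpNrm volume a (fun x => f (c • x)) = ENNReal.ofReal (c ^ (-(n / a))) * lpNrm volume a f := by
  unfold lpNrm
  rw [lintegral_comp_smul_euc (fun x => f x ^ a) (by fun_prop) hc,
    ENNReal.mul_rpow_of_nonneg _ _ (by positivity),
    ENNReal.ofReal_rpow_of_nonneg (by positivity) (by positivity), ← Real.rpow_mul hc.le]
  congr 3; ring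

/-- The heat kernel, in the self-similar form, as a function with values in `[0, ∞]`. -/
def heatK (β t : ℝ) (x : Euc n) : ℝ≥0∞ :=
  ENNReal.ofReal (t ^ (-((n : ℝ) / β)) * fracHeatKernel β 1 (t ^ (-(1 / β)) • x))

/-- The Riesz kernel as a function with values in `[0, ∞]`. -/
def rieszK (α : ℝ) (x : Euc n) : ℝ≥0∞ :=
  ENNReal.ofReal (rieszConstant n α * (‖x‖ ^ ((n : ℝ) - α))⁻¹)

lemma rieszConstant_pos {α : ℝ} (hα : 0 < α) (hαn : α < n) : 0 < rieszConstant n α := by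
  unfold rieszConstant
  have h1 := Real.Gamma_pos_of_pos (show 0 < ((n : ℝ) - α) / 2 by linarith)
  have h2 := Real.Gamma_pos_of_pos (show 0 < α / 2 by linarith)
  positivity

lemma measurable_rieszK (α : ℝ) : Measurable (rieszK α : Euc n → ℝ≥0∞) := by
  unfold rieszK; fun_prop

/-! ### The heat kernel: contraction, Lebesgue norms, mass in parabolic balls. -/

section Heat

variable [NeZero n] {β : ℝ}

/-- Joint measurability in time and space is the benefit of the self-similar definition: only the
kernel at time `1`, which is continuous, enters. -/
lemma measurable_heatK_uncurry (hβ : 0 < β) : Measurable (Function.uncurry (heatK β :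
    ℝ → Euc n → ℝ≥0∞)) := by
  have := (continuous_fracHeatKernel (n := n) hβ one_pos).measurable
  unfold heatK Function.uncurry
  fun_prop

lemma measurable_heatK (hβ : 0 < β) (t : ℝ) : Measurable (heatK β t : Euc n → ℝ≥0∞) :=
  (measurable_heatK_uncurry hβ).comp (measurable_const.prodMk measurable_id)

lemma heatK_eq (hβ : 0 < β) {t : ℝ} (ht : 0 < t) (x : Euc n) :
    heatK β t x = ENNReal.ofReal (fracHeatKernel β t x) := by
  rw [heatK, fracHeatKernel_scaling hβ ht]

lemma heatK_eq_mul (hβ : 0 < β) {t : ℝ} (ht : 0 < t) (x : Euc n) :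
    heatK β t x = ENNReal.ofReal (t ^ (-((n : ℝ) / β))) * heatK β 1 (t ^ (-(1 / β)) • x) := by
  rw [heatK_eq hβ one_pos, heatK, ENNReal.ofReal_mul (by positivity)]

lemma lintegral_heatK (hβ : 0 < β) (hβ2 : β ≤ 2) {t : ℝ} (ht : 0 < t) : ∫⁻ x : Euc n,
    heatK β t x = 1 := by
  simp_rw [heatK_eq hβ ht]
  rw [← ofReal_integral_eq_lintegral_ofReal (integrable_fracHeatKernel hβ hβ2 ht)
    (ae_of_all _ (fracHeatKernel_nonneg hβ hβ2 ht)), integral_fracHeatKernel hβ hβ2 ht,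
    ENNReal.ofReal_one]

lemma heatK_le_zero (hβ : 0 < β) (hβ2 : β ≤ 2) {t : ℝ} (ht : 0 < t) (x : Euc n) :
    heatK β t x ≤ heatK β t (0 : Euc n) := by
  rw [heatK_eq hβ ht, heatK_eq hβ ht]
  exact ENNReal.ofReal_le_ofReal (fracHeatKernel_anti hβ hβ2 ht (by simp))

lemma conv_heatK_heatK (hβ : 0 < β) (hβ2 : β ≤ 2) {s t : ℝ} (hs : 0 < s) (ht : 0 < t) :
    conv (heatK β s) (heatK β t) = (heatK β (s + t) : Euc n → ℝ≥0∞) := by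
  ext x
  rw [conv, heatK_eq hβ (add_pos hs ht), ← integral_fracHeatKernel_mul_fracHeatKernel hβ hβ2 hs ht,
    ofReal_integral_eq_lintegral_ofReal]
  · congr 1; ext y
    rw [heatK_eq hβ hs, heatK_eq hβ ht, ENNReal.ofReal_mul (fracHeatKernel_nonneg hβ hβ2 hs _)]
  · refine Integrable.mul_bdd (c := fracHeatKernel β t (0 : Euc n))
      ((integrable_fracHeatKernel hβ hβ2 hs).comp_sub_left x)
      (continuous_fracHeatKernel hβ ht).aestronglyMeasurable (ae_of_all _ fun y => ?_)
    rw [Real.norm_of_nonneg (fracHeatKernel_nonneg hβ hβ2 ht _)]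
    exact fracHeatKernel_anti hβ hβ2 ht (by simp)
  · exact ae_of_all _ fun y =>
      mul_nonneg (fracHeatKernel_nonneg hβ hβ2 hs _) (fracHeatKernel_nonneg hβ hβ2 ht _)

lemma conv_heatK_conv_heatK (hβ : 0 < β) (hβ2 : β ≤ 2) {s t : ℝ} (hs : 0 < s) (ht : 0 < t) {f :
    Euc n → ℝ≥0∞}
    (hf : Measurable f) :
    conv (heatK β s) (conv (heatK β t) f) = conv (heatK β (s + t)) f := by
  rw [← conv_assoc (measurable_heatK hβ s) (measurable_heatK hβ t) hf,
    conv_heatK_heatK hβ hβ2 hs ht]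

lemma conv_heatK_le (hβ : 0 < β) (hβ2 : β ≤ 2) {t : ℝ} (ht : 0 < t) {f : Euc n → ℝ≥0∞} {M : ℝ≥0∞}
    (hM : ∀ᵐ y, f y ≤ M) (x : Euc n) : conv (heatK β t) f x ≤ M := by
  have := conv_le_of_le (measurable_heatK (n := n) hβ t) hM x
  rwa [lintegral_heatK hβ hβ2 ht, one_mul] at this

lemma lpNrm_conv_heatK_le (hβ : 0 < β) (hβ2 : β ≤ 2) {t : ℝ} (ht : 0 < t) {f : Euc n → ℝ≥0∞} (hf :
    Measurable f) {s : ℝ}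
    (hs : 1 ≤ s) : lpNrm volume s (conv (heatK β t) f) ≤ lpNrm volume s f := by
  have := lpNrm_conv_le (measurable_heatK (n := n) hβ t) hf hs
  rwa [lintegral_heatK hβ hβ2 ht, one_mul] at this

lemma lpNrm_heatK_one_ne_top (hβ : 0 < β) (hβ2 : β ≤ 2) {a : ℝ} (ha : 1 ≤ a) :
    lpNrm volume a (heatK β 1 : Euc n → ℝ≥0∞) ≠ ∞ := by
  have h1 : lpNrm volume 1 (heatK β 1 : Euc n → ℝ≥0∞) ≤ 1 := by
    rw [lpNrm]; simp [lintegral_heatK hβ hβ2 one_pos]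
  have h := lpNrm_le_of_le_of_le one_pos ha (measurable_heatK (n := n) hβ 1)
    (ae_of_all _ (heatK_le_zero hβ hβ2 one_pos)) h1
  refine ne_top_of_le_ne_top ?_ h
  refine ENNReal.mul_ne_top (ENNReal.rpow_ne_top_of_nonneg ?_ ?_) (by simp)
  · rw [sub_nonneg, div_le_one (one_pos.trans_le ha)]; exact ha
  · rw [heatK_eq hβ one_pos]; exact ENNReal.ofReal_ne_top

lemma lpNrm_heatK (hβ : 0 < β) {a t : ℝ} (ha : 1 ≤ a) (ht : 0 < t) :
    lpNrm volume a (heatK β t : Euc n → ℝ≥0∞) =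
      ENNReal.ofReal (t ^ (-((n : ℝ) / β) * (1 - 1 / a))) * lpNrm volume a (heatK β 1 :
          Euc n → ℝ≥0∞) := by
  have ha0 : 0 < a := one_pos.trans_le ha
  have e : (heatK β t : Euc n → ℝ≥0∞) = fun x =>
      ENNReal.ofReal (t ^ (-((n : ℝ) / β))) * heatK β 1 (t ^ (-(1 / β)) • x) :=
    funext (heatK_eq_mul hβ ht)
  have hm := measurable_heatK (n := n) hβ 1
  rw [e, lpNrm_const_mul ha0 (by fun_prop), lpNrm_comp_smul _ hm (by positivity) ha0, ← mul_assoc,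
    ← ENNReal.ofReal_mul (by positivity), ← Real.rpow_mul ht.le, ← Real.rpow_add ht]
  congr 3; field_simp; ring

/-- By self-similarity the mass carried by the ball of radius `t ^ (1 / β)` is the same at all
times; it is the constant in the lower bounds below. -/
lemma setLIntegral_heatK_ball (hβ : 0 < β) {t : ℝ} (ht : 0 < t) :
    ∫⁻ x in Metric.ball (0 : Euc n) (t ^ (1 / β)), heatK β t x =
      ∫⁻ x in Metric.ball (0 : Euc n) 1, heatK β 1 x := by
  have hm := measurable_heatK (n := n) hβ 1
  rw [← lintegral_indicator measurableSet_ball, ← lintegral_indicator measurableSet_ball]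
  have hc : (0 : ℝ) < t ^ (-(1 / β)) := by positivity
  have h := lintegral_comp_smul_euc ((Metric.ball (0 : Euc n) 1).indicator (heatK β 1))
    (hm.indicator measurableSet_ball) hc
  have e : ∀ x : Euc n, (Metric.ball (0 : Euc n) (t ^ (1 / β))).indicator (heatK β t) x =
      ENNReal.ofReal (t ^ (-((n : ℝ) / β))) *
        (Metric.ball (0 : Euc n) 1).indicator (heatK β 1) (t ^ (-(1 / β)) • x) := by
    intro x
    have hiff : x ∈ Metric.ball (0 : Euc n) (t ^ (1 / β)) ↔
        t ^ (-(1 / β)) • x ∈ Metric.ball (0 : Euc n) 1 := by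
      rw [mem_ball_zero_iff, mem_ball_zero_iff, norm_smul, Real.norm_of_nonneg hc.le,
        Real.rpow_neg ht.le, inv_mul_lt_iff₀ (by positivity), mul_one]
    by_cases hx : x ∈ Metric.ball (0 : Euc n) (t ^ (1 / β))
    · rw [Set.indicator_of_mem hx, Set.indicator_of_mem (hiff.1 hx), heatK_eq_mul hβ ht]
    · rw [Set.indicator_of_notMem hx, Set.indicator_of_notMem (hiff.not.1 hx), mul_zero]
  have hm' : Measurable fun x : Euc n =>
      (Metric.ball (0 : Euc n) 1).indicator (heatK β 1) (t ^ (-(1 / β)) • x) :=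
    (hm.indicator measurableSet_ball).comp (measurable_const_smul _)
  simp_rw [e]
  rw [lintegral_const_mul _ hm', h,
    ← mul_assoc, ← ENNReal.ofReal_mul (by positivity), ← Real.rpow_mul ht.le, ← Real.rpow_add ht]
  rw [show -((n : ℝ) / β) + -(1 / β) * -(n : ℝ) = 0 by ring]
  simp

lemma setLIntegral_heatK_ball_pos (hβ : 0 < β) :
    0 < ∫⁻ x in Metric.ball (0 : Euc n) 1, heatK β 1 x := by
  rw [setLIntegral_pos_iff (measurable_heatK hβ 1)]
  have hc := continuous_fracHeatKernel (n := n) hβ one_pos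
  have ho : IsOpen ({x : Euc n | 0 < fracHeatKernel β 1 x} ∩ Metric.ball 0 1) :=
    (isOpen_lt continuous_const hc).inter Metric.isOpen_ball
  have hsub : {x : Euc n | 0 < fracHeatKernel β 1 x} ∩ Metric.ball 0 1 ⊆
      Function.support (heatK β 1) ∩ Metric.ball 0 1 := by
    rintro x ⟨hx, hx'⟩
    refine ⟨?_, hx'⟩
    rw [Function.mem_support, heatK_eq hβ one_pos]
    simpa using hx
  refine lt_of_lt_of_le (ho.measure_pos volume ⟨0, ?_, by simp⟩) (measure_mono hsub)
  exact fracHeatKernel_zero_pos hβ one_pos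

/-- The kernel is nonnegative, so a lower bound for `f` on the parabolic ball around `x` survives
the flow up to a fixed fraction. -/
lemma le_conv_heatK (hβ : 0 < β) {t : ℝ} (ht : 0 < t) {f : Euc n → ℝ≥0∞} {h : ℝ≥0∞} {x : Euc n}
    (hf : ∀ᵐ y, ‖x - y‖ < t ^ (1 / β) → h ≤ f y) :
    (∫⁻ x in Metric.ball (0 : Euc n) 1, heatK β 1 x) * h ≤ conv (heatK β t) f x := by
  have hm := measurable_heatK (n := n) hβ t
  rw [← setLIntegral_heatK_ball hβ ht, ← lintegral_indicator measurableSet_ball,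
    ← conv_const _ (hm.indicator measurableSet_ball) h x]
  refine lintegral_mono_ae (hf.mono fun y hy => ?_)
  by_cases hxy : x - y ∈ Metric.ball (0 : Euc n) (t ^ (1 / β))
  · rw [Set.indicator_of_mem hxy]
    exact mul_le_mul' le_rfl (hy (by simpa using hxy))
  · rw [Set.indicator_of_notMem hxy, zero_mul]
    exact zero_le

end Heat

/-! ### The Riesz kernel: lower bounds, scaling, near and far parts. -/

section Riesz

variable {α : ℝ}

/-- The origin must be excluded: there the kernel takes the value `0`, the inverse of `0`. -/
lemma le_rieszK (hα : 0 < α) (hαn : α < n) {y : Euc n} (hy : y ≠ 0) {R : ℝ} (hR : ‖y‖ ≤ R) :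
    ENNReal.ofReal (rieszConstant n α * (R ^ ((n : ℝ) - α))⁻¹) ≤ rieszK α y := by
  have hy' : 0 < ‖y‖ := norm_pos_iff.2 hy
  have := rieszConstant_pos hα hαn
  have h2 : 0 < (n : ℝ) - α := by linarith
  unfold rieszK
  gcongr

lemma rieszK_smul (hα : 0 < α) (hαn : α < n) {c : ℝ} (hc : 0 < c) (y : Euc n) :
    rieszK α (c • y) = ENNReal.ofReal (c ^ (-((n : ℝ) - α))) * rieszK α y := by
  have := rieszConstant_pos hα hαn
  rw [rieszK, rieszK, ← ENNReal.ofReal_mul (by positivity), norm_smul, Real.norm_of_nonneg hc.le,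
    Real.mul_rpow hc.le (norm_nonneg _), Real.rpow_neg hc.le, mul_inv]
  congr 1; ring

/-- The part of the Riesz kernel inside the unit ball. -/
def rieszNear (α : ℝ) : Euc n → ℝ≥0∞ := (Metric.ball 0 1).indicator (rieszK α)

/-- The part of the Riesz kernel outside the unit ball. -/
def rieszFar (α : ℝ) : Euc n → ℝ≥0∞ := (Metric.ball 0 1)ᶜ.indicator (rieszK α)

lemma rieszNear_add_rieszFar (x : Euc n) : rieszK α x = rieszNear α x + rieszFar α x :=
  (Set.indicator_self_add_compl_apply _ _ _).symm

lemma measurable_rieszNear : Measurable (rieszNear α : Euc n → ℝ≥0∞) :=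
  (measurable_rieszK α).indicator measurableSet_ball

lemma measurable_rieszFar : Measurable (rieszFar α : Euc n → ℝ≥0∞) :=
  (measurable_rieszK α).indicator measurableSet_ball.compl

/-- In polar coordinates the integrand becomes a multiple of `r ^ (α - 1)`, integrable at `0` since
`α > 0`. -/
lemma lintegral_rieszNear_ne_top (hα : 0 < α) (hαn : α < n) [NeZero n] : ∫⁻ x : Euc n,
    rieszNear α x ≠ ∞ := by
  have hA := rieszConstant_pos hα hαn
  unfold rieszNear
  rw [lintegral_indicator measurableSet_ball]
  have hn : 1 ≤ n := NeZero.one_le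
  have h := (integrableOn_fun_norm_addHaar (E := Euc n) (volume : Measure (Euc n))
    (f := fun r : ℝ => rieszConstant n α * (r ^ ((n : ℝ) - α))⁻¹) (r := 1)).2 (by
      have h1 := (intervalIntegral.intervalIntegrable_rpow' (a := 0) (b := 1)
        (show -1 < α - 1 by linarith)).const_mul (rieszConstant n α)
      rw [intervalIntegrable_iff_integrableOn_Ioo_of_le zero_le_one] at h1
      refine h1.congr_fun (fun r hr => ?_) measurableSet_Ioo
      have hr0 : 0 < r := hr.1
      simp only [smul_eq_mul, finrank_euclideanSpace_fin]
      rw [mul_left_comm, ← Real.rpow_neg hr0.le, ← Real.rpow_natCast, ← Real.rpow_add hr0,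
        Nat.cast_sub hn]
      congr 2; push_cast; ring)
  have h2 := h.lintegral_lt_top
  exact h2.ne

/-- For `‖x‖ ≥ 1` one has `‖x‖ ≥ (1 + ‖x‖) / 2`, so the `b`-th power is dominated by a multiple of
`(1 + ‖x‖) ^ (-b (n - α))`, integrable since `b (n - α) > n`. -/
lemma lpNrm_rieszFar_ne_top (hα : 0 < α) (hαn : α < n) {b : ℝ} (hb : 0 < b) (hbn : n < b *
    (n - α)) :
    lpNrm volume b (rieszFar α : Euc n → ℝ≥0∞) ≠ ∞ := by
  have hA := rieszConstant_pos hα hαn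
  have hna : 0 < (n : ℝ) - α := by linarith
  refine ENNReal.rpow_ne_top_of_nonneg (by positivity) ?_
  have hi := (integrable_one_add_norm (E := Euc n) (μ := volume) (r := b * (n - α)) (by
    rw [finrank_euclideanSpace_fin]; exact hbn)).const_mul
      ((rieszConstant n α * 2 ^ ((n : ℝ) - α)) ^ b)
  refine ne_top_of_le_ne_top hi.lintegral_lt_top.ne (lintegral_mono fun x => ?_)
  unfold rieszFar
  by_cases hx : x ∈ (Metric.ball (0 : Euc n) 1)ᶜ
  · have hx1 : 1 ≤ ‖x‖ := by simpa using hx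
    rw [Set.indicator_of_mem hx, rieszK, ENNReal.ofReal_rpow_of_nonneg (by positivity) hb.le]
    refine ENNReal.ofReal_le_ofReal ?_
    have e : (rieszConstant n α * 2 ^ ((n : ℝ) - α)) ^ b * (1 + ‖x‖) ^ (-(b * ((n : ℝ) - α))) =
        (rieszConstant n α * (2 ^ ((n : ℝ) - α) * ((1 + ‖x‖) ^ ((n : ℝ) - α))⁻¹)) ^ b := by
      rw [← mul_assoc, Real.mul_rpow (x := rieszConstant n α * 2 ^ ((n : ℝ) - α))
        (y := ((1 + ‖x‖) ^ ((n : ℝ) - α))⁻¹) (by positivity) (by positivity),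
        Real.inv_rpow (by positivity), ← Real.rpow_mul (by positivity), Real.rpow_neg
            (by positivity),
        mul_comm b]
    rw [e]
    gcongr
    rw [← Real.inv_rpow (by positivity), ← Real.inv_rpow (by positivity),
      ← Real.mul_rpow (by positivity) (by positivity)]
    gcongr
    rw [← div_eq_mul_inv, inv_eq_one_div, div_le_div_iff₀ (by positivity) (by positivity)]
    linarith
  · rw [Set.indicator_of_notMem hx, ENNReal.zero_rpow_of_pos hb]
    exact zero_le

/-- On the ball of radius `ρ` the distance to `x` is at most `‖x‖ + ρ`. A local source is thus felt
at every `x`, with decay only `‖x‖ ^ (-(n - α))`: this is the nonlocal gain behind the blow-up. -/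
lemma le_conv_rieszK (hα : 0 < α) (hαn : α < n) [NeZero n] {f : Euc n → ℝ≥0∞} {h : ℝ≥0∞} {ρ : ℝ}
    (hf : ∀ y, ‖y‖ < ρ → h ≤ f y) (x : Euc n) :
    ENNReal.ofReal (rieszConstant n α * ((‖x‖ + ρ) ^ ((n : ℝ) - α))⁻¹) * h *
      volume (Metric.ball (0 : Euc n) ρ) ≤ conv (rieszK α) f x := by
  rw [← setLIntegral_const, ← lintegral_indicator measurableSet_ball]
  have hx : ∀ᵐ y : Euc n, y ≠ x := by
    simp [ae_iff]
  refine lintegral_mono_ae (hx.mono fun y hy => ?_)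
  by_cases hyρ : y ∈ Metric.ball (0 : Euc n) ρ
  · rw [Set.indicator_of_mem hyρ]
    have hy' : ‖y‖ < ρ := by simpa using hyρ
    refine mul_le_mul' (le_rieszK hα hαn (sub_ne_zero.2 hy.symm) ?_) (hf y hy')
    exact (norm_sub_le _ _).trans (by linarith)
  · rw [Set.indicator_of_notMem hyρ]; exact zero_le

end Riesz

end Kernels

/-! ### The composition of the heat semigroup with the Riesz potential -/

section ForceKernel

variable {n : ℕ}

/-- The kernel of `S_β(t) I_α`. -/
def forceK (β α t : ℝ) : Euc n → ℝ≥0∞ := conv (heatK β t) (rieszK α)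

lemma rpow_smul_sub_rpow_smul {β t : ℝ} (ht : 0 < t) (x z : Euc n) :
    t ^ (-(1 / β)) • (x - t ^ (1 / β) • z) = t ^ (-(1 / β)) • x - z := by
  rw [smul_sub, smul_smul, ← Real.rpow_add ht]
  simp

variable {α β : ℝ}

lemma measurable_forceK [NeZero n] (hβ : 0 < β) (t : ℝ) : Measurable (forceK β α t :
    Euc n → ℝ≥0∞) :=
  measurable_conv (measurable_heatK hβ t) (measurable_rieszK α)

lemma measurable_forceK_uncurry [NeZero n] (hβ : 0 < β) :
    Measurable (Function.uncurry (forceK β α : ℝ → Euc n → ℝ≥0∞)) :=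
  measurable_conv_param (measurable_heatK_uncurry hβ)
    ((measurable_rieszK (n := n) α).comp measurable_snd)

lemma conv_forceK [NeZero n] (hβ : 0 < β) (t : ℝ) {f : Euc n → ℝ≥0∞} (hf : Measurable f) :
    conv (forceK β α t) f = conv (heatK β t) (conv (rieszK α) f) :=
  conv_assoc (measurable_heatK hβ t) (measurable_rieszK α) hf

lemma conv_heatK_conv_forceK [NeZero n] (hβ : 0 < β) (hβ2 : β ≤ 2) {s t : ℝ} (hs : 0 < s) (ht :
    0 < t)
    {f : Euc n → ℝ≥0∞} (hf : Measurable f) :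
    conv (heatK β s) (conv (forceK β α t) f) = conv (forceK β α (s + t)) f := by
  rw [conv_forceK hβ _ hf, conv_forceK hβ _ hf,
    conv_heatK_conv_heatK hβ hβ2 hs ht (measurable_conv (measurable_rieszK α) hf)]

lemma forceK_scaling (hα : 0 < α) (hαn : α < n) [NeZero n] (hβ : 0 < β) {t : ℝ} (ht : 0 < t) (x :
    Euc n) :
    forceK β α t x = ENNReal.ofReal (t ^ (-(((n : ℝ) - α) / β))) *
      forceK β α 1 (t ^ (-(1 / β)) • x) := by
  have hm1 := measurable_heatK (n := n) hβ t
  have hm2 := measurable_rieszK (n := n) α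
  have hm3 := measurable_heatK (n := n) hβ 1
  set c := t ^ (1 / β) with hc
  have hc0 : 0 < c := Real.rpow_pos_of_pos ht _
  have h := lintegral_comp_smul_euc (fun y => heatK β t (x - y) * rieszK α y) (by fun_prop) hc0
  have e : ∀ z : Euc n, heatK β t (x - c • z) * rieszK α (c • z) =
      ENNReal.ofReal (t ^ (-((n : ℝ) / β)) * c ^ (-((n : ℝ) - α))) *
        (heatK β 1 (t ^ (-(1 / β)) • x - z) * rieszK α z) := by
    intro z
    rw [heatK_eq_mul hβ ht, rieszK_smul hα hαn hc0, hc, rpow_smul_sub_rpow_smul ht,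
      ENNReal.ofReal_mul (by positivity)]
    ring
  simp_rw [e] at h
  rw [lintegral_const_mul _ (by fun_prop)] at h
  have h' := congrArg (fun z => ENNReal.ofReal (c ^ (n : ℝ)) * z) h
  rw [← mul_assoc, ← mul_assoc, ← ENNReal.ofReal_mul (by positivity),
    ← ENNReal.ofReal_mul (by positivity), ← Real.rpow_add hc0, add_neg_cancel, Real.rpow_zero,
    ENNReal.ofReal_one, one_mul] at h'
  rw [forceK, conv, ← h', forceK, conv]
  congr 2
  rw [hc, ← Real.rpow_mul ht.le, ← Real.rpow_mul ht.le, ← Real.rpow_add ht, ← Real.rpow_add ht]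
  congr 1; ring

/-- The near part of the Riesz kernel is in `L^1` and the heat kernel in `L^a`; the roles are
exchanged for the far part, which is where `n < a (n - α)` enters. -/
lemma lpNrm_forceK_one_ne_top (hα : 0 < α) (hαn : α < n) [NeZero n] (hβ : 0 < β) (hβ2 : β ≤ 2) {a :
    ℝ}
    (ha : 1 ≤ a) (han : n < a * (n - α)) :
    lpNrm volume a (forceK β α 1 : Euc n → ℝ≥0∞) ≠ ∞ := by
  have ha0 : 0 < a := one_pos.trans_le ha
  have hm := measurable_heatK (n := n) hβ 1
  have e : (forceK β α 1 : Euc n → ℝ≥0∞) =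
      fun x => conv (rieszNear α) (heatK β 1) x + conv (heatK β 1) (rieszFar α) x := by
    ext x
    rw [conv_comm (rieszNear α), ← conv_add hm measurable_rieszNear]
    simp_rw [← rieszNear_add_rieszFar]
    rfl
  rw [e]
  refine ne_top_of_le_ne_top ?_ (lpNrm_add_le ha (measurable_conv measurable_rieszNear hm)
    (measurable_conv hm measurable_rieszFar))
  refine ENNReal.add_ne_top.2 ⟨ne_top_of_le_ne_top ?_ (lpNrm_conv_le measurable_rieszNear hm ha),
    ne_top_of_le_ne_top ?_ (lpNrm_conv_le hm measurable_rieszFar ha)⟩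
  · exact ENNReal.mul_ne_top (lintegral_rieszNear_ne_top hα hαn)
      (lpNrm_heatK_one_ne_top hβ hβ2 ha)
  · rw [lintegral_heatK hβ hβ2 one_pos, one_mul]
    exact lpNrm_rieszFar_ne_top hα hαn ha0 han

lemma lpNrm_forceK (hα : 0 < α) (hαn : α < n) [NeZero n] (hβ : 0 < β) {a t : ℝ} (ha : 0 < a) (ht :
    0 < t) :
    lpNrm volume a (forceK β α t : Euc n → ℝ≥0∞) =
      ENNReal.ofReal (t ^ (-(((n : ℝ) - α) / β) + n / (β * a))) *
        lpNrm volume a (forceK β α 1 : Euc n → ℝ≥0∞) := by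
  have hm := measurable_forceK (n := n) (α := α) hβ 1
  rw [show (forceK β α t : Euc n → ℝ≥0∞) = _ from funext (forceK_scaling hα hαn hβ ht),
    lpNrm_const_mul ha (by fun_prop), lpNrm_comp_smul _ hm (by positivity) ha, ← mul_assoc,
    ← ENNReal.ofReal_mul (by positivity), ← Real.rpow_mul ht.le, ← Real.rpow_add ht]
  congr 3; field_simp

/-- A radially nonincreasing density of mass one satisfies `K(z) |B(0, ‖z‖)| ≤ 1`, hence decays at
least like `‖z‖ ^ (-n)`, faster than the Riesz kernel. No asymptotics of the kernel are needed. -/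
lemma exists_fracHeatKernel_one_le (hα : 0 < α) (hαn : α < n) [NeZero n] (hβ : 0 < β) (hβ2 :
    β ≤ 2) :
    ∃ C : ℝ, 0 < C ∧ ∀ z : Euc n,
      fracHeatKernel β 1 z ≤ C * ((‖z‖ + 1) ^ ((n : ℝ) - α))⁻¹ := by
  have hna : 0 < (n : ℝ) - α := by linarith
  set v := volume.real (Metric.ball (0 : Euc n) 1) with hv
  have hv0 : 0 < v := ENNReal.toReal_pos (Metric.measure_ball_pos _ _ one_pos).ne'
    measure_ball_lt_top.ne
  have hK0 := fracHeatKernel_zero_pos (n := n) hβ one_pos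
  set K0 := fracHeatKernel β 1 (0 : Euc n)
  have h1 : ∀ z : Euc n, fracHeatKernel β 1 z * (‖z‖ ^ n * v) ≤ 1 := by
    intro z
    have hi := integrable_fracHeatKernel (n := n) hβ hβ2 one_pos
    have hvol : volume.real (Metric.ball (0 : Euc n) ‖z‖) = ‖z‖ ^ n * v := by
      rw [Measure.real, Measure.addHaar_ball _ _ (norm_nonneg z), ENNReal.toReal_mul,
        ENNReal.toReal_ofReal (by positivity), finrank_euclideanSpace_fin]
      rfl
    rw [← hvol, mul_comm, ← smul_eq_mul, ← setIntegral_const]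
    refine le_trans ?_ (integral_fracHeatKernel (n := n) hβ hβ2 one_pos).le
    refine (setIntegral_mono_on (integrableOn_const measure_ball_lt_top.ne) hi.integrableOn
      measurableSet_ball fun y hy => ?_).trans (setIntegral_le_integral hi
        (ae_of_all _ (fracHeatKernel_nonneg hβ hβ2 one_pos)))
    exact fracHeatKernel_anti hβ hβ2 one_pos (mem_ball_zero_iff.1 hy).le
  refine ⟨(K0 + v⁻¹) * 2 ^ ((n : ℝ) - α), by positivity, fun z => ?_⟩
  rcases le_total ‖z‖ 1 with hz | hz
  · have h2 : fracHeatKernel β 1 z ≤ K0 := fracHeatKernel_anti hβ hβ2 one_pos (by simp)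
    have h3 : 1 ≤ (2 : ℝ) ^ ((n : ℝ) - α) * ((‖z‖ + 1) ^ ((n : ℝ) - α))⁻¹ := by
      rw [← div_eq_mul_inv, one_le_div (by positivity)]
      gcongr; linarith
    calc fracHeatKernel β 1 z ≤ K0 * 1 := by linarith
      _ ≤ (K0 + v⁻¹) * (2 ^ ((n : ℝ) - α) * ((‖z‖ + 1) ^ ((n : ℝ) - α))⁻¹) := by
          gcongr
          have : 0 < v⁻¹ := by positivity
          linarith
      _ = _ := by ring
  · have hz0 : 0 < ‖z‖ := by linarith
    have h2 : fracHeatKernel β 1 z ≤ v⁻¹ * (‖z‖ ^ (n : ℝ))⁻¹ := by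
      have := h1 z
      rw [Real.rpow_natCast, ← mul_inv, ← one_div, le_div_iff₀ (by positivity), mul_comm v]
      exact this
    have h3 : (‖z‖ ^ (n : ℝ))⁻¹ ≤ 2 ^ ((n : ℝ) - α) * ((‖z‖ + 1) ^ ((n : ℝ) - α))⁻¹ := by
      calc (‖z‖ ^ (n : ℝ))⁻¹ ≤ (‖z‖ ^ ((n : ℝ) - α))⁻¹ := by
            gcongr
            linarith
        _ ≤ _ := by
            rw [← div_eq_mul_inv, inv_eq_one_div, div_le_div_iff₀ (by positivity) (by positivity),
              one_mul, ← Real.mul_rpow (by positivity) (by positivity)]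
            gcongr; linarith
    calc fracHeatKernel β 1 z ≤ v⁻¹ * (‖z‖ ^ (n : ℝ))⁻¹ := h2
      _ ≤ (K0 + v⁻¹) * (2 ^ ((n : ℝ) - α) * ((‖z‖ + 1) ^ ((n : ℝ) - α))⁻¹) := by
          gcongr
          linarith
      _ = _ := by ring

/-- At time `1`, averaging the Riesz kernel over a unit ball gives at least a multiple of `(‖z‖ + 1)
^ (-(n - α))`, which dominates the heat kernel; scaling produces the factor `t ^ (α / β)`. From
below, `S_β(t) I_α` may thus be replaced by `t ^ (α / β) S_β(t)`, as if the nonlinearity were local.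
-/
lemma exists_mul_heatK_le_forceK (hα : 0 < α) (hαn : α < n) [NeZero n] (hβ : 0 < β) (hβ2 : β ≤ 2) :
    ∃ c : ℝ≥0∞, c ≠ 0 ∧ c ≠ ∞ ∧ ∀ t > 0, ∀ z : Euc n,
      c * ENNReal.ofReal (t ^ (α / β)) * heatK β t z ≤ forceK β α t z := by
  have hA := rieszConstant_pos hα hαn
  obtain ⟨C, hC, hK⟩ := exists_fracHeatKernel_one_le (n := n) hα hαn hβ hβ2
  set c0 := ∫⁻ x in Metric.ball (0 : Euc n) 1, heatK β 1 x with hc0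
  have hc0pos : 0 < c0 := setLIntegral_heatK_ball_pos hβ
  have hc0le : c0 ≤ 1 := by
    rw [← lintegral_heatK (n := n) hβ hβ2 one_pos]; exact setLIntegral_le_lintegral _ _
  set A := rieszConstant n α with hAdef
  have hone : ∀ z : Euc n, c0 * ENNReal.ofReal (A * C⁻¹) * heatK β 1 z ≤ forceK β α 1 z := by
    intro z
    have hne : ∀ᵐ y : Euc n, y ≠ 0 := by simp [ae_iff]
    have h1 := le_conv_heatK hβ one_pos (f := rieszK α) (x := z)
      (h := ENNReal.ofReal (A * ((‖z‖ + 1) ^ ((n : ℝ) - α))⁻¹)) (hne.mono fun y hy hzy => by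
        refine le_rieszK hα hαn hy ?_
        rw [Real.one_rpow] at hzy
        have := norm_sub_norm_le y z
        rw [norm_sub_rev] at this
        linarith)
    refine le_trans ?_ h1
    rw [mul_assoc, heatK_eq hβ one_pos, ← ENNReal.ofReal_mul (by positivity)]
    refine mul_le_mul' le_rfl (ENNReal.ofReal_le_ofReal ?_)
    calc A * C⁻¹ * fracHeatKernel β 1 z ≤ A * C⁻¹ * (C * ((‖z‖ + 1) ^ ((n : ℝ) - α))⁻¹) := by
          gcongr; exact hK z
      _ = _ := by field_simp
  refine ⟨c0 * ENNReal.ofReal (A * C⁻¹), mul_ne_zero hc0pos.ne' (by simp; positivity),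
    ENNReal.mul_ne_top (ne_top_of_le_ne_top (by simp) hc0le) ENNReal.ofReal_ne_top,
    fun t ht z => ?_⟩
  rw [forceK_scaling hα hαn hβ ht, heatK_eq_mul hβ ht]
  calc c0 * ENNReal.ofReal (A * C⁻¹) * ENNReal.ofReal (t ^ (α / β)) *
        (ENNReal.ofReal (t ^ (-((n : ℝ) / β))) * heatK β 1 (t ^ (-(1 / β)) • z))
      = (ENNReal.ofReal (t ^ (α / β)) * ENNReal.ofReal (t ^ (-((n : ℝ) / β)))) *
        (c0 * ENNReal.ofReal (A * C⁻¹) * heatK β 1 (t ^ (-(1 / β)) • z)) := by ring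
    _ ≤ _ := by
        rw [← ENNReal.ofReal_mul (by positivity), ← Real.rpow_add ht,
          show α / β + -((n : ℝ) / β) = -(((n : ℝ) - α) / β) by ring]
        gcongr
        exact hone _

/-- The near part sees only the sup norm of `v`, the far part its `L^b` norm. With `v` a `(p -
1)`-st power the estimate is linear in `w`. -/
lemma conv_rieszK_le {a b : ℝ} (hab : a.HolderConjugate b) {v w : Euc n → ℝ≥0∞}
    (hv : Measurable v) (hw : Measurable w) {M N : ℝ≥0∞} (hM : ∀ᵐ y, v y ≤ M)
    (hN : ∀ᵐ y, w y ≤ N) (x : Euc n) :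
    conv (rieszK α) (fun y => v y * w y) x ≤
      ((∫⁻ y : Euc n, rieszNear α y) * M + lpNrm volume a (rieszFar α : Euc n → ℝ≥0∞) *
        lpNrm volume b v) * N := by
  rw [conv_comm, show (rieszK α : Euc n → ℝ≥0∞) = fun y => rieszNear α y + rieszFar α y from
    funext rieszNear_add_rieszFar, conv_add (by fun_prop) measurable_rieszNear, conv_comm,
    conv_comm _ (rieszFar α), add_mul, mul_assoc]
  refine add_le_add (conv_le_of_le measurable_rieszNear ?_ x)
    (conv_mul_le measurable_rieszFar hv hab hN x)
  filter_upwards [hM, hN] with y h1 h2 using mul_le_mul' h1 h2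

lemma lpNrm_conv_rieszK_le {a b s : ℝ} (hab : a.HolderConjugate b) (has : a ≤ s)
    {v w : Euc n → ℝ≥0∞} (hv : Measurable v) (hw : Measurable w) {M : ℝ≥0∞}
    (hM : ∀ᵐ y, v y ≤ M) :
    lpNrm volume s (conv (rieszK α) (fun y => v y * w y)) ≤
      ((∫⁻ y : Euc n, rieszNear α y) * M + lpNrm volume a (rieszFar α : Euc n → ℝ≥0∞) *
        lpNrm volume b v) * lpNrm volume s w := by
  have hs : 1 ≤ s := hab.lt.le.trans has
  have hs0 : 0 < s := one_pos.trans_le hs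
  have hvw : Measurable fun y => v y * w y := by fun_prop
  have e : conv (rieszK α) (fun y => v y * w y) =
      fun x => conv (rieszNear α) (fun y => v y * w y) x +
        conv (rieszFar α) (fun y => v y * w y) x := by
    ext x
    rw [conv_comm, show (rieszK α : Euc n → ℝ≥0∞) = fun y => rieszNear α y + rieszFar α y from
      funext rieszNear_add_rieszFar, conv_add hvw measurable_rieszNear, conv_comm,
      conv_comm _ (rieszFar α)]
  rw [e]
  refine (lpNrm_add_le hs (measurable_conv measurable_rieszNear hvw)
    (measurable_conv measurable_rieszFar hvw)).trans ?_
  rw [add_mul, mul_assoc]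
  refine add_le_add ((lpNrm_conv_le measurable_rieszNear hvw hs).trans ?_)
    (lpNrm_conv_mul_le measurable_rieszFar hv hw hab has)
  gcongr 1
  rw [← lpNrm_const_mul hs0 hw]
  exact lpNrm_mono_ae hs0 (hM.mono fun y hy => mul_le_mul' hy le_rfl)

end ForceKernel

/-! ### The Duhamel operator and the minimal solution -/

section Duhamel

variable {n : ℕ} {α β : ℝ}

/-- The Duhamel operator `∫_0^t S_β(t - τ) I_α f(τ) dτ` on functions with values in `[0, ∞]`. -/
def duhamel (β α : ℝ) (f : ℝ → Euc n → ℝ≥0∞) (t : ℝ) (x : Euc n) : ℝ≥0∞ :=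
  ∫⁻ τ in Set.Ioo 0 t, conv (forceK β α (t - τ)) (f τ) x

lemma measurable_uncurry_apply {T X : Type*} [MeasurableSpace T] [MeasurableSpace X]
    {f : T → X → ℝ≥0∞} (hf : Measurable (Function.uncurry f)) (τ : T) : Measurable (f τ) :=
  hf.comp (measurable_const.prodMk measurable_id)

lemma duhamel_mono {f g : ℝ → Euc n → ℝ≥0∞} {t : ℝ} (h : ∀ τ ∈ Set.Ioo 0 t, ∀ x, f τ x ≤ g τ x)
    (x : Euc n) : duhamel β α f t x ≤ duhamel β α g t x :=
  setLIntegral_mono' measurableSet_Ioo fun τ hτ => conv_mono (fun _ => le_rfl) (h τ hτ) x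

lemma duhamel_congr {f g : ℝ → Euc n → ℝ≥0∞} {t : ℝ} (h : ∀ τ ∈ Set.Ioo 0 t, ∀ x, f τ x = g τ x)
    (x : Euc n) : duhamel β α f t x = duhamel β α g t x :=
  le_antisymm (duhamel_mono (fun τ hτ y => (h τ hτ y).le) x)
    (duhamel_mono (fun τ hτ y => (h τ hτ y).ge) x)

variable [NeZero n]

lemma measurable_conv_forceK_sub (hβ : 0 < β) {f : ℝ → Euc n → ℝ≥0∞}
    (hf : Measurable (Function.uncurry f)) :
    Measurable fun z : (ℝ × ℝ) × Euc n => conv (forceK β α (z.1.1 - z.1.2)) (f z.1.2) z.2 := by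
  refine measurable_conv_param (T := ℝ × ℝ) (f := fun w => forceK β α (w.1 - w.2))
    (g := fun w => f w.2) ?_ ?_
  · exact (measurable_forceK_uncurry hβ).comp
      (f := fun z : (ℝ × ℝ) × Euc n => (z.1.1 - z.1.2, z.2)) (by fun_prop)
  · exact hf.comp (f := fun z : (ℝ × ℝ) × Euc n => (z.1.2, z.2)) (by fun_prop)

lemma measurable_conv_forceK_time (hβ : 0 < β) {f : ℝ → Euc n → ℝ≥0∞}
    (hf : Measurable (Function.uncurry f)) (t : ℝ) :
    Measurable (Function.uncurry fun τ x => conv (forceK β α (t - τ)) (f τ) x) :=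
  (measurable_conv_forceK_sub (α := α) hβ hf).comp
    (f := fun z : ℝ × Euc n => ((t, z.1), z.2)) (by fun_prop)

lemma measurable_duhamel (hβ : 0 < β) {f : ℝ → Euc n → ℝ≥0∞}
    (hf : Measurable (Function.uncurry f)) :
    Measurable (Function.uncurry (duhamel β α f)) := by
  have e : Function.uncurry (duhamel β α f) = fun z : ℝ × Euc n => ∫⁻ τ,
      {w : (ℝ × Euc n) × ℝ | 0 < w.2 ∧ w.2 < w.1.1}.indicator
        (fun w => conv (forceK β α (w.1.1 - w.2)) (f w.2) w.1.2) (z, τ) := by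
    ext z
    simp only [Function.uncurry, duhamel]
    rw [← lintegral_indicator measurableSet_Ioo]
    congr 1
  rw [e]
  refine Measurable.lintegral_prod_right' ?_
  refine Measurable.indicator ?_ ?_
  · exact (measurable_conv_forceK_sub (α := α) hβ hf).comp
      (f := fun w : (ℝ × Euc n) × ℝ => ((w.1.1, w.2), w.1.2)) (by fun_prop)
  · exact (measurableSet_lt measurable_const measurable_snd).inter
      (measurableSet_lt measurable_snd measurable_fst.fst)

lemma duhamel_add (hβ : 0 < β) {f g : ℝ → Euc n → ℝ≥0∞} (hf : Measurable (Function.uncurry f))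
    (t : ℝ) (x : Euc n) :
    duhamel β α (fun τ y => f τ y + g τ y) t x = duhamel β α f t x + duhamel β α g t x := by
  simp only [duhamel]
  rw [← lintegral_add_left]
  · congr 1; ext τ
    exact conv_add (measurable_forceK hβ _) (measurable_uncurry_apply hf τ) x
  · exact (measurable_conv_forceK_time (α := α) hβ hf t).comp
      (f := fun τ : ℝ => (τ, x)) (by fun_prop)

lemma duhamel_iSup (hβ : 0 < β) {f : ℕ → ℝ → Euc n → ℝ≥0∞}
    (hf : ∀ k, Measurable (Function.uncurry (f k))) (hm : ∀ τ y, Monotone fun k => f k τ y)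
    (t : ℝ) (x : Euc n) :
    duhamel β α (fun τ y => ⨆ k, f k τ y) t x = ⨆ k, duhamel β α (f k) t x := by
  simp only [duhamel]
  rw [← lintegral_iSup]
  · congr 1; ext τ
    exact conv_iSup (measurable_forceK hβ _) (fun k => measurable_uncurry_apply (hf k) τ)
      (hm τ) x
  · intro k
    exact (measurable_conv_forceK_time (α := α) hβ (hf k) t).comp
      (f := fun τ : ℝ => (τ, x)) (by fun_prop)
  · intro i j hij τ
    exact conv_mono (fun _ => le_rfl) (fun y => hm τ y hij) x

/-- Before `t₀` the semigroup law pulls `S_β(t)` out of the integral; after `t₀` time is shifted.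
This identity lies behind every restart and behind continuity in time. -/
lemma duhamel_add_time (hβ : 0 < β) (hβ2 : β ≤ 2) {f : ℝ → Euc n → ℝ≥0∞}
    (hf : Measurable (Function.uncurry f)) {t₀ t : ℝ} (ht₀ : 0 ≤ t₀) (ht : 0 < t) (x : Euc n) :
    duhamel β α f (t₀ + t) x =
      conv (heatK β t) (duhamel β α f t₀) x + duhamel β α (fun τ => f (t₀ + τ)) t x := by
  have hU : Set.Ioo 0 (t₀ + t) =ᵐ[volume] (Set.Ioo 0 t₀ ∪ Set.Ioo t₀ (t₀ + t) : Set ℝ) := by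
    have h1 : (Set.Ioo 0 t₀ ∪ Set.Ioo t₀ (t₀ + t) : Set ℝ) =ᵐ[volume]
        (Set.Ioc 0 t₀ ∪ Set.Ioo t₀ (t₀ + t) : Set ℝ) :=
      ae_eq_set_union Ioo_ae_eq_Ioc (ae_eq_refl _)
    refine EventuallyEq.trans ?_ h1.symm
    rw [Set.Ioc_union_Ioo_eq_Ioo ht₀ (by linarith)]
    exact ae_eq_refl _
  rw [duhamel, setLIntegral_congr hU, lintegral_union measurableSet_Ioo
    (Set.disjoint_left.2 fun y hy hy' => (hy.2.trans hy'.1).false)]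
  congr 1
  · have := conv_lintegral (ν := volume.restrict (Set.Ioo 0 t₀)) (measurable_heatK (n := n) hβ t)
      (measurable_conv_forceK_time (α := α) hβ hf t₀) x
    change _ = conv (heatK β t) (fun y => duhamel β α f t₀ y) x
    simp only [duhamel]
    rw [this]
    refine setLIntegral_congr_fun measurableSet_Ioo fun τ hτ => ?_
    rw [conv_heatK_conv_forceK hβ hβ2 ht (by linarith [hτ.2]) (measurable_uncurry_apply hf τ)]
    congr 2; ring
  · rw [duhamel, ← lintegral_indicator measurableSet_Ioo, ← lintegral_indicator measurableSet_Ioo,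
      ← lintegral_add_left_eq_self _ t₀]
    congr 1; ext τ
    by_cases hτ : τ ∈ Set.Ioo 0 t
    · rw [Set.indicator_of_mem hτ, Set.indicator_of_mem (by
        constructor <;> linarith [hτ.1, hτ.2]), add_sub_add_left_eq_sub]
    · rw [Set.indicator_of_notMem hτ, Set.indicator_of_notMem fun h => hτ (by
        constructor <;> linarith [h.1, h.2])]

lemma duhamel_le_of_le (hβ : 0 < β) (hβ2 : β ≤ 2) {f : ℝ → Euc n → ℝ≥0∞}
    (hf : Measurable (Function.uncurry f)) {t : ℝ} {C : ℝ≥0∞}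
    (hC : ∀ τ ∈ Set.Ioo 0 t, ∀ x, conv (rieszK α) (f τ) x ≤ C) (x : Euc n) :
    duhamel β α f t x ≤ ENNReal.ofReal t * C := by
  calc duhamel β α f t x ≤ ∫⁻ _ in Set.Ioo 0 t, C := by
        refine setLIntegral_mono' measurableSet_Ioo fun τ hτ => ?_
        rw [conv_forceK hβ _ (measurable_uncurry_apply hf τ)]
        exact conv_heatK_le hβ hβ2 (by linarith [hτ.2]) (ae_of_all _ (hC τ hτ)) x
    _ = _ := by rw [setLIntegral_const, Real.volume_Ioo, sub_zero, mul_comm]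

lemma lpNrm_duhamel_le (hβ : 0 < β) (hβ2 : β ≤ 2) {f : ℝ → Euc n → ℝ≥0∞}
    (hf : Measurable (Function.uncurry f)) {t s : ℝ} (hs : 1 < s) {w : ℝ → ℝ≥0∞}
    (hw : Measurable w) (hw0 : ∀ τ ∈ Set.Ioo 0 t, w τ ≠ 0) (hwt : ∀ τ ∈ Set.Ioo 0 t, w τ ≠ ∞)
    (h : ∀ τ ∈ Set.Ioo 0 t, lpNrm volume s (conv (rieszK α) (f τ)) ≤ w τ) :
    lpNrm volume s (duhamel β α f t) ≤ ∫⁻ τ in Set.Ioo 0 t, w τ := by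
  refine lpNrm_lintegral_le (ν := volume.restrict (Set.Ioo 0 t)) hs
    (measurable_conv_forceK_time (α := α) hβ hf t) hw
    ((ae_restrict_iff' measurableSet_Ioo).2 (ae_of_all _ hw0))
    ((ae_restrict_iff' measurableSet_Ioo).2 (ae_of_all _ hwt))
    ((ae_restrict_iff' measurableSet_Ioo).2 (ae_of_all _ fun τ hτ => ?_))
  have hfτ := measurable_uncurry_apply hf τ
  refine le_trans (le_of_eq ?_) ((lpNrm_conv_heatK_le hβ hβ2 (t := t - τ) (by linarith [hτ.2])
    (measurable_conv (measurable_rieszK α) hfτ) hs.le).trans (h τ hτ))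
  rw [← conv_forceK hβ _ hfτ]

lemma lpNrm_duhamel_le_const (hβ : 0 < β) (hβ2 : β ≤ 2) {f : ℝ → Euc n → ℝ≥0∞}
    (hf : Measurable (Function.uncurry f)) {t s : ℝ} (hs : 1 < s) {C : ℝ≥0∞} (hC0 : C ≠ 0)
    (hC : C ≠ ∞) (h : ∀ τ ∈ Set.Ioo 0 t, lpNrm volume s (conv (rieszK α) (f τ)) ≤ C) :
    lpNrm volume s (duhamel β α f t) ≤ ENNReal.ofReal t * C := by
  refine (lpNrm_duhamel_le hβ hβ2 hf hs measurable_const (fun _ _ => hC0) (fun _ _ => hC) h).trans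
    (le_of_eq ?_)
  rw [setLIntegral_const, Real.volume_Ioo, sub_zero, mul_comm]

end Duhamel

/-! ### Picard iteration and the minimal solution. -/

section MinimalSolution

variable {n : ℕ} {α β p : ℝ} {f₀ : Euc n → ℝ≥0∞}

/-- The Picard iterates of `U = S_β(t) f₀ + ∫_0^t S_β(t - τ) I_α(U(τ) ^ p) dτ`, starting at `0`. -/
def picard (β α p : ℝ) (f₀ : Euc n → ℝ≥0∞) : ℕ → ℝ → Euc n → ℝ≥0∞
  | 0 => fun _ _ => 0
  | k + 1 => fun t x => conv (heatK β t) f₀ x +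
      duhamel β α (fun τ y => picard β α p f₀ k τ y ^ p) t x

/-- The minimal solution of `U = S_β(t) f₀ + ∫_0^t S_β(t - τ) I_α(U(τ) ^ p) dτ` with values in
`[0, ∞]`. -/
def minSol (β α p : ℝ) (f₀ : Euc n → ℝ≥0∞) (t : ℝ) (x : Euc n) : ℝ≥0∞ :=
  ⨆ k, picard β α p f₀ k t x

lemma picard_succ (k : ℕ) (t : ℝ) (x : Euc n) :
    picard β α p f₀ (k + 1) t x = conv (heatK β t) f₀ x +
      duhamel β α (fun τ y => picard β α p f₀ k τ y ^ p) t x := rfl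

lemma picard_le_minSol (k : ℕ) (t : ℝ) (x : Euc n) :
    picard β α p f₀ k t x ≤ minSol β α p f₀ t x :=
  le_iSup (fun k => picard β α p f₀ k t x) k

lemma picard_le_succ (hp : 0 ≤ p) (k : ℕ) (t : ℝ) (x : Euc n) :
    picard β α p f₀ k t x ≤ picard β α p f₀ (k + 1) t x := by
  induction k generalizing t x with
  | zero => exact zero_le
  | succ k ih =>
    rw [picard_succ, picard_succ]
    gcongr 1
    exact duhamel_mono (fun τ _ y => ENNReal.rpow_le_rpow (ih τ y) hp) x

lemma monotone_picard (hp : 0 ≤ p) (t : ℝ) (x : Euc n) :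
    Monotone fun k => picard β α p f₀ k t x :=
  monotone_nat_of_le_succ fun k => picard_le_succ hp k t x

lemma iSup_picard_rpow (hp : 0 < p) (t : ℝ) (x : Euc n) :
    minSol β α p f₀ t x ^ p = ⨆ k, picard β α p f₀ k t x ^ p := by
  exact (ENNReal.orderIsoRpow p hp).map_iSup (fun k => picard β α p f₀ k t x)

variable [NeZero n]

lemma measurable_conv_heatK_uncurry (hβ : 0 < β) (hf₀ : Measurable f₀) :
    Measurable (Function.uncurry fun t => conv (heatK β t) f₀) :=
  measurable_conv_param (measurable_heatK_uncurry hβ) (hf₀.comp measurable_snd)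

lemma measurable_picard (hβ : 0 < β) (hf₀ : Measurable f₀) (k : ℕ) :
    Measurable (Function.uncurry (picard β α p f₀ k)) := by
  induction k with
  | zero => exact measurable_const
  | succ k ih =>
    exact (measurable_conv_heatK_uncurry hβ hf₀).add (measurable_duhamel hβ (ih.pow_const p))

lemma measurable_minSol (hβ : 0 < β) (hf₀ : Measurable f₀) :
    Measurable (Function.uncurry (minSol β α p f₀)) := by
  have e : Function.uncurry (minSol β α p f₀) =
      fun z => ⨆ k, Function.uncurry (picard β α p f₀ k) z := by
    ext z; rfl
  rw [e]
  exact Measurable.iSup fun k => measurable_picard hβ hf₀ k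

/-- Monotone convergence passes through the power, the convolution and the time integral, so the
equation holds everywhere, also where both sides are infinite. -/
lemma minSol_eq (hβ : 0 < β) (hp : 0 < p) (hf₀ : Measurable f₀) (t : ℝ) (x : Euc n) :
    minSol β α p f₀ t x = conv (heatK β t) f₀ x +
      duhamel β α (fun τ y => minSol β α p f₀ τ y ^ p) t x := by
  simp_rw [iSup_picard_rpow hp]
  rw [duhamel_iSup hβ (fun k => (measurable_picard hβ hf₀ k).pow_const p)
    (fun τ y i j hij => ENNReal.rpow_le_rpow (monotone_picard hp.le τ y hij) hp.le),
    ENNReal.add_iSup]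
  refine le_antisymm (iSup_le fun k => ?_) (iSup_le fun k => picard_le_minSol (k + 1) t x)
  exact (picard_le_succ hp.le k t x).trans (le_iSup (fun k => picard β α p f₀ (k + 1) t x) k)

lemma minSol_add_time (hβ : 0 < β) (hβ2 : β ≤ 2) (hp : 0 < p) (hf₀ : Measurable f₀) {t₀ t : ℝ}
    (ht₀ : 0 < t₀) (ht : 0 < t) (x : Euc n) :
    minSol β α p f₀ (t₀ + t) x = conv (heatK β t) (minSol β α p f₀ t₀) x +
      duhamel β α (fun τ y => minSol β α p f₀ (t₀ + τ) y ^ p) t x := by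
  have hm := (measurable_minSol (α := α) (p := p) hβ hf₀).pow_const p
  rw [minSol_eq hβ hp hf₀, duhamel_add_time hβ hβ2 hm ht₀.le ht, ← add_assoc, add_comm t₀ t,
    ← conv_heatK_conv_heatK hβ hβ2 ht ht₀ hf₀, ← conv_add (measurable_heatK hβ t)
      (measurable_conv (measurable_heatK hβ t₀) hf₀)]
  congr 2
  ext y
  exact (minSol_eq hβ hp hf₀ t₀ y).symm

/-- Restarting from the full value of the minimal solution at `t₀`, rather than from an iterate, can
only increase the result. This one-sided comparison is all that continuation needs. -/
lemma picard_add_time_le (hβ : 0 < β) (hβ2 : β ≤ 2) (hp : 0 < p) (hf₀ : Measurable f₀) {t₀ : ℝ}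
    (ht₀ : 0 < t₀) (k : ℕ) {t : ℝ} (ht : 0 < t) (x : Euc n) :
    picard β α p f₀ k (t₀ + t) x ≤ minSol β α p (minSol β α p f₀ t₀) t x := by
  induction k generalizing t x with
  | zero => exact zero_le
  | succ k ih =>
    have hm := (measurable_picard (α := α) (p := p) hβ hf₀ k).pow_const p
    have hms : Measurable (minSol β α p f₀ t₀) :=
      measurable_uncurry_apply (measurable_minSol hβ hf₀) t₀
    rw [picard_succ, duhamel_add_time hβ hβ2 hm ht₀.le ht, ← add_assoc, add_comm t₀ t,
      ← conv_heatK_conv_heatK hβ hβ2 ht ht₀ hf₀, ← conv_add (measurable_heatK hβ t)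
        (measurable_conv (measurable_heatK hβ t₀) hf₀), minSol_eq hβ hp hms]
    refine add_le_add (conv_mono (fun _ => le_rfl) (fun y => ?_) x) (duhamel_mono (fun τ hτ y =>
        ?_) x)
    · exact picard_le_minSol (k + 1) t₀ y
    · exact ENNReal.rpow_le_rpow (ih hτ.1 y) hp.le

lemma minSol_add_time_le (hβ : 0 < β) (hβ2 : β ≤ 2) (hp : 0 < p) (hf₀ : Measurable f₀) {t₀ : ℝ}
    (ht₀ : 0 < t₀) {t : ℝ} (ht : 0 < t) (x : Euc n) :
    minSol β α p f₀ (t₀ + t) x ≤ minSol β α p (minSol β α p f₀ t₀) t x :=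
  iSup_le fun k => picard_add_time_le hβ hβ2 hp hf₀ ht₀ k ht x

end MinimalSolution

/-! ### Local bounds for the minimal solution -/

section LocalBounds

variable {n : ℕ} {α β p s : ℝ}

lemma lpNrm_iSup_le {f : ℕ → Euc n → ℝ≥0∞} (hs : 0 < s) (hf : ∀ k, Measurable (f k))
    (hm : ∀ x, Monotone fun k => f k x) {M : ℝ≥0∞} (h : ∀ k, lpNrm volume s (f k) ≤ M) :
    lpNrm volume s (fun x => ⨆ k, f k x) ≤ M := by
  rw [lpNrm_le_iff hs]
  have e : ∀ x, (⨆ k, f k x) ^ s = ⨆ k, f k x ^ s := fun x =>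
    (ENNReal.orderIsoRpow s hs).map_iSup (fun k => f k x)
  simp_rw [e]
  rw [lintegral_iSup (fun k => (hf k).pow_const s)
    (fun i j hij x => ENNReal.rpow_le_rpow (hm x hij) hs.le)]
  exact iSup_le fun k => (lpNrm_le_iff hs).1 (h k)

lemma lpNrm_rpow_le_of_le {M : ℝ≥0∞} (hs : 0 < s) (hp : 1 < p) {b : ℝ} (hb : s ≤ (p - 1) * b)
    {v : Euc n → ℝ≥0∞} (hv : Measurable v) (hM : ∀ᵐ x, v x ≤ M) (hN : lpNrm volume s v ≤ M) :
    lpNrm volume b (fun x => v x ^ (p - 1)) ≤ M ^ (p - 1) := by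
  have hp1 : 0 < p - 1 := by linarith
  rw [lpNrm_rpow_left hp1]
  gcongr 1
  refine (lpNrm_le_of_le_of_le hs hb hv hM hN).trans (le_of_eq ?_)
  have hb' : 0 < (p - 1) * b := hs.trans_le hb
  rw [← ENNReal.rpow_add_of_nonneg _ _ _ (by positivity), sub_add_cancel, ENNReal.rpow_one]
  rw [sub_nonneg, div_le_one hb']; exact hb

/-- The number `1 / b` must exceed `α / n`, so that the far Riesz kernel is in `L^a`, and be at most
`1 - 1/s`, so that `a ≤ s` as Young's inequality requires; `s > n / (n - α)` says that these are
compatible. The bound `κ` stands for the integrability available for `v ^ (p - 1)`, namely `(p - 1)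
/ s` or `(p - 1) / r`. -/
lemma exists_holder_exponents (hα : 0 < α) (hαn : α < n) (hs1 : (n : ℝ) / (n - α) < s) {κ : ℝ}
    (hκ : α / n < κ) :
    ∃ a b : ℝ, a.HolderConjugate b ∧ a ≤ s ∧ n < a * (n - α) ∧ 1 / b ≤ κ := by
  have hn : (0 : ℝ) < n := hα.trans hαn
  have hna : 0 < (n : ℝ) - α := by linarith
  have hs0 : 0 < s := lt_trans (by positivity) hs1
  have h1 : α / n < 1 - 1 / s := by
    rw [div_lt_iff₀ hna] at hs1
    rw [lt_sub_iff_add_lt, div_add_div _ _ hn.ne' hs0.ne', div_lt_one (by positivity)]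
    nlinarith
  set c := min κ (1 - 1 / s) with hc
  have hc1 : α / n < c := lt_min hκ h1
  have hc0 : 0 < c := lt_trans (by positivity) hc1
  have hc2 : c ≤ 1 - 1 / s := min_le_right _ _
  have hs' : 0 < 1 / s := by positivity
  have hc3 : 0 < 1 - c := by linarith
  refine ⟨(1 - c)⁻¹, c⁻¹, ?_, ?_, ?_, ?_⟩
  · rw [Real.holderConjugate_iff]
    refine ⟨(one_lt_inv₀ hc3).2 (by linarith), by rw [inv_inv, inv_inv]; ring⟩
  · rw [inv_le_comm₀ hc3 hs0, ← one_div]; linarith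
  · rw [inv_mul_eq_div, lt_div_iff₀ hc3]
    have := (div_lt_iff₀ hn).1 hc1
    nlinarith
  · rw [one_div, inv_inv]; exact min_le_left _ _

/-- Here `κ = (p - 1) / s`, which exceeds `α / n` exactly because `s < n (p - 1) / α`, and `v ^ (p -
1)` is in `L^b` by interpolation between `L^s` and `L^∞`. The factor `w` is kept apart so that the
estimate serves both the nonlinearity, with `w = v`, and its differences. -/
lemma exists_conv_rieszK_rpow_mul_le (hα : 0 < α) (hαn : α < n) [NeZero n] (hp : 1 < p)
    (hs1 : (n : ℝ) / (n - α) < s) (hs2 : s < n * (p - 1) / α) :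
    ∃ C : ℝ≥0∞, C ≠ ∞ ∧ C ≠ 0 ∧ ∀ (M : ℝ≥0∞) (v w : Euc n → ℝ≥0∞), Measurable v → Measurable w →
      (∀ᵐ x, v x ≤ M) → lpNrm volume s v ≤ M →
      (∀ N : ℝ≥0∞, (∀ᵐ x, w x ≤ N) → ∀ x,
        conv (rieszK α) (fun y => v y ^ (p - 1) * w y) x ≤ C * M ^ (p - 1) * N) ∧
      lpNrm volume s (conv (rieszK α) (fun y => v y ^ (p - 1) * w y)) ≤
        C * M ^ (p - 1) * lpNrm volume s w := by
  have hn : (0 : ℝ) < n := hα.trans hαn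
  have hna : 0 < (n : ℝ) - α := by linarith
  have hs0 : 0 < s := lt_trans (by positivity) hs1
  have hp1 : 0 < p - 1 := by linarith
  have hκ : α / n < (p - 1) / s := by
    rw [lt_div_iff₀ hα] at hs2
    rw [div_lt_div_iff₀ hn hs0]; linarith
  obtain ⟨a, b, hab, has, han, hb⟩ := exists_holder_exponents hα hαn hs1 hκ
  have hb0 : 0 < b := hab.symm.pos
  have hsb : s ≤ (p - 1) * b := by
    rw [div_le_div_iff₀ hb0 hs0, one_mul] at hb; exact hb
  -- The summand `1` only makes the constant nonzero.
  refine ⟨(∫⁻ y : Euc n, rieszNear α y) + lpNrm volume a (rieszFar α : Euc n → ℝ≥0∞) + 1,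
    ?_, by simp, ?_⟩
  · have h1 := lintegral_rieszNear_ne_top (n := n) hα hαn
    have h2 := lpNrm_rieszFar_ne_top (n := n) hα hαn hab.pos han
    exact ENNReal.add_ne_top.2 ⟨ENNReal.add_ne_top.2 ⟨h1, h2⟩, by simp⟩
  intro M v w hv hw hM hN
  have h3 := lpNrm_rpow_le_of_le hs0 hp hsb hv hM hN
  have h4 : ∀ᵐ x, v x ^ (p - 1) ≤ M ^ (p - 1) := hM.mono fun x hx => ENNReal.rpow_le_rpow hx hp1.le
  have h5 : (∫⁻ y : Euc n, rieszNear α y) * M ^ (p - 1) +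
      lpNrm volume a (rieszFar α : Euc n → ℝ≥0∞) * lpNrm volume b (fun x => v x ^ (p - 1)) ≤
      ((∫⁻ y : Euc n, rieszNear α y) + lpNrm volume a (rieszFar α : Euc n → ℝ≥0∞) + 1) *
        M ^ (p - 1) := by
    rw [add_mul, add_mul]
    exact le_add_right (add_le_add le_rfl (mul_le_mul' le_rfl h3))
  constructor
  · intro N hwN x
    exact (conv_rieszK_le hab (hv.pow_const _) hw h4 hwN x).trans (mul_le_mul' h5 le_rfl)
  · exact (lpNrm_conv_rieszK_le hab has (hv.pow_const _) hw h4).trans (mul_le_mul' h5 le_rfl)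

lemma rpow_sub_one_mul_self (hp : 1 < p) (a : ℝ≥0∞) : a ^ (p - 1) * a = a ^ p := by
  nth_rewrite 2 [← ENNReal.rpow_one a]
  rw [← ENNReal.rpow_add_of_nonneg _ _ (by linarith) zero_le_one, sub_add_cancel]

lemma exists_conv_rieszK_rpow_le (hα : 0 < α) (hαn : α < n) [NeZero n] (hp : 1 < p)
    (hs1 : (n : ℝ) / (n - α) < s) (hs2 : s < n * (p - 1) / α) :
    ∃ C : ℝ≥0∞, C ≠ ∞ ∧ C ≠ 0 ∧ ∀ (M : ℝ≥0∞) (v : Euc n → ℝ≥0∞), Measurable v →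
      (∀ᵐ x, v x ≤ M) → lpNrm volume s v ≤ M →
      (∀ x, conv (rieszK α) (fun y => v y ^ p) x ≤ C * M ^ p) ∧
      lpNrm volume s (conv (rieszK α) (fun y => v y ^ p)) ≤ C * M ^ p := by
  obtain ⟨C, hC, hC0, h⟩ := exists_conv_rieszK_rpow_mul_le hα hαn hp hs1 hs2
  refine ⟨C, hC, hC0, fun M v hv hM hN => ?_⟩
  obtain ⟨h1, h2⟩ := h M v v hv hv hM hN
  simp_rw [rpow_sub_one_mul_self hp] at h1 h2
  refine ⟨fun x => (h1 M hM x).trans (le_of_eq ?_), (h2.trans (mul_le_mul' le_rfl hN)).trans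
      (le_of_eq ?_)⟩ <;>
  rw [mul_assoc, rpow_sub_one_mul_self hp]

/-- The iterates stay in the ball of radius `2 * M` as long as the Duhamel term, at most `t * C * (2
* M) ^ p`, does not exceed `M`. Hence the lifespan `δ = M / D`, which depends on the datum only
through the bound `M`. -/
lemma exists_minSol_le_of_le (hα : 0 < α) (hαn : α < n) [NeZero n] (hβ : 0 < β) (hβ2 : β ≤ 2)
    (hp : 1 < p) (hs1 : (n : ℝ) / (n - α) < s) (hs2 : s < n * (p - 1) / α) {M : ℝ≥0∞}
    (hM0 : M ≠ 0) (hM : M ≠ ∞) :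
    ∃ δ : ℝ, 0 < δ ∧ ∀ f₀ : Euc n → ℝ≥0∞, Measurable f₀ → (∀ᵐ x, f₀ x ≤ M) →
      lpNrm volume s f₀ ≤ M → ∀ t ∈ Set.Ioc 0 δ,
        (∀ x, minSol β α p f₀ t x ≤ 2 * M) ∧ lpNrm volume s (minSol β α p f₀ t) ≤ 2 * M := by
  obtain ⟨C, hC, hC0, h⟩ := exists_conv_rieszK_rpow_le (n := n) hα hαn hp hs1 hs2
  have hna : 0 < (n : ℝ) - α := by linarith
  have hs : 1 < s := lt_trans (by rw [one_lt_div hna]; linarith) hs1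
  set D := C * (2 * M) ^ p with hD
  have h2M : (2 * M) ≠ ∞ := ENNReal.mul_ne_top (by simp) hM
  have hDt : D ≠ ∞ := ENNReal.mul_ne_top hC (ENNReal.rpow_ne_top_of_nonneg (by linarith) h2M)
  have hD0 : D ≠ 0 := mul_ne_zero hC0 (by
    simp only [ne_eq, ENNReal.rpow_eq_zero_iff, not_or, not_and]
    exact ⟨fun h => absurd h (mul_ne_zero (by simp) hM0), fun h => absurd h h2M⟩)
  have hMD : M / D ≠ ∞ := ENNReal.div_ne_top hM hD0
  refine ⟨(M / D).toReal, ENNReal.toReal_pos (ENNReal.div_ne_zero.2 ⟨hM0, hDt⟩) hMD, ?_⟩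
  intro f₀ hf₀ hb hN
  have key : ∀ k, ∀ t ∈ Set.Ioc 0 (M / D).toReal,
      (∀ x, picard β α p f₀ k t x ≤ 2 * M) ∧ lpNrm volume s (picard β α p f₀ k t) ≤ 2 * M := by
    intro k
    induction k with
    | zero =>
      intro t _
      refine ⟨fun x => zero_le, ?_⟩
      simp [picard, lpNrm, ENNReal.zero_rpow_of_pos (one_pos.trans hs),
        ENNReal.zero_rpow_of_pos (inv_pos.2 (one_pos.trans hs))]
    | succ k ih =>
      intro t ht
      have hm := measurable_picard (α := α) (p := p) hβ hf₀ k
      have hmp := hm.pow_const p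
      have htD : ENNReal.ofReal t * D ≤ M := by
        calc ENNReal.ofReal t * D ≤ M / D * D := by
              gcongr
              exact ENNReal.ofReal_le_of_le_toReal ht.2
          _ = M := ENNReal.div_mul_cancel hD0 hDt
      have hτ : ∀ τ ∈ Set.Ioo 0 t, (∀ x, conv (rieszK α) (fun y =>
          picard β α p f₀ k τ y ^ p) x ≤ D) ∧
          lpNrm volume s (conv (rieszK α) (fun y => picard β α p f₀ k τ y ^ p)) ≤ D := fun τ hτ =>
              by
        have := ih τ ⟨hτ.1, hτ.2.le.trans ht.2⟩
        exact h (2 * M) _ (measurable_uncurry_apply hm τ) (ae_of_all _ this.1) this.2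
      constructor
      · intro x
        rw [picard_succ, two_mul]
        exact add_le_add (conv_heatK_le hβ hβ2 ht.1 hb x)
          ((duhamel_le_of_le hβ hβ2 hmp (fun τ h' => (hτ τ h').1) x).trans htD)
      · rw [two_mul]
        refine (lpNrm_add_le hs.le (measurable_conv (measurable_heatK hβ t) hf₀)
          (measurable_uncurry_apply (measurable_duhamel hβ hmp) t)).trans (add_le_add ?_ ?_)
        · exact (lpNrm_conv_heatK_le hβ hβ2 ht.1 hf₀ hs.le).trans hN
        · exact (lpNrm_duhamel_le_const hβ hβ2 hmp hs hD0 hDt (fun τ h' => (hτ τ h').2)).trans htD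
  intro t ht
  exact ⟨fun x => iSup_le fun k => (key k t ht).1 x,
    lpNrm_iSup_le (one_pos.trans hs) (fun k => measurable_uncurry_apply
        (measurable_picard hβ hf₀ k) t)
      (fun x => monotone_picard (by linarith) t x) (fun k => (key k t ht).2)⟩

lemma exists_minSol_le_of_le_at (hα : 0 < α) (hαn : α < n) [NeZero n] (hβ : 0 < β) (hβ2 : β ≤ 2)
    (hp : 1 < p) (hs1 : (n : ℝ) / (n - α) < s) (hs2 : s < n * (p - 1) / α) {M : ℝ≥0∞}
    (hM0 : M ≠ 0) (hM : M ≠ ∞) :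
    ∃ δ : ℝ, 0 < δ ∧ ∀ f₀ : Euc n → ℝ≥0∞, Measurable f₀ → ∀ t₀ > 0,
      (∀ᵐ x, minSol β α p f₀ t₀ x ≤ M) → lpNrm volume s (minSol β α p f₀ t₀) ≤ M →
      ∀ t ∈ Set.Ioc t₀ (t₀ + δ),
        (∀ x, minSol β α p f₀ t x ≤ 2 * M) ∧ lpNrm volume s (minSol β α p f₀ t) ≤ 2 * M := by
  obtain ⟨δ, hδ, h⟩ := exists_minSol_le_of_le hα hαn hβ hβ2 hp hs1 hs2 hM0 hM
  have hna : 0 < (n : ℝ) - α := by linarith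
  have hs0 : 0 < s := lt_trans (div_pos (by linarith) hna) hs1
  refine ⟨δ, hδ, fun f₀ hf₀ t₀ ht₀ h1 h2 t ht => ?_⟩
  have hm := measurable_uncurry_apply (measurable_minSol (α := α) (p := p) hβ hf₀) t₀
  obtain ⟨h3, h4⟩ := h _ hm h1 h2 (t - t₀) ⟨by linarith [ht.1], by linarith [ht.2]⟩
  have h5 : ∀ x, minSol β α p f₀ t x ≤ minSol β α p (minSol β α p f₀ t₀) (t - t₀) x := fun x => by
    have := minSol_add_time_le (α := α) hβ hβ2 (p := p) (by linarith) hf₀ ht₀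
      (t := t - t₀) (by linarith [ht.1]) x
    rwa [add_sub_cancel] at this
  exact ⟨fun x => (h5 x).trans (h3 x), (lpNrm_mono hs0 h5).trans h4⟩

end LocalBounds

/-! ### Real-valued functions -/

section RealForms

variable {n : ℕ} {α β p s : ℝ}

lemma eLpNorm_eq_lpNrm (hs : 0 < s) (f : Euc n → ℝ) :
    eLpNorm f (ENNReal.ofReal s) volume = lpNrm volume s (fun x => ‖f x‖ₑ) := by
  rw [eLpNorm_eq_lintegral_rpow_enorm_toReal (by simpa using hs) ENNReal.ofReal_ne_top,
    ENNReal.toReal_ofReal hs.le]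
  rfl

lemma enorm_rpow_eq_ofReal (hp : 0 ≤ p) (a : ℝ) : ‖a‖ₑ ^ p = ENNReal.ofReal (|a| ^ p) := by
  rw [Real.enorm_eq_ofReal_abs, ENNReal.ofReal_rpow_of_nonneg (abs_nonneg a) hp]

lemma rieszPotential_eq (hα : 0 < α) (hαn : α < n) (hp : 0 ≤ p) {g : Euc n → ℝ}
    (hg : AEStronglyMeasurable g volume) (x : Euc n) :
    rieszPotential α (fun y => |g y| ^ p) x =
      (conv (rieszK α) (fun y => ‖g y‖ₑ ^ p) x).toReal := by
  have hA := rieszConstant_pos hα hαn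
  have hm : AEStronglyMeasurable (fun y => |g y| ^ p / ‖x - y‖ ^ ((n : ℝ) - α)) volume := by
    have := hg.aemeasurable
    exact AEMeasurable.aestronglyMeasurable (by fun_prop)
  rw [rieszPotential, integral_eq_lintegral_of_nonneg_ae (ae_of_all _ fun y => by positivity) hm,
    ← ENNReal.toReal_ofReal hA.le, ← ENNReal.toReal_mul,
    ← lintegral_const_mul' _ _ ENNReal.ofReal_ne_top, conv]
  congr 2; ext y
  rw [enorm_rpow_eq_ofReal hp, rieszK, ← ENNReal.ofReal_mul hA.le,
    ← ENNReal.ofReal_mul (by positivity)]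
  congr 1; rw [div_eq_mul_inv]; ring

lemma fracHeatSemigroup_toReal [NeZero n] (hβ : 0 < β) (hβ2 : β ≤ 2) {t : ℝ} (ht : 0 < t)
    {F : Euc n → ℝ≥0∞} (hF : Measurable F) (hFt : ∀ y, F y ≠ ∞) (x : Euc n) :
    fracHeatSemigroup β t (fun y => (F y).toReal) x = (conv (heatK β t) F x).toReal := by
  have hc := (continuous_fracHeatKernel (n := n) hβ ht).measurable
  rw [fracHeatSemigroup, integral_eq_lintegral_of_nonneg_ae
    (ae_of_all _ fun y => mul_nonneg (fracHeatKernel_nonneg hβ hβ2 ht _) ENNReal.toReal_nonneg)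
    (Measurable.aestronglyMeasurable (by fun_prop)), conv]
  congr 2; ext y
  rw [ENNReal.ofReal_mul (fracHeatKernel_nonneg hβ hβ2 ht _), ENNReal.ofReal_toReal (hFt y),
    heatK_eq hβ ht]

lemma duhamelIntegrand_eq [NeZero n] (hα : 0 < α) (hαn : α < n) (hβ : 0 < β) (hβ2 : β ≤ 2)
    (hp : 0 ≤ p) {u : ℝ → Euc n → ℝ} {t τ : ℝ} (hτ : τ < t)
    (hu : AEStronglyMeasurable (u τ) volume)
    (hfin : ∀ x, conv (rieszK α) (fun y => ‖u τ y‖ₑ ^ p) x ≠ ∞) (x : Euc n) :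
    duhamelIntegrand α β p u t x τ =
      (conv (heatK β (t - τ)) (conv (rieszK α) (fun y => ‖u τ y‖ₑ ^ p)) x).toReal := by
  rw [duhamelIntegrand, show rieszPotential α (fun y => |u τ y| ^ p) =
    fun x => (conv (rieszK α) (fun y => ‖u τ y‖ₑ ^ p) x).toReal from
      funext (rieszPotential_eq hα hαn hp hu)]
  refine fracHeatSemigroup_toReal hβ hβ2 (by linarith) ?_ hfin x
  rw [conv_congr_ae (g' := fun y => ‖hu.mk (u τ) y‖ₑ ^ p)
    (hu.ae_eq_mk.mono fun y hy => by simp only [hy])]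
  have := hu.stronglyMeasurable_mk.measurable
  exact measurable_conv (measurable_rieszK α) (by fun_prop)

end RealForms

/-! ### Uniqueness -/

section Uniqueness

variable {n : ℕ} {α β p s : ℝ}

/-- For `a > b`, Bernoulli's inequality at `b / a` replaces the mean value theorem. -/
lemma rpow_le_rpow_add_mul (hp : 1 ≤ p) {a b : ℝ} (ha : 0 ≤ a) (hb : 0 ≤ b) :
    a ^ p ≤ b ^ p + p * (a + b) ^ (p - 1) * |a - b| := by
  rcases le_or_gt a b with hab | hab
  · have := Real.rpow_le_rpow ha hab (by linarith : 0 ≤ p)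
    have h2 : 0 ≤ p * (a + b) ^ (p - 1) * |a - b| := by positivity
    linarith
  have ha0 : 0 < a := hb.trans_lt hab
  have h1 := one_add_mul_self_le_rpow_one_add (s := b / a - 1)
    (by have : 0 ≤ b / a := by positivity
        linarith) hp
  rw [add_sub_cancel, Real.div_rpow hb ha0.le, le_div_iff₀ (by positivity)] at h1
  have e : a ^ p = a ^ (p - 1) * a := by
    rw [← Real.rpow_add_one ha0.ne', sub_add_cancel]
  have h2 : a ^ p ≤ b ^ p + p * a ^ (p - 1) * (a - b) := by
    have h3 : (1 + p * (b / a - 1)) * a ^ p = a ^ p - p * a ^ (p - 1) * (a - b) := by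
      rw [e]; field_simp; ring
    linarith
  rw [abs_of_pos (sub_pos.2 hab)]
  refine h2.trans ?_
  have : 0 ≤ a - b := by linarith
  have : 0 ≤ p - 1 := by linarith
  gcongr
  linarith

lemma enorm_rpow_le_enorm_rpow_add (hp : 1 ≤ p) (a b : ℝ) :
    ‖a‖ₑ ^ p ≤ ‖b‖ₑ ^ p + (‖a‖ₑ + ‖b‖ₑ) ^ (p - 1) * (ENNReal.ofReal p * ‖a - b‖ₑ) := by
  have hp0 : 0 ≤ p := by linarith
  have hp1 : 0 ≤ p - 1 := by linarith
  rw [enorm_rpow_eq_ofReal hp0, enorm_rpow_eq_ofReal hp0]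
  simp only [Real.enorm_eq_ofReal_abs]
  rw [← ENNReal.ofReal_add (abs_nonneg _) (abs_nonneg _),
    ENNReal.ofReal_rpow_of_nonneg (by positivity) hp1, ← ENNReal.ofReal_mul hp0,
    ← ENNReal.ofReal_mul (by positivity), ← ENNReal.ofReal_add (by positivity) (by positivity)]
  refine ENNReal.ofReal_le_ofReal ((rpow_le_rpow_add_mul hp (abs_nonneg a) (abs_nonneg b)).trans ?_)
  have := abs_abs_sub_abs_le a b
  calc _ ≤ |b| ^ p + p * (|a| + |b|) ^ (p - 1) * |a - b| := by gcongr
    _ = _ := by ring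

/-- `f` is bounded by `M` in `L^∞` and in `L^s`. -/
def BoundedBy (s : ℝ) (M : ℝ≥0∞) (f : Euc n → ℝ) : Prop :=
  AEStronglyMeasurable f volume ∧ (∀ᵐ x, ‖f x‖ₑ ≤ M) ∧ lpNrm volume s (fun x => ‖f x‖ₑ) ≤ M

/-- A local Lipschitz bound in the sup norm, in additive form to avoid the truncated subtraction of
`[0, ∞]`. It is the preceding estimate with `v = |f| + |g|` and `w = p |f - g|`. -/
lemma exists_conv_rieszK_enorm_le (hα : 0 < α) (hαn : α < n) [NeZero n] (hp : 1 < p)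
    (hs1 : (n : ℝ) / (n - α) < s) (hs2 : s < n * (p - 1) / α) {M : ℝ≥0∞} (hM : M ≠ ∞) :
    ∃ C : ℝ≥0∞, C ≠ ∞ ∧ ∀ f g : Euc n → ℝ, BoundedBy s M f → BoundedBy s M g →
      (∀ x, conv (rieszK α) (fun y => ‖f y‖ₑ ^ p) x ≤ C) ∧
      ∀ e : ℝ≥0∞, (∀ᵐ x, ‖f x - g x‖ₑ ≤ e) → ∀ x,
        conv (rieszK α) (fun y => ‖f y‖ₑ ^ p) x ≤
          conv (rieszK α) (fun y => ‖g y‖ₑ ^ p) x + C * e := by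
  obtain ⟨C₁, hC₁, -, h₁⟩ := exists_conv_rieszK_rpow_le (n := n) hα hαn hp hs1 hs2
  obtain ⟨C₂, hC₂, -, h₂⟩ := exists_conv_rieszK_rpow_mul_le (n := n) hα hαn hp hs1 hs2
  have hna : 0 < (n : ℝ) - α := by linarith
  have hs : 1 < s := lt_trans (by rw [one_lt_div hna]; linarith) hs1
  have hs0 : 0 < s := one_pos.trans hs
  refine ⟨C₁ * M ^ p + C₂ * (2 * M) ^ (p - 1) * ENNReal.ofReal p, ?_, fun f g hf hg => ?_⟩
  · have h1 : M ^ p ≠ ∞ := ENNReal.rpow_ne_top_of_nonneg (by linarith) hM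
    have h2 : (2 * M) ^ (p - 1) ≠ ∞ := ENNReal.rpow_ne_top_of_nonneg (by linarith)
      (ENNReal.mul_ne_top (by simp) hM)
    finiteness
  have hrf := hf.1.ae_eq_mk
  have hrg := hg.1.ae_eq_mk
  set f' := hf.1.mk f
  set g' := hg.1.mk g
  have hf'm : Measurable f' := hf.1.stronglyMeasurable_mk.measurable
  have hg'm : Measurable g' := hg.1.stronglyMeasurable_mk.measurable
  have ef : conv (rieszK α) (fun y => ‖f y‖ₑ ^ p) = conv (rieszK α) (fun y => ‖f' y‖ₑ ^ p) :=
    conv_congr_ae (hrf.mono fun y hy => by simp only [hy])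
  have eg : conv (rieszK α) (fun y => ‖g y‖ₑ ^ p) = conv (rieszK α) (fun y => ‖g' y‖ₑ ^ p) :=
    conv_congr_ae (hrg.mono fun y hy => by simp only [hy])
  have hfM : ∀ᵐ x, ‖f' x‖ₑ ≤ M := by
    filter_upwards [hrf, hf.2.1] with x h1 h2
    rwa [← h1]
  have hgM : ∀ᵐ x, ‖g' x‖ₑ ≤ M := by
    filter_upwards [hrg, hg.2.1] with x h1 h2
    rwa [← h1]
  have hfs : lpNrm volume s (fun x => ‖f' x‖ₑ) ≤ M := by
    have e : lpNrm volume s (fun x => ‖f x‖ₑ) = lpNrm volume s (fun x => ‖f' x‖ₑ) :=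
      lpNrm_congr_ae (hrf.mono fun y hy => by simp only [hy])
    rw [← e]; exact hf.2.2
  have hgs : lpNrm volume s (fun x => ‖g' x‖ₑ) ≤ M := by
    have e : lpNrm volume s (fun x => ‖g x‖ₑ) = lpNrm volume s (fun x => ‖g' x‖ₑ) :=
      lpNrm_congr_ae (hrg.mono fun y hy => by simp only [hy])
    rw [← e]; exact hg.2.2
  rw [ef, eg]
  refine ⟨fun x => ((h₁ M _ hf'm.enorm hfM hfs).1 x).trans (le_add_right le_rfl), fun e he x => ?_⟩
  have he' : ∀ᵐ x, ENNReal.ofReal p * ‖f' x - g' x‖ₑ ≤ ENNReal.ofReal p * e := by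
    filter_upwards [hrf, hrg, he] with x h1 h2 h3
    rw [← h1, ← h2]; gcongr
  have hsum : ∀ᵐ x, ‖f' x‖ₑ + ‖g' x‖ₑ ≤ 2 * M := by
    filter_upwards [hfM, hgM] with x h1 h2
    rw [two_mul]; gcongr
  have hsum' : lpNrm volume s (fun x => ‖f' x‖ₑ + ‖g' x‖ₑ) ≤ 2 * M := by
    rw [two_mul]
    exact (lpNrm_add_le hs.le hf'm.enorm hg'm.enorm).trans (add_le_add hfs hgs)
  have h3 := (h₂ (2 * M) (fun x => ‖f' x‖ₑ + ‖g' x‖ₑ) (fun x => ENNReal.ofReal p * ‖f' x - g' x‖ₑ)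
    (by fun_prop) (by fun_prop) hsum hsum').1 _ he' x
  calc conv (rieszK α) (fun y => ‖f' y‖ₑ ^ p) x
      ≤ conv (rieszK α) (fun y => ‖g' y‖ₑ ^ p + (‖f' y‖ₑ + ‖g' y‖ₑ) ^ (p - 1) *
        (ENNReal.ofReal p * ‖f' y - g' y‖ₑ)) x :=
        conv_mono (fun _ => le_rfl) (fun y => enorm_rpow_le_enorm_rpow_add hp.le _ _) x
    _ = conv (rieszK α) (fun y => ‖g' y‖ₑ ^ p) x + conv (rieszK α) (fun y =>
        (‖f' y‖ₑ + ‖g' y‖ₑ) ^ (p - 1) * (ENNReal.ofReal p * ‖f' y - g' y‖ₑ)) x :=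
        conv_add (measurable_rieszK α) (by fun_prop) x
    _ ≤ _ := by
        gcongr 1
        refine h3.trans ?_
        rw [← mul_assoc]
        gcongr 1
        exact le_add_left le_rfl

lemma abs_toReal_sub_toReal_le {a b : ℝ≥0∞} {e : ℝ} (ha : a ≠ ∞) (hb : b ≠ ∞) (he : 0 ≤ e)
    (h1 : a ≤ b + ENNReal.ofReal e) (h2 : b ≤ a + ENNReal.ofReal e) :
    |a.toReal - b.toReal| ≤ e := by
  have h3 := ENNReal.toReal_mono (by finiteness) h1
  have h4 := ENNReal.toReal_mono (by finiteness) h2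
  rw [ENNReal.toReal_add hb ENNReal.ofReal_ne_top, ENNReal.toReal_ofReal he] at h3
  rw [ENNReal.toReal_add ha ENNReal.ofReal_ne_top, ENNReal.toReal_ofReal he] at h4
  rw [abs_le]
  constructor <;> linarith

lemma conv_heatK_le_add [NeZero n] (hβ : 0 < β) (hβ2 : β ≤ 2) {t : ℝ} (ht : 0 < t)
    {F G : Euc n → ℝ≥0∞} (hG : Measurable G) {e : ℝ≥0∞} (h : ∀ x, F x ≤ G x + e) (x : Euc n) :
    conv (heatK β t) F x ≤ conv (heatK β t) G x + e := by
  refine (conv_mono (fun _ => le_rfl) h x).trans ?_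
  rw [conv_add (measurable_heatK hβ t) hG, conv_const _ (measurable_heatK hβ t),
    lintegral_heatK hβ hβ2 ht, one_mul]

lemma measurable_conv_rieszK_enorm {f : Euc n → ℝ} (hf : AEStronglyMeasurable f volume) :
    Measurable (conv (rieszK α) (fun y => ‖f y‖ₑ ^ p)) := by
  rw [conv_congr_ae (g' := fun y => ‖hf.mk f y‖ₑ ^ p)
    (hf.ae_eq_mk.mono fun y hy => by simp only [hy])]
  have := hf.stronglyMeasurable_mk.measurable
  exact measurable_conv (measurable_rieszK α) (by fun_prop)

/-- The integral equation at time `t`, with the datum `u₀`. -/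
def SolvesAt (α β p : ℝ) (u₀ : Euc n → ℝ) (u : ℝ → Euc n → ℝ) (t : ℝ) : Prop :=
  ∀ᵐ x ∂volume, IntervalIntegrable (duhamelIntegrand α β p u t x) volume 0 t ∧
    u t x = fracHeatSemigroup β t u₀ x + ∫ τ in (0 : ℝ)..t, duhamelIntegrand α β p u t x τ

/-- Gronwall by iteration: the Lipschitz bound improves `|u - v| ≤ B (c t) ^ k / k!` from `k` to `k
+ 1`, and `k → ∞` gives `0`. The explicit majorants avoid any measurability in time of the norm of
`u - v`. -/
lemma SolvesAt.ae_eq (hα : 0 < α) (hαn : α < n) [NeZero n] (hβ : 0 < β) (hβ2 : β ≤ 2) (hp : 1 < p)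
    (hs1 : (n : ℝ) / (n - α) < s) (hs2 : s < n * (p - 1) / α) {M : ℝ≥0∞} (hM : M ≠ ∞)
    {u₀ : Euc n → ℝ} {u v : ℝ → Euc n → ℝ} {t₁ : ℝ}
    (hu : ∀ t ∈ Set.Ioc 0 t₁, BoundedBy s M (u t)) (hv : ∀ t ∈ Set.Ioc 0 t₁, BoundedBy s M (v t))
    (hue : ∀ t ∈ Set.Ioc 0 t₁, SolvesAt α β p u₀ u t)
    (hve : ∀ t ∈ Set.Ioc 0 t₁, SolvesAt α β p u₀ v t) :
    ∀ t ∈ Set.Ioc 0 t₁, u t =ᵐ[volume] v t := by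
  obtain ⟨C, hC, h⟩ := exists_conv_rieszK_enorm_le (n := n) hα hαn hp hs1 hs2 hM
  set c := C.toReal with hc
  have hc0 : 0 ≤ c := ENNReal.toReal_nonneg
  have hCc : C = ENNReal.ofReal c := (ENNReal.ofReal_toReal hC).symm
  set B := (2 * M).toReal with hB
  have hB0 : 0 ≤ B := ENNReal.toReal_nonneg
  have hMB : 2 * M = ENNReal.ofReal B := (ENNReal.ofReal_toReal (by finiteness)).symm
  have key : ∀ k : ℕ, ∀ t ∈ Set.Ioc 0 t₁, ∀ᵐ x, |u t x - v t x| ≤ B *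
      ((c * t) ^ k / k.factorial) := by
    intro k
    induction k with
    | zero =>
      intro t ht
      filter_upwards [(hu t ht).2.1, (hv t ht).2.1] with x h1 h2
      have h3 : ‖u t x - v t x‖ₑ ≤ ENNReal.ofReal B := by
        rw [← hMB, two_mul]
        exact enorm_sub_le.trans (add_le_add h1 h2)
      rw [Real.enorm_eq_ofReal_abs, ENNReal.ofReal_le_ofReal_iff hB0] at h3
      simpa using h3
    | succ k ih =>
      intro t ht
      have hstep : ∀ τ ∈ Set.Ioo 0 t, ∀ x,
          |duhamelIntegrand α β p u t x τ - duhamelIntegrand α β p v t x τ| ≤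
            c * (B * ((c * τ) ^ k / k.factorial)) := by
        intro τ hτ x
        have hτ' : τ ∈ Set.Ioc 0 t₁ := ⟨hτ.1, hτ.2.le.trans ht.2⟩
        have hτ0 : 0 ≤ τ := hτ.1.le
        have htτ : 0 < t - τ := by linarith [hτ.2]
        have hbu := hu τ hτ'
        have hbv := hv τ hτ'
        obtain ⟨h1, h2⟩ := h _ _ hbu hbv
        obtain ⟨h1', h2'⟩ := h _ _ hbv hbu
        set e := B * ((c * τ) ^ k / k.factorial) with he
        have he0 : 0 ≤ e := by positivity
        have h3 := h2 (ENNReal.ofReal e) ((ih τ hτ').mono fun y hy => by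
          rw [Real.enorm_eq_ofReal_abs]; exact ENNReal.ofReal_le_ofReal hy)
        have h3' := h2' (ENNReal.ofReal e) ((ih τ hτ').mono fun y hy => by
          rw [Real.enorm_eq_ofReal_abs, abs_sub_comm]; exact ENNReal.ofReal_le_ofReal hy)
        rw [hCc, ← ENNReal.ofReal_mul hc0] at h3 h3'
        rw [duhamelIntegrand_eq hα hαn hβ hβ2 (by linarith) hτ.2 hbu.1
            (fun x => ne_top_of_le_ne_top hC (h1 x)),
          duhamelIntegrand_eq hα hαn hβ hβ2 (by linarith) hτ.2 hbv.1
            (fun x => ne_top_of_le_ne_top hC (h1' x))]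
        refine abs_toReal_sub_toReal_le
          (ne_top_of_le_ne_top hC (conv_heatK_le hβ hβ2 htτ (ae_of_all _ h1) x))
          (ne_top_of_le_ne_top hC (conv_heatK_le hβ hβ2 htτ (ae_of_all _ h1') x))
          (by positivity) ?_ ?_
        · exact conv_heatK_le_add hβ hβ2 htτ (measurable_conv_rieszK_enorm hbv.1) h3 x
        · exact conv_heatK_le_add hβ hβ2 htτ (measurable_conv_rieszK_enorm hbu.1) h3' x
      filter_upwards [hue t ht, hve t ht] with x hx hy
      rw [hx.2, hy.2, add_sub_add_left_eq_sub, ← intervalIntegral.integral_sub hx.1 hy.1]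
      have hcont : Continuous fun τ : ℝ => c * (B * ((c * τ) ^ k / k.factorial)) := by fun_prop
      have hle := intervalIntegral.norm_integral_le_of_norm_le (μ := volume)
        (f := fun τ => duhamelIntegrand α β p u t x τ - duhamelIntegrand α β p v t x τ) ht.1.le (by
          have hne : ∀ᵐ τ : ℝ, τ ≠ t := by simp [ae_iff]
          filter_upwards [hne] with τ hτ hmem
          exact hstep τ ⟨hmem.1, lt_of_le_of_ne hmem.2 hτ⟩ x) (hcont.intervalIntegrable 0 t)
      refine hle.trans (le_of_eq ?_)
      have e : (fun τ : ℝ => c * (B * ((c * τ) ^ k / k.factorial))) =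
          fun τ : ℝ => (c ^ (k + 1) * B / k.factorial) * τ ^ k := by
        ext τ; rw [mul_pow]; ring
      rw [e, intervalIntegral.integral_const_mul, integral_pow, Nat.factorial_succ]
      push_cast
      rw [zero_pow (by omega), sub_zero, mul_pow]
      have : (k.factorial : ℝ) ≠ 0 := by positivity
      have : (k : ℝ) + 1 ≠ 0 := by positivity
      field_simp
  intro t ht
  filter_upwards [ae_all_iff.2 fun k => key k t ht] with x hx
  have hlim : Tendsto (fun k : ℕ => B * ((c * t) ^ k / k.factorial)) atTop (𝓝 (B * 0)) :=
    (FloorSemiring.tendsto_pow_div_factorial_atTop (c * t)).const_mul B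
  rw [mul_zero] at hlim
  have h0 : |u t x - v t x| ≤ 0 := ge_of_tendsto' hlim hx
  exact sub_eq_zero.1 (abs_nonpos_iff.1 h0)

/-- The definition bounds the sup norm directly; for the `L^s` norm, continuity gives a bound near
each time and compactness of `[0, t₁]` a uniform one. -/
lemma IsMildSolution.exists_boundedBy (hs : 1 < s) {u₀ : Euc n → ℝ} {T : ℝ≥0∞}
    {u : ℝ → Euc n → ℝ} (hu : IsMildSolution α β p s u₀ T u) {t₁ : ℝ}
    (ht₁ : ENNReal.ofReal t₁ < T) :
    ∃ M : ℝ≥0∞, M ≠ ∞ ∧ ∀ t ∈ Set.Icc 0 t₁, BoundedBy s M (u t) := by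
  have hs0 : 0 < s := one_pos.trans hs
  have hT : ∀ t ∈ Set.Icc 0 t₁, ENNReal.ofReal t < T := fun t ht =>
    (ENNReal.ofReal_le_ofReal ht.2).trans_lt ht₁
  have hloc : ∃ N : ℝ≥0∞, N ≠ ∞ ∧ ∀ t ∈ Set.Icc 0 t₁,
      eLpNorm (u t) (ENNReal.ofReal s) volume ≤ N := by
    -- The repeated membership makes the property meaningful for arbitrary sets of times, as
    -- induction on compact sets requires.
    suffices h : ∃ N : ℝ≥0∞, N ≠ ∞ ∧ ∀ t ∈ Set.Icc 0 t₁, t ∈ Set.Icc 0 t₁ →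
        eLpNorm (u t) (ENNReal.ofReal s) volume ≤ N by
      obtain ⟨N, hN, h⟩ := h
      exact ⟨N, hN, fun t ht => h t ht ht⟩
    refine isCompact_Icc.induction_on (s := Set.Icc 0 t₁) (p := fun S => ∃ N : ℝ≥0∞,
        N ≠ ∞ ∧ ∀ t ∈ S,
      t ∈ Set.Icc 0 t₁ → eLpNorm (u t) (ENNReal.ofReal s) volume ≤ N) ?_ ?_ ?_ ?_
    · exact ⟨0, by simp, by simp⟩
    · rintro S S' hSS ⟨N, hN, h⟩
      exact ⟨N, hN, fun t ht => h t (hSS ht)⟩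
    · rintro S S' ⟨N, hN, h⟩ ⟨N', hN', h'⟩
      refine ⟨max N N', by simp [hN, hN'], fun t ht ht' => ?_⟩
      rcases ht with ht | ht
      · exact (h t ht ht').trans (le_max_left _ _)
      · exact (h' t ht ht').trans (le_max_right _ _)
    · intro t ht
      have hc := hu.continuous t ht.1 (hT t ht)
      have hev := hc.eventually (gt_mem_nhds (zero_lt_one' ℝ≥0∞))
      have hmt := hu.memLp t ht.1 (hT t ht)
      have hsub : Set.Icc 0 t₁ ⊆ {τ : ℝ | 0 ≤ τ ∧ ENNReal.ofReal τ < T} :=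
        fun τ hτ => ⟨hτ.1, hT τ hτ⟩
      refine ⟨_, nhdsWithin_mono t hsub hev, 1 + eLpNorm (u t) (ENNReal.ofReal s) volume,
        ENNReal.add_ne_top.2 ⟨by simp, hmt.2.ne⟩, fun τ hτ hτ' => ?_⟩
      have h1 : u τ = (u τ - u t) + u t := by simp
      rw [h1]
      refine (eLpNorm_add_le (((hu.memLp τ hτ'.1 (hT τ hτ')).1).sub hmt.1) hmt.1 ?_).trans
        (add_le_add (le_of_lt hτ) le_rfl)
      rw [← ENNReal.ofReal_one]; exact ENNReal.ofReal_le_ofReal hs.le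
  obtain ⟨N, hN, hNb⟩ := hloc
  obtain ⟨M, hM⟩ := hu.bounded t₁ ht₁
  refine ⟨N + M, by finiteness, fun t ht => ⟨(hu.memLp t ht.1 (hT t ht)).1, ?_, ?_⟩⟩
  · filter_upwards [ae_le_eLpNormEssSup (f := u t) (μ := volume)] with x hx
    rw [← eLpNorm_exponent_top] at hx
    exact hx.trans ((hM t ht).trans (le_add_left le_rfl))
  · rw [← eLpNorm_eq_lpNrm hs0]
    exact (hNb t ht).trans (le_add_right le_rfl)

lemma IsMildSolution.ae_eq (hα : 0 < α) (hαn : α < n) [NeZero n] (hβ : 0 < β) (hβ2 : β ≤ 2)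
    (hp : 1 < p) (hs1 : (n : ℝ) / (n - α) < s) (hs2 : s < n * (p - 1) / α)
    {u₀ : Euc n → ℝ} {T T' : ℝ≥0∞} {u v : ℝ → Euc n → ℝ} (hu : IsMildSolution α β p s u₀ T u)
    (hv : IsMildSolution α β p s u₀ T' v) {t : ℝ} (ht : 0 ≤ t) (htT : ENNReal.ofReal t < T)
    (htT' : ENNReal.ofReal t < T') : v t =ᵐ[volume] u t := by
  have hna : 0 < (n : ℝ) - α := by linarith
  have hs : 1 < s := lt_trans (by rw [one_lt_div hna]; linarith) hs1
  rcases ht.eq_or_lt with rfl | ht0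
  · exact hv.initial.trans hu.initial.symm
  obtain ⟨M, hM, hMb⟩ := hu.exists_boundedBy hs htT
  obtain ⟨M', hM', hMb'⟩ := hv.exists_boundedBy hs htT'
  have hmono : ∀ {A : ℝ≥0∞} {f : Euc n → ℝ}, BoundedBy s A f → A ≤ M + M' →
      BoundedBy s (M + M') f := fun hf hA =>
    ⟨hf.1, hf.2.1.mono fun x hx => hx.trans hA, hf.2.2.trans hA⟩
  refine SolvesAt.ae_eq (u₀ := u₀) (t₁ := t) hα hαn hβ hβ2 hp hs1 hs2 (M := M + M') (by finiteness)
    (fun τ hτ => hmono (hMb' τ ⟨hτ.1.le, hτ.2⟩) (le_add_left le_rfl))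
    (fun τ hτ => hmono (hMb τ ⟨hτ.1.le, hτ.2⟩) (le_add_right le_rfl))
    (fun τ hτ => hv.equation τ hτ.1 ((ENNReal.ofReal_le_ofReal hτ.2).trans_lt htT'))
    (fun τ hτ => hu.equation τ hτ.1 ((ENNReal.ofReal_le_ofReal hτ.2).trans_lt htT)) t ⟨ht0, le_rfl⟩

end Uniqueness

/-! ### Strong continuity of the heat flow -/

section HeatFlow

variable {n : ℕ} {α β p s : ℝ}

/-- Jensen's inequality for the measure `k dμ`, without normalisation. For the heat kernel the mass
factor is `1`. -/
lemma lintegral_mul_rpow_le {X : Type*} [MeasurableSpace X] {μ : Measure X} {k d : X → ℝ≥0∞}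
    (hk : Measurable k) (hd : Measurable d) (hs : 1 ≤ s) :
    (∫⁻ x, k x * d x ∂μ) ^ s ≤ (∫⁻ x, k x ∂μ) ^ (s - 1) * ∫⁻ x, k x * d x ^ s ∂μ := by
  have hs0 : 0 < s := one_pos.trans_le hs
  have hs1 : 0 ≤ 1 - 1 / s := by rw [sub_nonneg, div_le_one hs0]; exact hs
  have h1 : ∫⁻ x, k x * d x ∂μ ≤
      (∫⁻ x, k x ∂μ) ^ (1 - 1 / s) * (∫⁻ x, k x * d x ^ s ∂μ) ^ (1 / s) := by
    have h2 := ENNReal.lintegral_mul_norm_pow_le (μ := μ)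
      (f := k) (g := fun x => k x * d x ^ s)
      (by fun_prop) (by fun_prop) (p := 1 - 1 / s) (q := 1 / s) hs1 (by positivity) (by ring)
    refine le_trans (le_of_eq ?_) h2
    congr 1; ext x
    rw [ENNReal.mul_rpow_of_nonneg _ _ (by positivity : 0 ≤ 1 / s), ← ENNReal.rpow_mul,
      mul_one_div, div_self hs0.ne', ENNReal.rpow_one, ← mul_assoc,
      ← ENNReal.rpow_add_of_nonneg _ _ hs1 (by positivity), sub_add_cancel, ENNReal.rpow_one]
  refine (ENNReal.rpow_le_rpow h1 hs0.le).trans (le_of_eq ?_)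
  rw [ENNReal.mul_rpow_of_nonneg _ _ hs0.le, ← ENNReal.rpow_mul, ← ENNReal.rpow_mul,
    show (1 - 1 / s) * s = s - 1 by field_simp, one_div, inv_mul_cancel₀ hs0.ne', ENNReal.rpow_one]

/-- Translations form a continuous family of measure-preserving maps, and composition with such a
family is continuous in `L^q` for finite `q`. -/
lemma tendsto_eLpNorm_translate {q : ℝ≥0∞} (hq1 : 1 ≤ q) (hq : q ≠ ∞) {f : Euc n → ℝ}
    (hf : MemLp f q volume) :
    Tendsto (fun h : Euc n => eLpNorm (fun x => f (x - h) - f x) q volume) (𝓝 0) (𝓝 0) := by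
  have : Fact (1 ≤ q) := ⟨hq1⟩
  set g : Euc n → C(Euc n, Euc n) := fun h => ⟨fun x => x - h, by fun_prop⟩ with hg
  have hgc : Continuous g := by
    have := (ContinuousMap.curry (⟨fun z : Euc n × Euc n => z.2 - z.1, by fun_prop⟩ :
      C(Euc n × Euc n, Euc n))).continuous
    exact this
  have hgm : ∀ h, MeasurePreserving (g h) (volume : Measure (Euc n)) volume :=
    fun h => measurePreserving_sub_right volume h
  have hc := Continuous.compMeasurePreservingLp (f := fun _ : Euc n => hf.toLp f)
    continuous_const hgc hgm hq
  have ht := (hc.tendsto 0)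
  rw [tendsto_iff_edist_tendsto_0] at ht
  refine ht.congr fun h => ?_
  rw [Lp.edist_def]
  refine eLpNorm_congr_ae ?_
  have e1 : ∀ h : Euc n, (Lp.compMeasurePreserving (g h) (hgm h) (hf.toLp f) : Euc n → ℝ) =ᵐ[volume]
      fun x => f (x - h) := fun h => by
    refine (Lp.coeFn_compMeasurePreserving _ (hgm h)).trans ?_
    exact (hgm h).quasiMeasurePreserving.ae_eq_comp hf.coeFn_toLp
  filter_upwards [e1 h, e1 0] with x h1 h2
  rw [Pi.sub_apply, h1, h2, sub_zero]

lemma enorm_toReal_sub_toReal_le {a b d : ℝ≥0∞} (ha : a ≠ ∞) (hb : b ≠ ∞)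
    (h1 : a ≤ b + d) (h2 : b ≤ a + d) : ‖a.toReal - b.toReal‖ₑ ≤ d := by
  rcases eq_or_ne d ∞ with rfl | hd
  · exact le_top
  rw [Real.enorm_eq_ofReal_abs, ENNReal.ofReal_le_iff_le_toReal hd]
  refine abs_toReal_sub_toReal_le ha hb ENNReal.toReal_nonneg ?_ ?_ <;>
  rwa [ENNReal.ofReal_toReal hd]

lemma le_add_enorm_toReal_sub {a b : ℝ≥0∞} (ha : a ≠ ∞) (hb : b ≠ ∞) :
    a ≤ b + ‖a.toReal - b.toReal‖ₑ := by
  calc a = ENNReal.ofReal a.toReal := (ENNReal.ofReal_toReal ha).symm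
    _ ≤ ENNReal.ofReal (b.toReal + |a.toReal - b.toReal|) :=
      ENNReal.ofReal_le_ofReal (by linarith [le_abs_self (a.toReal - b.toReal)])
    _ = _ := by rw [ENNReal.ofReal_add ENNReal.toReal_nonneg (abs_nonneg _),
      ENNReal.ofReal_toReal hb, Real.enorm_eq_ofReal_abs]

/-- The heat flow `S_β(t) F` in the form `∫ S_β(1, z) F(x - t ^ (1 / β) z) dz`. -/
def heatFlow (β t : ℝ) (F : Euc n → ℝ≥0∞) (x : Euc n) : ℝ≥0∞ :=
  ∫⁻ z, heatK β 1 z * F (x - t ^ (1 / β) • z)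

variable [NeZero n]

lemma heatFlow_eq_conv (hβ : 0 < β) {t : ℝ} (ht : 0 < t) {F : Euc n → ℝ≥0∞} (hF : Measurable F)
    (x : Euc n) : heatFlow β t F x = conv (heatK β t) F x := by
  have hm := measurable_heatK (n := n) hβ t
  have hm1 := measurable_heatK (n := n) hβ 1
  rw [conv_comm, conv]
  have hc : 0 < t ^ (1 / β) := Real.rpow_pos_of_pos ht _
  have h := lintegral_comp_smul_euc (fun y => F (x - y) * heatK β t y) (by fun_prop) hc
  have e : ∀ z : Euc n, F (x - t ^ (1 / β) • z) * heatK β t (t ^ (1 / β) • z) =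
      ENNReal.ofReal (t ^ (-((n : ℝ) / β))) * (heatK β 1 z * F (x - t ^ (1 / β) • z)) := by
    intro z
    rw [heatK_eq_mul hβ ht, smul_smul, ← Real.rpow_add ht]
    simp only [neg_add_cancel, Real.rpow_zero, one_smul]
    ring
  simp_rw [e] at h
  rw [lintegral_const_mul _ (by fun_prop), ← Real.rpow_mul ht.le,
    show 1 / β * -(n : ℝ) = -(n / β) by ring] at h
  exact (ENNReal.mul_right_inj (by simpa using Real.rpow_pos_of_pos ht _) ENNReal.ofReal_ne_top).1 h

/-- The self-similar form makes sense at `t = 0`, so continuity at the initial time is not a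
separate case. -/
lemma heatFlow_zero (hβ : 0 < β) (hβ2 : β ≤ 2) (F : Euc n → ℝ≥0∞) (x : Euc n) :
    heatFlow β 0 F x = F x := by
  have hm1 := measurable_heatK (n := n) hβ 1
  simp only [heatFlow]
  rw [Real.zero_rpow (by positivity)]
  simp only [zero_smul, sub_zero]
  rw [lintegral_mul_const _ hm1, lintegral_heatK hβ hβ2 one_pos, one_mul]

lemma heatFlow_ne_top (hβ : 0 < β) (hβ2 : β ≤ 2) {t : ℝ} (ht : 0 ≤ t) {F : Euc n → ℝ≥0∞}
    (hF : Measurable F) (hFt : ∀ x, F x ≠ ∞) {M : ℝ≥0∞} (hM : M ≠ ∞) (hFM : ∀ᵐ x, F x ≤ M)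
    (x : Euc n) : heatFlow β t F x ≠ ∞ := by
  rcases ht.eq_or_lt with rfl | ht
  · rw [heatFlow_zero hβ hβ2]; exact hFt x
  · rw [heatFlow_eq_conv hβ ht hF]
    exact ne_top_of_le_ne_top hM (conv_heatK_le hβ hβ2 ht hFM x)

lemma measurable_heatFlow (hβ : 0 < β) (t : ℝ) {F : Euc n → ℝ≥0∞} (hF : Measurable F) :
    Measurable (heatFlow β t F) := by
  have hm1 := measurable_heatK (n := n) hβ 1
  have : Measurable fun w : Euc n × Euc n => heatK β 1 w.2 * F (w.1 - t ^ (1 / β) • w.2) := by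
    fun_prop
  exact this.lintegral_prod_right'

/-- Both flows average translates of `F` against the same probability density. Jensen's inequality
and a translation in `x` reduce their difference to that of `F` and its translate by `(a ^ (1 / β) -
b ^ (1 / β)) • z`. -/
lemma lintegral_enorm_heatFlow_sub_le (hβ : 0 < β) (hβ2 : β ≤ 2) (hs : 1 ≤ s)
    {a b : ℝ} (ha : 0 ≤ a) (hb : 0 ≤ b) {F : Euc n → ℝ≥0∞}
    (hF : Measurable F) (hFt : ∀ x, F x ≠ ∞) {M : ℝ≥0∞} (hM : M ≠ ∞) (hFM : ∀ᵐ x, F x ≤ M) :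
    ∫⁻ x, ‖(heatFlow β a F x).toReal - (heatFlow β b F x).toReal‖ₑ ^ s ≤
      ∫⁻ z, heatK β 1 z * ∫⁻ x,
        ‖(F (x - (a ^ (1 / β) - b ^ (1 / β)) • z)).toReal - (F x).toReal‖ₑ ^ s := by
  have hs0 : 0 ≤ s := zero_le_one.trans hs
  have hm1 := measurable_heatK (n := n) hβ 1
  set c := a ^ (1 / β)
  set c' := b ^ (1 / β)
  have h1 : ∀ x, ‖(heatFlow β a F x).toReal - (heatFlow β b F x).toReal‖ₑ ^ s ≤
      ∫⁻ z, heatK β 1 z * ‖(F (x - c • z)).toReal - (F (x - c' • z)).toReal‖ₑ ^ s := by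
    intro x
    have hle : ‖(heatFlow β a F x).toReal - (heatFlow β b F x).toReal‖ₑ ≤
        ∫⁻ z, heatK β 1 z * ‖(F (x - c • z)).toReal - (F (x - c' • z)).toReal‖ₑ := by
      refine enorm_toReal_sub_toReal_le (heatFlow_ne_top hβ hβ2 ha hF hFt hM hFM x)
        (heatFlow_ne_top hβ hβ2 hb hF hFt hM hFM x) ?_ ?_
      · rw [heatFlow, heatFlow, ← lintegral_add_left (by fun_prop)]
        refine lintegral_mono fun z => ?_
        rw [← mul_add]
        exact mul_le_mul' le_rfl (le_add_enorm_toReal_sub (hFt _) (hFt _))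
      · rw [heatFlow, heatFlow, ← lintegral_add_left (by fun_prop)]
        refine lintegral_mono fun z => ?_
        rw [← mul_add]
        refine mul_le_mul' le_rfl ?_
        have := le_add_enorm_toReal_sub (hFt (x - c' • z)) (hFt (x - c • z))
        rwa [← enorm_neg, neg_sub] at this
    refine (ENNReal.rpow_le_rpow hle hs0).trans ?_
    refine (lintegral_mul_rpow_le hm1 (by fun_prop) hs).trans (le_of_eq ?_)
    rw [lintegral_heatK hβ hβ2 one_pos, ENNReal.one_rpow, one_mul]
  refine (lintegral_mono h1).trans (le_of_eq ?_)
  rw [lintegral_lintegral_swap (Measurable.aemeasurable (by unfold Function.uncurry; fun_prop))]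
  congr 1; ext z
  rw [lintegral_const_mul _ (by fun_prop)]
  congr 1
  rw [← lintegral_add_right_eq_self _ (c' • z)]
  congr 1; ext x
  rw [add_sub_cancel_right, sub_smul, sub_sub_eq_add_sub]

/-- Dominated convergence in `z`: the modulus `Ω` of translation tends to `0` at the origin and is
everywhere at most the `s`-th power of twice the norm of `F`. -/
lemma tendsto_lpNrm_heatFlow_sub (hβ : 0 < β) (hβ2 : β ≤ 2) (hs : 1 < s)
    {b : ℝ} (hb : 0 ≤ b) {F : Euc n → ℝ≥0∞}
    (hF : Measurable F) (hFt : ∀ x, F x ≠ ∞) {M : ℝ≥0∞} (hM : M ≠ ∞) (hFM : ∀ᵐ x, F x ≤ M)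
    (hFs : lpNrm volume s F ≠ ∞) :
    Tendsto (fun a => lpNrm volume s
      (fun x => ‖(heatFlow β a F x).toReal - (heatFlow β b F x).toReal‖ₑ))
      (𝓝[Set.Ici 0] b) (𝓝 0) := by
  have hs0 : 0 < s := one_pos.trans hs
  have hm1 := measurable_heatK (n := n) hβ 1
  set f : Euc n → ℝ := fun x => (F x).toReal with hf
  have hfm : Measurable f := hF.ennreal_toReal
  have hfF : ∀ x, ‖f x‖ₑ = F x := fun x => by
    rw [Real.enorm_eq_ofReal ENNReal.toReal_nonneg, ENNReal.ofReal_toReal (hFt x)]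
  have hmem : MemLp f (ENNReal.ofReal s) volume := by
    refine ⟨hfm.aestronglyMeasurable, ?_⟩
    rw [eLpNorm_eq_lpNrm hs0]
    simp_rw [hfF]
    exact hFs.lt_top
  set Ω : Euc n → ℝ≥0∞ := fun h => ∫⁻ x, ‖f (x - h) - f x‖ₑ ^ s with hΩ
  have hΩm : Measurable Ω := by
    have : Measurable fun w : Euc n × Euc n => ‖f (w.2 - w.1) - f w.2‖ₑ ^ s := by fun_prop
    exact this.lintegral_prod_right'
  have hΩ0 : Tendsto Ω (𝓝 0) (𝓝 0) := by
    have h := tendsto_eLpNorm_translate (q := ENNReal.ofReal s)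
      (by rw [← ENNReal.ofReal_one]; exact ENNReal.ofReal_le_ofReal hs.le) ENNReal.ofReal_ne_top hmem
    have h2 := ((ENNReal.continuous_rpow_const (y := s)).tendsto 0).comp h
    rw [ENNReal.zero_rpow_of_pos hs0] at h2
    refine h2.congr fun y => ?_
    rw [Function.comp, eLpNorm_eq_lpNrm hs0, lpNrm_rpow hs0]
  have hΩb : ∀ h, Ω h ≤ (lpNrm volume s F + lpNrm volume s F) ^ s := by
    intro h
    rw [hΩ, ← lpNrm_le_iff hs0]
    have e : lpNrm volume s (fun x => F (x - h)) = lpNrm volume s F := by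
      unfold lpNrm
      rw [lintegral_sub_right_eq_self (fun x => F x ^ s) h]
    calc lpNrm volume s (fun x => ‖f (x - h) - f x‖ₑ)
        ≤ lpNrm volume s (fun x => F (x - h) + F x) := lpNrm_mono hs0 fun x => by
          refine enorm_sub_le.trans ?_
          rw [hfF, hfF]
      _ ≤ _ := (lpNrm_add_le hs.le (by fun_prop) hF).trans (by rw [e])
  have hlim : Tendsto (fun a : ℝ => ∫⁻ z, heatK β 1 z * Ω ((a ^ (1 / β) - b ^ (1 / β)) • z))
      (𝓝[Set.Ici 0] b) (𝓝 (∫⁻ z : Euc n, 0)) := by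
    refine tendsto_lintegral_filter_of_dominated_convergence
      (fun z => heatK β 1 z * (lpNrm volume s F + lpNrm volume s F) ^ s) ?_ ?_ ?_ ?_
    · exact Eventually.of_forall fun a => by fun_prop
    · exact Eventually.of_forall fun a => ae_of_all _ fun z => mul_le_mul' le_rfl (hΩb _)
    · rw [lintegral_mul_const _ hm1, lintegral_heatK hβ hβ2 one_pos, one_mul]
      exact ENNReal.rpow_ne_top_of_nonneg hs0.le (by finiteness)
    · refine ae_of_all _ fun z => ?_
      have h1 : Tendsto (fun a : ℝ => (a ^ (1 / β) - b ^ (1 / β)) • z) (𝓝[Set.Ici 0] b) (𝓝 0) := by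
        have hc : ContinuousAt (fun a : ℝ => (a ^ (1 / β) - b ^ (1 / β)) • z) b := by
          have := Real.continuousAt_rpow_const b (1 / β) (Or.inr (by positivity))
          fun_prop
        have := hc.tendsto
        simp only [sub_self, zero_smul] at this
        exact this.mono_left nhdsWithin_le_nhds
      have h2 := ENNReal.Tendsto.const_mul (a := heatK β 1 z) (hΩ0.comp h1)
        (Or.inr (by rw [heatK]; exact ENNReal.ofReal_ne_top))
      rw [mul_zero] at h2
      exact h2
  rw [lintegral_zero] at hlim
  have hle : ∀ᶠ a in 𝓝[Set.Ici 0] b, lpNrm volume s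
      (fun x => ‖(heatFlow β a F x).toReal - (heatFlow β b F x).toReal‖ₑ) ≤
      (∫⁻ z, heatK β 1 z * Ω ((a ^ (1 / β) - b ^ (1 / β)) • z)) ^ (1 / s) := by
    filter_upwards [self_mem_nhdsWithin] with a ha
    exact ENNReal.rpow_le_rpow (lintegral_enorm_heatFlow_sub_le hβ hβ2 hs.le ha hb hF hFt hM hFM)
      (by positivity)
  have h3 := ((ENNReal.continuous_rpow_const (y := 1 / s)).tendsto 0).comp hlim
  rw [ENNReal.zero_rpow_of_pos (by positivity)] at h3
  exact tendsto_of_tendsto_of_tendsto_of_le_of_le' tendsto_const_nhds h3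
    (Eventually.of_forall fun _ => zero_le) hle

end HeatFlow

/-! ### A criterion for mild solutions -/

section Criterion

variable {n : ℕ} {α β p s : ℝ}

lemma lpNrm_enorm_add_le (hs : 1 ≤ s) {f g h : Euc n → ℝ} (hf : Measurable f) (hg : Measurable g)
    (hfgh : ∀ x, h x = f x + g x) :
    lpNrm volume s (fun x => ‖h x‖ₑ) ≤
      lpNrm volume s (fun x => ‖f x‖ₑ) + lpNrm volume s (fun x => ‖g x‖ₑ) := by
  refine (lpNrm_mono (one_pos.trans_le hs) fun x => ?_).trans (lpNrm_add_le hs hf.enorm hg.enorm)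
  rw [hfgh]; exact enorm_add_le _ _

lemma IsMildSolution.congr_initial {u₀ v₀ : Euc n → ℝ} (h₀ : u₀ =ᵐ[volume] v₀) {T : ℝ≥0∞}
    {u : ℝ → Euc n → ℝ} (hu : IsMildSolution α β p s u₀ T u) : IsMildSolution α β p s v₀ T u := by
  refine ⟨hu.initial.trans h₀, hu.memLp, hu.continuous, hu.bounded, fun t ht htT => ?_⟩
  filter_upwards [hu.equation t ht htT] with x hx
  refine ⟨hx.1, hx.2.trans ?_⟩
  congr 1
  exact integral_congr_ae (h₀.mono fun y hy => by simp only [hy])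

lemma IsMaximalMildSolution.congr_initial {u₀ v₀ : Euc n → ℝ} (h₀ : u₀ =ᵐ[volume] v₀) {T : ℝ≥0∞}
    {u : ℝ → Euc n → ℝ} (hu : IsMaximalMildSolution α β p s u₀ T u) :
    IsMaximalMildSolution α β p s v₀ T u :=
  ⟨hu.1.congr_initial h₀, fun T' v hv => hu.2 T' v (hv.congr_initial h₀.symm)⟩

variable [NeZero n]

/-- Splitting slightly before `b`, at `t₀`, writes the Duhamel term at nearby times as the heat flow
of its value at `t₀`, which is continuous, plus a remainder of norm at most `C (a - t₀)`. Times on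
both sides of `b` are treated alike. -/
lemma tendsto_lpNrm_duhamel_sub (hβ : 0 < β) (hβ2 : β ≤ 2) (hs : 1 < s)
    {f : ℝ → Euc n → ℝ≥0∞} (hf : Measurable (Function.uncurry f)) {C : ℝ≥0∞} (hC0 : C ≠ 0)
    (hC : C ≠ ∞) {b t₁ : ℝ} (hb : 0 ≤ b) (hbt : b < t₁)
    (h1 : ∀ τ ∈ Set.Ioo 0 t₁, ∀ x, conv (rieszK α) (f τ) x ≤ C)
    (h2 : ∀ τ ∈ Set.Ioo 0 t₁, lpNrm volume s (conv (rieszK α) (f τ)) ≤ C) :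
    Tendsto (fun a => lpNrm volume s
      (fun x => ‖(duhamel β α f a x).toReal - (duhamel β α f b x).toReal‖ₑ))
      (𝓝[Set.Ici 0] b) (𝓝 0) := by
  have hs0 : 0 < s := one_pos.trans hs
  rw [ENNReal.tendsto_nhds_zero]
  intro ε hε
  -- For `a ≤ b + e` and `t₀ ≥ b - e` each remainder is at most `2 * e * C`, and there are two of
  -- them: hence `4 * C`.
  obtain ⟨e, he0, he⟩ := ENNReal.exists_nnreal_pos_mul_lt (a := 4 * C) (b := ε / 2)
    (ENNReal.mul_ne_top (by simp) hC) (by simpa using hε.ne')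
  set t₀ := max (b - e) 0 with ht₀
  have ht₀0 : 0 ≤ t₀ := le_max_right _ _
  have ht₀b : t₀ ≤ b := max_le (by linarith [e.2]) hb
  have he0' : (0 : ℝ) < e := he0
  have hQm := measurable_duhamel (α := α) hβ hf
  have hQm' := fun t => measurable_uncurry_apply hQm t
  have hfs : Measurable (Function.uncurry fun τ => f (t₀ + τ)) :=
    hf.comp (f := fun z : ℝ × Euc n => (t₀ + z.1, z.2)) (by fun_prop)
  have hRm' := fun t => measurable_uncurry_apply (measurable_duhamel (α := α) hβ hfs) t
  have hQb : ∀ x, duhamel β α f t₀ x ≤ ENNReal.ofReal t₀ * C :=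
    duhamel_le_of_le hβ hβ2 hf fun τ hτ => h1 τ ⟨hτ.1, by linarith [hτ.2]⟩
  have hQs : lpNrm volume s (duhamel β α f t₀) ≤ ENNReal.ofReal t₀ * C :=
    lpNrm_duhamel_le_const hβ hβ2 hf hs hC0 hC fun τ hτ => h2 τ ⟨hτ.1, by linarith [hτ.2]⟩
  have hMt : ENNReal.ofReal t₀ * C ≠ ∞ := by finiteness
  set F := duhamel β α f t₀ with hF
  have hFt : ∀ x, F x ≠ ∞ := fun x => ne_top_of_le_ne_top hMt (hQb x)
  set R : ℝ → Euc n → ℝ≥0∞ := fun r => duhamel β α (fun τ => f (t₀ + τ)) r with hR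
  have hsplit : ∀ a, t₀ ≤ a → ∀ x, duhamel β α f a x = heatFlow β (a - t₀) F x + R (a - t₀) x := by
    intro a ha x
    rcases ha.eq_or_lt with rfl | ha
    · rw [sub_self, heatFlow_zero hβ hβ2, hR]
      simp [duhamel, hF]
    · have ha' : 0 < a - t₀ := by linarith
      rw [heatFlow_eq_conv hβ ha' (hQm' t₀), ← duhamel_add_time hβ hβ2 hf ht₀0 ha', add_sub_cancel]
  have hRb : ∀ a, t₀ ≤ a → a < t₁ → ∀ x, R (a - t₀) x ≤ ENNReal.ofReal (a - t₀) * C :=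
      fun a ha ha1 =>
    duhamel_le_of_le hβ hβ2 hfs fun τ hτ => h1 _ ⟨by linarith [hτ.1], by linarith [hτ.2]⟩
  have hRs : ∀ a, t₀ ≤ a → a < t₁ → a ≤ b + e →
      lpNrm volume s (R (a - t₀)) ≤ (e : ℝ≥0∞) * (2 * C) := fun a ha ha1 hae => by
    refine (lpNrm_duhamel_le_const hβ hβ2 hfs hs hC0 hC fun τ hτ =>
      h2 _ ⟨by linarith [hτ.1], by linarith [hτ.2]⟩).trans ?_
    rw [mul_comm 2 C, mul_comm C 2, ← mul_assoc]
    gcongr 1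
    have h3 : (e : ℝ≥0∞) * 2 = ENNReal.ofReal (e * 2) := by
      rw [ENNReal.ofReal_mul NNReal.zero_le_coe, ENNReal.ofReal_coe_nnreal]; simp
    rw [h3]
    refine ENNReal.ofReal_le_ofReal ?_
    have : b - e ≤ t₀ := le_max_left _ _
    linarith
  have hshift : Tendsto (fun a => a - t₀) (𝓝[Set.Ici 0] b) (𝓝[Set.Ici 0] (b - t₀)) := by
    refine tendsto_nhdsWithin_iff.2 ⟨?_, ?_⟩
    · exact ((continuous_sub_right t₀).tendsto b).mono_left nhdsWithin_le_nhds
    · have h3 : ∀ᶠ a in 𝓝[Set.Ici 0] b, b - e < a :=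
        nhdsWithin_le_nhds (lt_mem_nhds (by linarith))
      filter_upwards [h3, self_mem_nhdsWithin] with a ha ha'
      exact sub_nonneg.2 (max_le ha.le ha')
  have hflow := (tendsto_lpNrm_heatFlow_sub hβ hβ2 hs (sub_nonneg.2 ht₀b) (hQm' t₀) hFt hMt
    (ae_of_all _ hQb) (ne_top_of_le_ne_top hMt hQs)).comp hshift
  have hev := (ENNReal.tendsto_nhds_zero.1 hflow) (ε / 2) (by simpa using hε.ne')
  have h4 : ∀ᶠ a in 𝓝[Set.Ici 0] b, b - e < a := nhdsWithin_le_nhds (lt_mem_nhds (by linarith))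
  have h5 : ∀ᶠ a in 𝓝[Set.Ici 0] b, a < min t₁ (b + e) :=
    nhdsWithin_le_nhds (gt_mem_nhds (lt_min hbt (by linarith)))
  filter_upwards [hev, h4, h5, self_mem_nhdsWithin] with a h6 h7 h8 h9
  have hta : t₀ ≤ a := max_le h7.le h9
  have ha1 : a < t₁ := h8.trans_le (min_le_left _ _)
  have hae : a ≤ b + e := (h8.trans_le (min_le_right _ _)).le
  have hHfin : ∀ c, t₀ ≤ c → ∀ x, heatFlow β (c - t₀) F x ≠ ∞ := fun c hc x =>
    heatFlow_ne_top hβ hβ2 (sub_nonneg.2 hc) (hQm' t₀) hFt hMt (ae_of_all _ hQb) x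
  have hRfin : ∀ c, t₀ ≤ c → c < t₁ → ∀ x, R (c - t₀) x ≠ ∞ := fun c hc hc1 x =>
    ne_top_of_le_ne_top (by finiteness) (hRb c hc hc1 x)
  have hHm := fun c => measurable_heatFlow hβ (c - t₀) (hQm' t₀)
  calc lpNrm volume s (fun x => ‖(duhamel β α f a x).toReal - (duhamel β α f b x).toReal‖ₑ)
      ≤ lpNrm volume s (fun x => ‖(heatFlow β (a - t₀) F x).toReal -
          (heatFlow β (b - t₀) F x).toReal‖ₑ) +
        lpNrm volume s (fun x => R (a - t₀) x + R (b - t₀) x) := by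
        refine (lpNrm_mono hs0 fun x => ?_).trans (lpNrm_add_le hs.le
          ((hHm a).ennreal_toReal.sub (hHm b).ennreal_toReal).enorm ((hRm' _).add (hRm' _)))
        rw [hsplit a hta, hsplit b ht₀b, ENNReal.toReal_add (hHfin a hta x) (hRfin a hta ha1 x),
          ENNReal.toReal_add (hHfin b ht₀b x) (hRfin b ht₀b hbt x), add_sub_add_comm]
        refine (enorm_add_le _ _).trans (add_le_add le_rfl (enorm_sub_le.trans (le_of_eq ?_)))
        rw [Real.enorm_eq_ofReal ENNReal.toReal_nonneg, Real.enorm_eq_ofReal ENNReal.toReal_nonneg,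
          ENNReal.ofReal_toReal (hRfin a hta ha1 x), ENNReal.ofReal_toReal (hRfin b ht₀b hbt x)]
    _ ≤ ε / 2 + (e * (2 * C) + e * (2 * C)) :=
        add_le_add h6 ((lpNrm_add_le hs.le (hRm' _) (hRm' _)).trans (add_le_add
          (hRs a hta ha1 hae) (hRs b ht₀b hbt (by linarith))))
    _ ≤ ε / 2 + ε / 2 := by
        gcongr
        refine le_trans (le_of_eq ?_) he.le
        ring
    _ = ε := ENNReal.add_halves ε

lemma fracHeatSemigroup_eq_sub (hβ : 0 < β) (hβ2 : β ≤ 2) {t : ℝ} (ht : 0 < t)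
    {u₀ : Euc n → ℝ} (hu₀ : Measurable u₀) {M : ℝ≥0∞} (hM : M ≠ ∞) (hb : ∀ᵐ x, ‖u₀ x‖ₑ ≤ M)
    (x : Euc n) :
    fracHeatSemigroup β t u₀ x = (conv (heatK β t) (fun y => ENNReal.ofReal (u₀ y)) x).toReal -
      (conv (heatK β t) (fun y => ENNReal.ofReal (-u₀ y)) x).toReal := by
  have hc := (continuous_fracHeatKernel (n := n) hβ ht).measurable
  have key : ∀ F : Euc n → ℝ≥0∞, Measurable F → (∀ᵐ y, F y ≤ M) → (∀ y, F y ≠ ∞) →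
      Integrable (fun y => fracHeatKernel β t (x - y) * (F y).toReal) := fun F hF hFM hFt => by
    refine ⟨Measurable.aestronglyMeasurable (by fun_prop), ?_⟩
    refine lt_of_le_of_lt (le_of_eq ?_) ((conv_heatK_le hβ hβ2 ht hFM x).trans_lt hM.lt_top)
    rw [conv]
    congr 1; ext y
    rw [enorm_mul, Real.enorm_eq_ofReal (fracHeatKernel_nonneg hβ hβ2 ht _),
      Real.enorm_eq_ofReal ENNReal.toReal_nonneg, ENNReal.ofReal_toReal (hFt y), heatK_eq hβ ht]
  have hpos : ∀ᵐ y, ENNReal.ofReal (u₀ y) ≤ M := hb.mono fun y hy => by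
    refine le_trans ?_ hy
    rw [Real.enorm_eq_ofReal_abs]; exact ENNReal.ofReal_le_ofReal (le_abs_self _)
  have hneg : ∀ᵐ y, ENNReal.ofReal (-u₀ y) ≤ M := hb.mono fun y hy => by
    refine le_trans ?_ hy
    rw [Real.enorm_eq_ofReal_abs]; exact ENNReal.ofReal_le_ofReal (neg_le_abs _)
  rw [← fracHeatSemigroup_toReal hβ hβ2 ht (by fun_prop) (fun y => ENNReal.ofReal_ne_top),
    ← fracHeatSemigroup_toReal hβ hβ2 ht (by fun_prop) (fun y => ENNReal.ofReal_ne_top)]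
  simp only [fracHeatSemigroup]
  rw [← integral_sub (key _ (by fun_prop) hpos (fun y => ENNReal.ofReal_ne_top))
    (key _ (by fun_prop) hneg (fun y => ENNReal.ofReal_ne_top))]
  congr 1; ext y
  rw [← mul_sub, ENNReal.toReal_ofReal', ENNReal.toReal_ofReal', max_zero_sub_eq_self]

lemma duhamelIntegrand_integral_eq (hα : 0 < α) (hαn : α < n) (hβ : 0 < β) (hβ2 : β ≤ 2)
    (hp : 0 ≤ p) {u : ℝ → Euc n → ℝ} (hu : Measurable (Function.uncurry u)) {C : ℝ≥0∞}
    (hC : C ≠ ∞) {t : ℝ} (ht : 0 < t)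
    (h1 : ∀ τ ∈ Set.Ioo 0 t, ∀ x, conv (rieszK α) (fun y => ‖u τ y‖ₑ ^ p) x ≤ C) (x : Euc n) :
    IntervalIntegrable (duhamelIntegrand α β p u t x) volume 0 t ∧
      ∫ τ in (0 : ℝ)..t, duhamelIntegrand α β p u t x τ =
        (duhamel β α (fun τ y => ‖u τ y‖ₑ ^ p) t x).toReal := by
  have hum : ∀ τ, Measurable (u τ) := fun τ => hu.comp (measurable_const.prodMk measurable_id)
  have hf : Measurable (Function.uncurry fun τ y => ‖u τ y‖ₑ ^ p) := hu.enorm.pow_const p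
  set g : ℝ → ℝ≥0∞ := fun τ => conv (forceK β α (t - τ)) (fun y => ‖u τ y‖ₑ ^ p) x with hg
  have hgm : Measurable g := (measurable_conv_forceK_time (α := α) hβ hf t).comp
    (f := fun τ : ℝ => (τ, x)) (by fun_prop)
  have hfin : duhamel β α (fun τ y => ‖u τ y‖ₑ ^ p) t x ≠ ∞ :=
    ne_top_of_le_ne_top (by finiteness) (duhamel_le_of_le hβ hβ2 hf h1 x)
  have hge : ∀ τ ∈ Set.Ioo 0 t, g τ =
      conv (heatK β (t - τ)) (conv (rieszK α) (fun y => ‖u τ y‖ₑ ^ p)) x := fun τ _ => by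
    rw [hg, ← conv_forceK hβ _ (measurable_uncurry_apply hf τ)]
  have heq : Set.EqOn (fun τ => (g τ).toReal) (duhamelIntegrand α β p u t x) (Set.Ioo 0 t) :=
    fun τ hτ => by
      simp only
      rw [duhamelIntegrand_eq hα hαn hβ hβ2 hp hτ.2 (hum τ).aestronglyMeasurable
        (fun y => ne_top_of_le_ne_top hC (h1 τ hτ y)), hge τ hτ]
  have hint : IntegrableOn (fun τ => (g τ).toReal) (Set.Ioo 0 t) :=
    integrable_toReal_of_lintegral_ne_top hgm.aemeasurable hfin
  refine ⟨?_, ?_⟩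
  · rw [intervalIntegrable_iff_integrableOn_Ioo_of_le ht.le]
    exact (integrableOn_congr_fun heq measurableSet_Ioo).1 hint
  · rw [intervalIntegral.integral_of_le ht.le, integral_Ioc_eq_integral_Ioo,
      ← setIntegral_congr_fun measurableSet_Ioo heq, integral_toReal hgm.aemeasurable]
    · rfl
    · refine (ae_restrict_iff' measurableSet_Ioo).2 (ae_of_all _ fun τ hτ => ?_)
      rw [hge τ hτ]
      exact (conv_heatK_le hβ hβ2 (by linarith [hτ.2]) (ae_of_all _ (h1 τ hτ)) x).trans_lt hC.lt_top

/-- A function which solves the integral equation pointwise, with locally bounded norms, is a mild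
solution. -/
lemma isMildSolution_of_eq (hα : 0 < α) (hαn : α < n) (hβ : 0 < β) (hβ2 : β ≤ 2) (hp : 1 < p)
    (hs1 : (n : ℝ) / (n - α) < s) (hs2 : s < n * (p - 1) / α)
    {u₀ : Euc n → ℝ} (hu₀ : Measurable u₀) {M₀ : ℝ≥0∞} (hM₀ : M₀ ≠ ∞) (hb₀ : ∀ᵐ x, ‖u₀ x‖ₑ ≤ M₀)
    (hN₀ : lpNrm volume s (fun x => ‖u₀ x‖ₑ) ≠ ∞) {T : ℝ≥0∞} {u : ℝ → Euc n → ℝ}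
    (hu : Measurable (Function.uncurry u)) (hinit : u 0 = u₀)
    (hbd : ∀ t₁ : ℝ, ENNReal.ofReal t₁ < T → ∃ M : ℝ≥0∞, M ≠ ∞ ∧ ∀ t ∈ Set.Ioc 0 t₁,
      (∀ x, ‖u t x‖ₑ ≤ M) ∧ lpNrm volume s (fun x => ‖u t x‖ₑ) ≤ M)
    (heq : ∀ t : ℝ, 0 < t → ENNReal.ofReal t < T → ∀ x, u t x =
      (conv (heatK β t) (fun y => ENNReal.ofReal (u₀ y)) x).toReal -
      (conv (heatK β t) (fun y => ENNReal.ofReal (-u₀ y)) x).toReal +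
      (duhamel β α (fun τ y => ‖u τ y‖ₑ ^ p) t x).toReal) :
    IsMildSolution α β p s u₀ T u := by
  have hna : 0 < (n : ℝ) - α := by linarith
  have hs : 1 < s := lt_trans (by rw [one_lt_div hna]; linarith) hs1
  have hs0 : 0 < s := one_pos.trans hs
  have hum : ∀ τ, Measurable (u τ) := fun τ => hu.comp (measurable_const.prodMk measurable_id)
  have hf : Measurable (Function.uncurry fun τ y => ‖u τ y‖ₑ ^ p) := hu.enorm.pow_const p
  obtain ⟨C₀, hC₀, hC₀0, hC⟩ := exists_conv_rieszK_rpow_le (n := n) hα hαn hp hs1 hs2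
  have hforce : ∀ t₁ : ℝ, ENNReal.ofReal t₁ < T → ∃ C : ℝ≥0∞, C ≠ 0 ∧ C ≠ ∞ ∧ ∀ t ∈ Set.Ioc 0 t₁,
      (∀ x, conv (rieszK α) (fun y => ‖u t y‖ₑ ^ p) x ≤ C) ∧
      lpNrm volume s (conv (rieszK α) (fun y => ‖u t y‖ₑ ^ p)) ≤ C := by
    intro t₁ ht₁
    obtain ⟨M, hM, h⟩ := hbd t₁ ht₁
    refine ⟨C₀ * (M + 1) ^ p, ?_, ?_, fun t ht => ?_⟩
    · refine mul_ne_zero hC₀0 ?_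
      rw [ne_eq, ENNReal.rpow_eq_zero_iff]
      rintro (h | h)
      · simp at h
      · linarith [h.2]
    · exact ENNReal.mul_ne_top hC₀ (ENNReal.rpow_ne_top_of_nonneg (by linarith) (by finiteness))
    · exact hC (M + 1) _ (hum t).enorm (ae_of_all _ fun x => ((h t ht).1 x).trans (by simp))
        ((h t ht).2.trans (by simp))
  set Fp : Euc n → ℝ≥0∞ := fun y => ENNReal.ofReal (u₀ y) with hFp
  set Fn : Euc n → ℝ≥0∞ := fun y => ENNReal.ofReal (-u₀ y) with hFn
  have hFpm : Measurable Fp := by fun_prop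
  have hFnm : Measurable Fn := by fun_prop
  have hFp0 : ∀ y, Fp y ≤ ‖u₀ y‖ₑ := fun y => by
    rw [Real.enorm_eq_ofReal_abs]; exact ENNReal.ofReal_le_ofReal (le_abs_self _)
  have hFn0 : ∀ y, Fn y ≤ ‖u₀ y‖ₑ := fun y => by
    rw [Real.enorm_eq_ofReal_abs]; exact ENNReal.ofReal_le_ofReal (neg_le_abs _)
  have hrep : ∀ t : ℝ, 0 ≤ t → ENNReal.ofReal t < T → ∀ x, u t x =
      (heatFlow β t Fp x).toReal - (heatFlow β t Fn x).toReal +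
      (duhamel β α (fun τ y => ‖u τ y‖ₑ ^ p) t x).toReal := by
    intro t ht htT x
    rcases ht.eq_or_lt with rfl | ht
    · rw [heatFlow_zero hβ hβ2, heatFlow_zero hβ hβ2, hinit]
      simp [duhamel, hFp, hFn, ENNReal.toReal_ofReal']
    · rw [heatFlow_eq_conv hβ ht hFpm, heatFlow_eq_conv hβ ht hFnm, heq t ht htT x]
  -- Continuity at `t` also involves later times, so the bounds are needed slightly beyond `t`.
  have hexists : ∀ t : ℝ, ENNReal.ofReal t < T → ∃ t₁, t < t₁ ∧ ENNReal.ofReal t₁ < T := by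
    intro t ht
    have h := (ENNReal.continuous_ofReal.tendsto t).eventually (gt_mem_nhds ht)
    obtain ⟨t₁, h1, h2⟩ := ((frequently_gt_nhds t).and_eventually h).exists
    exact ⟨t₁, h1, h2⟩
  have hmem₀ : MemLp (u 0) (ENNReal.ofReal s) volume := by
    rw [hinit]
    refine ⟨hu₀.aestronglyMeasurable, ?_⟩
    rw [eLpNorm_eq_lpNrm hs0]; exact hN₀.lt_top
  refine ⟨by rw [hinit], fun t ht htT => ?_, fun t ht htT => ?_, fun t₁ ht₁ => ?_,
    fun t ht htT => ae_of_all _ fun x => ?_⟩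
  · rcases ht.eq_or_lt with rfl | ht
    · exact hmem₀
    obtain ⟨M, hM, h⟩ := hbd t htT
    refine ⟨(hum t).aestronglyMeasurable, ?_⟩
    rw [eLpNorm_eq_lpNrm hs0]
    exact (h t ⟨ht, le_rfl⟩).2.trans_lt hM.lt_top
  · obtain ⟨t₁, htt₁, ht₁⟩ := hexists t htT
    obtain ⟨C, hC0, hCt, h⟩ := hforce t₁ ht₁
    have hq := tendsto_lpNrm_duhamel_sub (α := α) hβ hβ2 hs hf hC0 hCt ht htt₁
      (fun τ hτ => (h τ ⟨hτ.1, hτ.2.le⟩).1) (fun τ hτ => (h τ ⟨hτ.1, hτ.2.le⟩).2)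
    have hflow : ∀ F : Euc n → ℝ≥0∞, Measurable F → (∀ y, F y ≤ ‖u₀ y‖ₑ) →
        Tendsto (fun a => lpNrm volume s
          (fun x => ‖(heatFlow β a F x).toReal - (heatFlow β t F x).toReal‖ₑ))
          (𝓝[Set.Ici 0] t) (𝓝 0) := fun F hF hF0 =>
      tendsto_lpNrm_heatFlow_sub hβ hβ2 hs ht hF
        (fun y => ne_top_of_le_ne_top (by simp) (hF0 y)) hM₀
        (hb₀.mono fun y hy => (hF0 y).trans hy) (ne_top_of_le_ne_top hN₀ (lpNrm_mono hs0 hF0))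
    have hsum := ((hflow Fp hFpm hFp0).add (hflow Fn hFnm hFn0)).add hq
    simp only [add_zero] at hsum
    have hle : 𝓝[{τ : ℝ | 0 ≤ τ ∧ ENNReal.ofReal τ < T}] t ≤ 𝓝[Set.Ici 0] t :=
      nhdsWithin_mono t fun τ hτ => hτ.1
    refine tendsto_of_tendsto_of_tendsto_of_le_of_le' tendsto_const_nhds (hsum.mono_left hle)
      (Eventually.of_forall fun _ => zero_le) ?_
    filter_upwards [self_mem_nhdsWithin] with τ hτ
    rw [eLpNorm_eq_lpNrm hs0]
    have hQm := fun t => (measurable_uncurry_apply (measurable_duhamel (α :=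
        α) hβ hf) t).ennreal_toReal
    have hPm := fun t => (measurable_heatFlow hβ t hFpm).ennreal_toReal
    have hNm := fun t => (measurable_heatFlow hβ t hFnm).ennreal_toReal
    refine (lpNrm_enorm_add_le hs.le (f := fun x => ((heatFlow β τ Fp x).toReal -
      (heatFlow β t Fp x).toReal) - ((heatFlow β τ Fn x).toReal - (heatFlow β t Fn x).toReal))
      (((hPm τ).sub (hPm t)).sub ((hNm τ).sub (hNm t))) ((hQm τ).sub (hQm t)) fun x => ?_).trans
      (add_le_add ?_ le_rfl)
    · simp only [Pi.sub_apply]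
      rw [hrep τ hτ.1 hτ.2, hrep t ht htT]; ring
    · have h3 := lpNrm_enorm_add_le hs.le
        (f := fun x => (heatFlow β τ Fp x).toReal - (heatFlow β t Fp x).toReal)
        (g := fun x => -((heatFlow β τ Fn x).toReal - (heatFlow β t Fn x).toReal))
        ((hPm τ).sub (hPm t)) ((hNm τ).sub (hNm t)).neg (fun x => sub_eq_add_neg _ _)
      simpa only [enorm_neg] using h3
  · obtain ⟨M, hM, h⟩ := hbd t₁ ht₁
    refine ⟨(M + M₀).toNNReal, fun t ht => ?_⟩
    rw [ENNReal.coe_toNNReal (by finiteness), eLpNorm_exponent_top]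
    refine essSup_le_of_ae_le _ ?_
    rcases ht.1.eq_or_lt with rfl | ht0
    · rw [hinit]
      exact hb₀.mono fun x hx => hx.trans (le_add_left le_rfl)
    · exact ae_of_all _ fun x => ((h t ⟨ht0, ht.2⟩).1 x).trans (le_add_right le_rfl)
  · obtain ⟨C, hC0, hCt, h⟩ := hforce t htT
    obtain ⟨h1, h2⟩ := duhamelIntegrand_integral_eq (β := β) hα hαn hβ hβ2 (by linarith) hu hCt ht
      (fun τ hτ => (h τ ⟨hτ.1, hτ.2.le⟩).1) x
    refine ⟨h1, ?_⟩
    rw [h2, fracHeatSemigroup_eq_sub hβ hβ2 ht hu₀ hM₀ hb₀, heq t ht htT x]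

end Criterion

/-! ### Mild solutions dominated by the minimal solution -/

section Majorant

variable {n : ℕ} {α β p s : ℝ}

/-- Convexity of `x ^ p`: the points `b + d` and `B` lie between `b` and `B + d` and are
complementary convex combinations of them. -/
lemma add_rpow_add_rpow_le (hp : 1 ≤ p) {b B d : ℝ} (hb : 0 ≤ b) (hbB : b ≤ B) (hd : 0 ≤ d) :
    (b + d) ^ p + B ^ p ≤ b ^ p + (B + d) ^ p := by
  rcases hd.eq_or_lt with rfl | hd
  · simp
  have hc := convexOn_rpow hp
  have hD : 0 < B + d - b := by linarith
  have h1 := hc.2 (Set.mem_Ici.2 hb) (Set.mem_Ici.2 (by linarith : 0 ≤ B + d))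
    (div_nonneg (by linarith : 0 ≤ B - b) hD.le) (by positivity : 0 ≤ d / (B + d - b))
    (by field_simp; ring)
  have h2 := hc.2 (Set.mem_Ici.2 hb) (Set.mem_Ici.2 (by linarith : 0 ≤ B + d))
    (by positivity : 0 ≤ d / (B + d - b)) (div_nonneg (by linarith : 0 ≤ B - b) hD.le)
    (by field_simp; ring)
  simp only [smul_eq_mul] at h1 h2
  rw [show (B - b) / (B + d - b) * b + d / (B + d - b) * (B + d) = b + d by field_simp; ring] at h1
  rw [show d / (B + d - b) * b + (B - b) / (B + d - b) * (B + d) = B by field_simp; ring] at h2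
  have h3 : (B - b) / (B + d - b) + d / (B + d - b) = 1 := by field_simp; ring
  calc (b + d) ^ p + B ^ p ≤ _ := add_le_add h1 h2
    _ = ((B - b) / (B + d - b) + d / (B + d - b)) * (b ^ p + (B + d) ^ p) := by ring
    _ = _ := by rw [h3, one_mul]

/-- The subtraction-free form of the implication from `a - b ≤ A - B` to `a ^ p - b ^ p ≤ A ^ p - B
^ p`: slopes of a convex function increase. -/
lemma rpow_add_rpow_le_of_add_le_add (hp : 1 ≤ p) {a b A B : ℝ≥0∞} (hA : A ≠ ∞)
    (haA : a ≤ A) (hbB : b ≤ B) (hBA : B ≤ A) (h : a + B ≤ b + A) :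
    a ^ p + B ^ p ≤ b ^ p + A ^ p := by
  have hp0 : 0 ≤ p := by linarith
  have hB : B ≠ ∞ := ne_top_of_le_ne_top hA hBA
  lift A to ℝ≥0 using hA
  lift B to ℝ≥0 using hB
  lift a to ℝ≥0 using ne_top_of_le_ne_top (by simp) haA
  lift b to ℝ≥0 using ne_top_of_le_ne_top (by simp) hbB
  rw [← ENNReal.coe_rpow_of_nonneg _ hp0, ← ENNReal.coe_rpow_of_nonneg _ hp0,
    ← ENNReal.coe_rpow_of_nonneg _ hp0, ← ENNReal.coe_rpow_of_nonneg _ hp0]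
  norm_cast at *
  rcases le_total a b with hab | hab
  · gcongr
  have h1 := add_rpow_add_rpow_le hp (b := b) (B := B) (d := a - b) b.2 (by exact_mod_cast hbB)
    (sub_nonneg.2 (by exact_mod_cast hab))
  rw [add_sub_cancel] at h1
  have h2 : (B : ℝ) + (a - b) ≤ A := by
    have : (a : ℝ) + B ≤ b + A := by exact_mod_cast h
    linarith
  have h3 : ((B : ℝ) + (a - b)) ^ p ≤ (A : ℝ) ^ p :=
    Real.rpow_le_rpow (add_nonneg B.2 (sub_nonneg.2 (by exact_mod_cast hab))) h2 hp0
  have h4 : (a : ℝ) ^ p + (B : ℝ) ^ p ≤ (b : ℝ) ^ p + (A : ℝ) ^ p := by linarith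
  exact_mod_cast h4

/-- The signed Picard iterates of the integral equation. -/
def signedPicard (β α p : ℝ) (u₀ : Euc n → ℝ) : ℕ → ℝ → Euc n → ℝ
  | 0 => fun _ _ => 0
  | k + 1 => fun t x => (conv (heatK β t) (fun y => ENNReal.ofReal (u₀ y)) x).toReal -
      (conv (heatK β t) (fun y => ENNReal.ofReal (-u₀ y)) x).toReal +
      (duhamel β α (fun τ y => ‖signedPicard β α p u₀ k τ y‖ₑ ^ p) t x).toReal

variable [NeZero n] {u₀ : Euc n → ℝ}

lemma measurable_signedPicard (hβ : 0 < β) (hu₀ : Measurable u₀) (k : ℕ) :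
    Measurable (Function.uncurry (signedPicard β α p u₀ k)) := by
  induction k with
  | zero => exact measurable_const
  | succ k ih =>
    exact ((measurable_conv_heatK_uncurry hβ (f₀ := fun y => ENNReal.ofReal (u₀ y))
      (by fun_prop)).ennreal_toReal.sub (measurable_conv_heatK_uncurry hβ
      (f₀ := fun y => ENNReal.ofReal (-u₀ y)) (by fun_prop)).ennreal_toReal).add
      (measurable_duhamel hβ (ih.enorm.pow_const p)).ennreal_toReal

lemma enorm_conv_heatK_sub_le (hβ : 0 < β) (hu₀ : Measurable u₀) (t : ℝ) (x : Euc n) :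
    ‖(conv (heatK β t) (fun y => ENNReal.ofReal (u₀ y)) x).toReal -
      (conv (heatK β t) (fun y => ENNReal.ofReal (-u₀ y)) x).toReal‖ₑ ≤
      conv (heatK β t) (fun y => ‖u₀ y‖ₑ) x := by
  refine enorm_sub_le.trans ?_
  have e : (fun y => ‖u₀ y‖ₑ) = fun y => ENNReal.ofReal (u₀ y) + ENNReal.ofReal (-u₀ y) := by
    ext y
    rw [Real.enorm_eq_ofReal_abs]
    rcases le_total 0 (u₀ y) with h | h
    · rw [abs_of_nonneg h, ENNReal.ofReal_of_nonpos (p := -u₀ y) (by linarith), add_zero]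
    · rw [abs_of_nonpos h, ENNReal.ofReal_of_nonpos (p := u₀ y) h, zero_add]
  rw [e, conv_add (measurable_heatK hβ t) (by fun_prop)]
  rw [Real.enorm_eq_ofReal ENNReal.toReal_nonneg, Real.enorm_eq_ofReal ENNReal.toReal_nonneg]
  exact add_le_add ENNReal.ofReal_toReal_le ENNReal.ofReal_toReal_le

lemma enorm_signedPicard_le (hβ : 0 < β) (hp : 0 ≤ p) (hu₀ : Measurable u₀) (k : ℕ) (t : ℝ)
    (x : Euc n) : ‖signedPicard β α p u₀ k t x‖ₑ ≤ picard β α p (fun y => ‖u₀ y‖ₑ) k t x := by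
  induction k generalizing t x with
  | zero => simp [signedPicard]
  | succ k ih =>
    refine (enorm_add_le _ _).trans (add_le_add (enorm_conv_heatK_sub_le hβ hu₀ t x) ?_)
    rw [Real.enorm_eq_ofReal ENNReal.toReal_nonneg]
    exact ENNReal.ofReal_toReal_le.trans
      (duhamel_mono (fun τ _ y => ENNReal.rpow_le_rpow (ih τ y) hp) x)

/-- If `|a| ≤ A`, `|b| ≤ B` and `|a - b| ≤ A - B` then the Duhamel terms of `|a| ^ p` and `|b| ^ p`
differ at most by the difference of the Duhamel terms of `A ^ p` and `B ^ p`. -/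
lemma enorm_duhamel_toReal_sub_le (hβ : 0 < β) (hp : 1 ≤ p) {a b : ℝ → Euc n → ℝ}
    {A B : ℝ → Euc n → ℝ≥0∞} (ha : Measurable (Function.uncurry a))
    (hb : Measurable (Function.uncurry b))
    (hA : ∀ t > 0, ∀ x, A t x ≠ ∞) (haA : ∀ t > 0, ∀ x, ‖a t x‖ₑ ≤ A t x)
    (hbB : ∀ t > 0, ∀ x, ‖b t x‖ₑ ≤ B t x)
    (h : ∀ t > 0, ∀ x, B t x + ‖a t x - b t x‖ₑ ≤ A t x) (t : ℝ) (x : Euc n)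
    (hfin : duhamel β α (fun τ y => A τ y ^ p) t x ≠ ∞) :
    duhamel β α (fun τ y => B τ y ^ p) t x +
      ‖(duhamel β α (fun τ y => ‖a τ y‖ₑ ^ p) t x).toReal -
        (duhamel β α (fun τ y => ‖b τ y‖ₑ ^ p) t x).toReal‖ₑ ≤
      duhamel β α (fun τ y => A τ y ^ p) t x := by
  have hp0 : 0 ≤ p := by linarith
  have hBA : ∀ t > 0, ∀ x, B t x ≤ A t x := fun t ht x => (le_add_right le_rfl).trans (h t ht x)
  have hBA' : duhamel β α (fun τ y => B τ y ^ p) t x ≤ duhamel β α (fun τ y => A τ y ^ p) t x :=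
    duhamel_mono (fun τ hτ y => ENNReal.rpow_le_rpow (hBA τ hτ.1 y) hp0) x
  have hBfin := ne_top_of_le_ne_top hfin hBA'
  have hfa : duhamel β α (fun τ y => ‖a τ y‖ₑ ^ p) t x ≠ ∞ := ne_top_of_le_ne_top hfin
    (duhamel_mono (fun τ hτ y => ENNReal.rpow_le_rpow (haA τ hτ.1 y) hp0) x)
  have hfb : duhamel β α (fun τ y => ‖b τ y‖ₑ ^ p) t x ≠ ∞ := ne_top_of_le_ne_top hfin
    (duhamel_mono (fun τ hτ y => ENNReal.rpow_le_rpow ((hbB τ hτ.1 y).trans (hBA τ hτ.1 y)) hp0) x)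
  have h1 : duhamel β α (fun τ y => ‖a τ y‖ₑ ^ p) t x + duhamel β α (fun τ y => B τ y ^ p) t x ≤
      duhamel β α (fun τ y => ‖b τ y‖ₑ ^ p) t x + duhamel β α (fun τ y => A τ y ^ p) t x := by
    rw [← duhamel_add hβ (ha.enorm.pow_const p), ← duhamel_add hβ (hb.enorm.pow_const p)]
    refine duhamel_mono (fun τ hτ y => ?_) x
    refine rpow_add_rpow_le_of_add_le_add hp (hA τ hτ.1 y) (haA τ hτ.1 y) (hbB τ hτ.1 y)
      (hBA τ hτ.1 y) ?_
    have h1 : ‖a τ y‖ₑ ≤ ‖b τ y‖ₑ + ‖a τ y - b τ y‖ₑ := by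
      refine le_trans (le_of_eq ?_) (enorm_add_le (b τ y) (a τ y - b τ y))
      rw [add_sub_cancel]
    calc ‖a τ y‖ₑ + B τ y ≤ ‖b τ y‖ₑ + (B τ y + ‖a τ y - b τ y‖ₑ) :=
          (add_le_add h1 le_rfl).trans (le_of_eq (by ring))
      _ ≤ _ := add_le_add le_rfl (h τ hτ.1 y)
  have h2 : duhamel β α (fun τ y => ‖b τ y‖ₑ ^ p) t x + duhamel β α (fun τ y => B τ y ^ p) t x ≤
      duhamel β α (fun τ y => ‖a τ y‖ₑ ^ p) t x + duhamel β α (fun τ y => A τ y ^ p) t x := by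
    rw [← duhamel_add hβ (hb.enorm.pow_const p), ← duhamel_add hβ (ha.enorm.pow_const p)]
    refine duhamel_mono (fun τ hτ y => ?_) x
    rcases le_total ‖b τ y‖ₑ ‖a τ y‖ₑ with hab | hab
    · exact add_le_add (ENNReal.rpow_le_rpow hab hp0) (ENNReal.rpow_le_rpow (hBA τ hτ.1 y) hp0)
    refine rpow_add_rpow_le_of_add_le_add hp (hA τ hτ.1 y) ((hbB τ hτ.1 y).trans (hBA τ hτ.1 y))
      (hab.trans (hbB τ hτ.1 y)) (hBA τ hτ.1 y) ?_
    have h1 : ‖b τ y‖ₑ ≤ ‖a τ y‖ₑ + ‖a τ y - b τ y‖ₑ := by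
      refine le_trans (le_of_eq ?_) (enorm_sub_le (a := a τ y) (b := a τ y - b τ y))
      rw [sub_sub_cancel]
    calc ‖b τ y‖ₑ + B τ y ≤ ‖a τ y‖ₑ + (B τ y + ‖a τ y - b τ y‖ₑ) :=
          (add_le_add h1 le_rfl).trans (le_of_eq (by ring))
      _ ≤ _ := add_le_add le_rfl (h τ hτ.1 y)
  have key : ∀ d e : ℝ≥0∞, d + duhamel β α (fun τ y => B τ y ^ p) t x ≤
      e + duhamel β α (fun τ y => A τ y ^ p) t x →
      d ≤ e + (duhamel β α (fun τ y => A τ y ^ p) t x - duhamel β α (fun τ y => B τ y ^ p) t x) :=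
          by
    intro d e hde
    rw [← ENNReal.add_le_add_iff_right hBfin, add_assoc, tsub_add_cancel_of_le hBA']
    exact hde
  calc _ ≤ duhamel β α (fun τ y => B τ y ^ p) t x + (duhamel β α (fun τ y => A τ y ^ p) t x -
        duhamel β α (fun τ y => B τ y ^ p) t x) :=
        add_le_add le_rfl (enorm_toReal_sub_toReal_le hfa hfb (key _ _ h1) (key _ _ h2))
    _ = _ := add_tsub_cancel_of_le hBA'

/-- Increments of the signed iterates are dominated by those of the positive iterates with datum
`|u₀|`. The linear parts cancel in both increments, and convexity carries the domination through the
Duhamel term. -/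
lemma picard_add_enorm_signedPicard_sub_le (hβ : 0 < β) (hp : 1 ≤ p) (hu₀ : Measurable u₀)
    (hfin : ∀ t > 0, ∀ x, minSol β α p (fun y => ‖u₀ y‖ₑ) t x ≠ ∞) (k : ℕ) {t : ℝ} (ht : 0 < t)
    (x : Euc n) :
    picard β α p (fun y => ‖u₀ y‖ₑ) k t x +
      ‖signedPicard β α p u₀ (k + 1) t x - signedPicard β α p u₀ k t x‖ₑ ≤
      picard β α p (fun y => ‖u₀ y‖ₑ) (k + 1) t x := by
  have hp0 : 0 ≤ p := by linarith
  induction k generalizing t x with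
  | zero =>
    have := enorm_signedPicard_le (α := α) hβ hp0 hu₀ 1 t x
    simpa [signedPicard, picard] using this
  | succ k ih =>
    have hpf : ∀ k, ∀ t > 0, ∀ x, picard β α p (fun y => ‖u₀ y‖ₑ) k t x ≠ ∞ := fun k t ht x =>
      ne_top_of_le_ne_top (hfin t ht x) (picard_le_minSol k t x)
    rw [picard_succ, picard_succ, add_assoc, signedPicard, signedPicard, add_sub_add_left_eq_sub]
    refine add_le_add le_rfl (enorm_duhamel_toReal_sub_le hβ hp (measurable_signedPicard hβ hu₀ _)
      (measurable_signedPicard hβ hu₀ _) (hpf (k + 1))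
      (fun t _ x => enorm_signedPicard_le hβ hp0 hu₀ _ t x)
      (fun t _ x => enorm_signedPicard_le hβ hp0 hu₀ _ t x) (fun t ht x => ih ht x) t x ?_)
    refine ne_top_of_le_ne_top (hpf (k + 2) t ht x) ?_
    rw [picard_succ]
    exact le_add_left le_rfl

lemma picard_add_enorm_signedPicard_sub_le_of_le (hβ : 0 < β) (hp : 1 ≤ p) (hu₀ : Measurable u₀)
    (hfin : ∀ t > 0, ∀ x, minSol β α p (fun y => ‖u₀ y‖ₑ) t x ≠ ∞) {k m : ℕ} (hkm : k ≤ m) {t : ℝ}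
    (ht : 0 < t) (x : Euc n) :
    picard β α p (fun y => ‖u₀ y‖ₑ) k t x +
      ‖signedPicard β α p u₀ m t x - signedPicard β α p u₀ k t x‖ₑ ≤
      picard β α p (fun y => ‖u₀ y‖ₑ) m t x := by
  induction m, hkm using Nat.le_induction with
  | base => simp
  | succ m hkm ih =>
    refine le_trans ?_ (picard_add_enorm_signedPicard_sub_le hβ hp hu₀ hfin m ht x)
    refine le_trans ?_ (add_le_add ih le_rfl)
    rw [add_assoc]
    refine add_le_add le_rfl (le_trans (le_of_eq ?_) (enorm_add_le _ _))
    congr 1; ring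

/-- The positive iterates converge to a finite limit; the signed ones move no further than they do
and are therefore Cauchy. -/
lemma exists_tendsto_signedPicard (hβ : 0 < β) (hp : 1 ≤ p) (hu₀ : Measurable u₀)
    (hfin : ∀ t > 0, ∀ x, minSol β α p (fun y => ‖u₀ y‖ₑ) t x ≠ ∞) {t : ℝ} (ht : 0 < t) (x :
        Euc n) :
    ∃ w : ℝ, Tendsto (fun k => signedPicard β α p u₀ k t x) atTop (𝓝 w) := by
  set U := fun k => picard β α p (fun y => ‖u₀ y‖ₑ) k t x with hU
  have hUf : ∀ k, U k ≠ ∞ := fun k => ne_top_of_le_ne_top (hfin t ht x) (picard_le_minSol k t x)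
  have hlim : Tendsto (fun k => (U k).toReal) atTop (𝓝 (minSol β α p (fun y =>
      ‖u₀ y‖ₑ) t x).toReal) :=
    (ENNReal.tendsto_toReal (hfin t ht x)).comp
      (tendsto_atTop_iSup (monotone_picard (by linarith) t x))
  have hd : ∀ k m, k ≤ m → dist (signedPicard β α p u₀ k t x) (signedPicard β α p u₀ m t x) ≤
      dist (U k).toReal (U m).toReal := by
    intro k m hkm
    have h1 := picard_add_enorm_signedPicard_sub_le_of_le (α := α) hβ hp hu₀ hfin hkm ht x
    have h2 := ENNReal.toReal_mono (hUf m) h1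
    rw [ENNReal.toReal_add (hUf k) (by simp), toReal_enorm, Real.norm_eq_abs] at h2
    rw [dist_comm, Real.dist_eq, dist_comm, Real.dist_eq]
    refine le_trans ?_ (le_abs_self _)
    linarith
  have hc : CauchySeq fun k => signedPicard β α p u₀ k t x := by
    have hcU := hlim.cauchySeq
    rw [Metric.cauchySeq_iff] at hcU ⊢
    intro ε hε
    obtain ⟨N, hN⟩ := hcU ε hε
    refine ⟨N, fun m hm k hk => ?_⟩
    rcases le_total m k with h | h
    · exact (hd m k h).trans_lt (hN m hm k hk)
    · rw [dist_comm]
      exact (hd k m h).trans_lt (hN k hk m hm)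
  exact cauchySeq_tendsto_of_complete hc

/-- If the minimal solution with datum `|u₀|` is finite, it dominates a solution of the integral
equation with datum `u₀`. -/
lemma exists_solution_le_minSol (hβ : 0 < β) (hp : 1 ≤ p) (hu₀ : Measurable u₀)
    (hfin : ∀ t > 0, ∀ x, minSol β α p (fun y => ‖u₀ y‖ₑ) t x ≠ ∞) :
    ∃ u : ℝ → Euc n → ℝ, Measurable (Function.uncurry u) ∧ u 0 = u₀ ∧ ∀ t > 0, ∀ x,
      ‖u t x‖ₑ ≤ minSol β α p (fun y => ‖u₀ y‖ₑ) t x ∧ u t x =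
      (conv (heatK β t) (fun y => ENNReal.ofReal (u₀ y)) x).toReal -
      (conv (heatK β t) (fun y => ENNReal.ofReal (-u₀ y)) x).toReal +
      (duhamel β α (fun τ y => ‖u τ y‖ₑ ^ p) t x).toReal := by
  have hp0 : 0 < p := by linarith
  set U := picard β α p (fun y => ‖u₀ y‖ₑ) with hU
  set V := minSol β α p (fun y => ‖u₀ y‖ₑ) with hV
  have hUlim : ∀ t > 0, ∀ x, Tendsto (fun k => U k t x) atTop (𝓝 (V t x)) := fun t _ x =>
    tendsto_atTop_iSup (monotone_picard hp0.le t x)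
  -- For `t ≤ 0` the sequence is constantly `u₀`, so one pointwise limit gives joint measurability
  -- and the initial value at once.
  have hex : ∀ z : ℝ × Euc n, ∃ w : ℝ, Tendsto (fun k =>
      if 0 < z.1 then signedPicard β α p u₀ k z.1 z.2 else u₀ z.2) atTop (𝓝 w) := by
    intro z
    by_cases hz : 0 < z.1
    · simp only [hz, if_true]
      exact exists_tendsto_signedPicard hβ hp hu₀ hfin hz z.2
    · simp only [hz, if_false]
      exact ⟨_, tendsto_const_nhds⟩
  choose w hw using hex
  have hwm : Measurable w := by
    refine measurable_of_tendsto_metrizable (f := fun k z =>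
      if 0 < z.1 then signedPicard β α p u₀ k z.1 z.2 else u₀ z.2) (fun k => ?_)
      (tendsto_pi_nhds.2 hw)
    exact Measurable.ite (measurableSet_lt measurable_const measurable_fst)
      (measurable_signedPicard hβ hu₀ k) (hu₀.comp measurable_snd)
  set u : ℝ → Euc n → ℝ := fun t x => w (t, x) with hu
  have hum : Measurable (Function.uncurry u) := hwm
  have hlim : ∀ t > 0, ∀ x, Tendsto (fun k => signedPicard β α p u₀ k t x) atTop (𝓝 (u t x)) := by
    intro t ht x
    have := hw (t, x)
    simpa [ht] using this
  have huU : ∀ k, ∀ t > 0, ∀ x, U k t x + ‖u t x - signedPicard β α p u₀ k t x‖ₑ ≤ V t x := by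
    intro k t ht x
    have h1 : Tendsto (fun m => U k t x + ‖signedPicard β α p u₀ m t x -
        signedPicard β α p u₀ k t x‖ₑ) atTop
        (𝓝 (U k t x + ‖u t x - signedPicard β α p u₀ k t x‖ₑ)) :=
      tendsto_const_nhds.add ((hlim t ht x).sub_const _).enorm
    refine le_of_tendsto_of_tendsto h1 (hUlim t ht x) ?_
    filter_upwards [eventually_ge_atTop k] with m hm
    exact picard_add_enorm_signedPicard_sub_le_of_le hβ hp hu₀ hfin hm ht x
  have huV : ∀ t > 0, ∀ x, ‖u t x‖ₑ ≤ V t x := fun t ht x => by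
    simpa [hU, picard, signedPicard] using huU 0 t ht x
  refine ⟨u, hum, ?_, fun t ht x => ⟨huV t ht x, ?_⟩⟩
  · ext x
    have := hw (0, x)
    simp only [lt_self_iff_false, if_false] at this
    exact tendsto_nhds_unique this tendsto_const_nhds
  · have hDfin : duhamel β α (fun τ y => V τ y ^ p) t x ≠ ∞ := by
      refine ne_top_of_le_ne_top (hfin t ht x) ?_
      rw [hV, minSol_eq hβ hp0 hu₀.enorm]
      exact le_add_left le_rfl
    have hstep : ∀ k, ‖(duhamel β α (fun τ y => ‖u τ y‖ₑ ^ p) t x).toReal -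
        (duhamel β α (fun τ y => ‖signedPicard β α p u₀ k τ y‖ₑ ^ p) t x).toReal‖ₑ ≤
        V t x - U (k + 1) t x := by
      intro k
      have h1 := enorm_duhamel_toReal_sub_le (α := α) hβ hp hum (measurable_signedPicard hβ hu₀ k)
        hfin huV
        (fun t _ x => enorm_signedPicard_le hβ hp0.le hu₀ k t x) (huU k) t x hDfin
      refine ENNReal.le_sub_of_add_le_left
        (ne_top_of_le_ne_top (hfin t ht x) (picard_le_minSol _ t x)) ?_
      rw [hU, picard_succ, hV, minSol_eq hβ hp0 hu₀.enorm, add_assoc]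
      exact add_le_add le_rfl h1
    have hzero : Tendsto (fun k => V t x - U (k + 1) t x) atTop (𝓝 0) := by
      have h1 := ENNReal.Tendsto.sub (tendsto_const_nhds (x := V t x))
        ((hUlim t ht x).comp (tendsto_add_atTop_nat 1)) (Or.inl (hfin t ht x))
      rwa [tsub_self] at h1
    have h2 : Tendsto (fun k => ‖(duhamel β α (fun τ y =>
        ‖signedPicard β α p u₀ k τ y‖ₑ ^ p) t x).toReal -
        (duhamel β α (fun τ y => ‖u τ y‖ₑ ^ p) t x).toReal‖ₑ) atTop (𝓝 0) := by
      refine tendsto_of_tendsto_of_tendsto_of_le_of_le tendsto_const_nhds hzero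
        (fun _ => zero_le) fun k => ?_
      simp only
      rw [← enorm_neg, neg_sub]
      exact hstep k
    have h3 : Tendsto (fun k => (duhamel β α (fun τ y =>
        ‖signedPicard β α p u₀ k τ y‖ₑ ^ p) t x).toReal)
        atTop (𝓝 (duhamel β α (fun τ y => ‖u τ y‖ₑ ^ p) t x).toReal) := by
      rw [tendsto_iff_edist_tendsto_0]
      simpa only [edist_eq_enorm_sub] using h2
    exact tendsto_nhds_unique ((hlim t ht x).comp (tendsto_add_atTop_nat 1))
      (tendsto_const_nhds.add h3)

lemma exists_isMildSolution_of_minSol_le (hα : 0 < α) (hαn : α < n) (hβ : 0 < β) (hβ2 : β ≤ 2)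
    (hp : 1 < p) (hs1 : (n : ℝ) / (n - α) < s) (hs2 : s < n * (p - 1) / α)
    (hu₀ : Measurable u₀) {M₀ : ℝ≥0∞} (hM₀ : M₀ ≠ ∞) (hb₀ : ∀ᵐ x, ‖u₀ x‖ₑ ≤ M₀)
    (hN₀ : lpNrm volume s (fun x => ‖u₀ x‖ₑ) ≠ ∞)
    (hbd : ∀ t₁ : ℝ, ∃ M : ℝ≥0∞, M ≠ ∞ ∧ ∀ t ∈ Set.Ioc 0 t₁,
      (∀ x, minSol β α p (fun y => ‖u₀ y‖ₑ) t x ≤ M) ∧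
      lpNrm volume s (minSol β α p (fun y => ‖u₀ y‖ₑ) t) ≤ M) :
    ∃ u : ℝ → Euc n → ℝ, IsMildSolution α β p s u₀ ∞ u ∧
      ∀ t > 0, ∀ x, ‖u t x‖ₑ ≤ minSol β α p (fun y => ‖u₀ y‖ₑ) t x := by
  have hs0 : 0 < s := lt_trans (div_pos (by linarith) (by linarith)) hs1
  obtain ⟨u, hum, hu0, hu⟩ := exists_solution_le_minSol (α := α) hβ hp.le hu₀ fun t ht x => by
    obtain ⟨M, hM, h⟩ := hbd t
    exact ne_top_of_le_ne_top hM ((h t ⟨ht, le_rfl⟩).1 x)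
  refine ⟨u, isMildSolution_of_eq hα hαn hβ hβ2 hp hs1 hs2 hu₀ hM₀ hb₀ hN₀ hum hu0
    (fun t₁ _ => ?_) (fun t ht _ x => (hu t ht x).2), fun t ht x => (hu t ht x).1⟩
  obtain ⟨M, hM, h⟩ := hbd t₁
  exact ⟨M, hM, fun t ht => ⟨fun x => ((hu t ht.1 x).1).trans ((h t ht).1 x),
    (lpNrm_mono hs0 fun x => (hu t ht.1 x).1).trans (h t ht).2⟩⟩

end Majorant

/-! ### The maximal solution for a nonnegative datum -/

section MaximalSolution

variable {n : ℕ} {α β p s : ℝ} {f₀ : Euc n → ℝ≥0∞}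

/-- The minimal solution is bounded in `L^∞` and in `L^s` on the time interval `(0, T]`. -/
def BoundedUpTo (α β p s : ℝ) (f₀ : Euc n → ℝ≥0∞) (T : ℝ) : Prop :=
  ∃ M : ℝ≥0∞, M ≠ ∞ ∧ ∀ t ∈ Set.Ioc 0 T,
    (∀ x, minSol β α p f₀ t x ≤ M) ∧ lpNrm volume s (minSol β α p f₀ t) ≤ M

lemma BoundedUpTo.mono {T T' : ℝ} (h : BoundedUpTo α β p s f₀ T) (hT : T' ≤ T) :
    BoundedUpTo α β p s f₀ T' := by
  obtain ⟨M, hM, h⟩ := h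
  exact ⟨M, hM, fun t ht => h t ⟨ht.1, ht.2.trans hT⟩⟩

variable [NeZero n]

/-- The extension time `δ` depends on `M` but not on `t₀`; this uniformity turns failure to extend
into divergence of the norms. -/
lemma exists_boundedUpTo_add (hα : 0 < α) (hαn : α < n) (hβ : 0 < β) (hβ2 : β ≤ 2)
    (hp : 1 < p) (hs1 : (n : ℝ) / (n - α) < s) (hs2 : s < n * (p - 1) / α) (hf₀ : Measurable f₀)
    {M : ℝ≥0∞} (hM : M ≠ ∞) : ∃ δ : ℝ, 0 < δ ∧ ∀ t₀ > 0, BoundedUpTo α β p s f₀ t₀ →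
      (∀ᵐ x, minSol β α p f₀ t₀ x ≤ M) → lpNrm volume s (minSol β α p f₀ t₀) ≤ M →
      BoundedUpTo α β p s f₀ (t₀ + δ) := by
  obtain ⟨δ, hδ, h⟩ := exists_minSol_le_of_le_at (n := n) hα hαn hβ hβ2 hp hs1 hs2
    (M := M + 1) (by simp) (by finiteness)
  refine ⟨δ, hδ, fun t₀ ht₀ hb h1 h2 => ?_⟩
  obtain ⟨M', hM', h'⟩ := hb
  refine ⟨M' + 2 * (M + 1), by finiteness, fun t ht => ?_⟩
  rcases le_or_gt t t₀ with htt | htt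
  · have := h' t ⟨ht.1, htt⟩
    exact ⟨fun x => (this.1 x).trans (le_add_right le_rfl), this.2.trans (le_add_right le_rfl)⟩
  · have := h f₀ hf₀ t₀ ht₀ (h1.mono fun x hx => hx.trans (by simp)) (h2.trans (by simp)) t
      ⟨htt, ht.2⟩
    exact ⟨fun x => (this.1 x).trans (le_add_left le_rfl), this.2.trans (le_add_left le_rfl)⟩

/-- If the minimal solution is not bounded on `(0, T]` for some `T`, it is bounded up to a finite
time at which it blows up. -/
lemma exists_blowup_time (hα : 0 < α) (hαn : α < n) (hβ : 0 < β) (hβ2 : β ≤ 2)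
    (hp : 1 < p) (hs1 : (n : ℝ) / (n - α) < s) (hs2 : s < n * (p - 1) / α) (hf₀ : Measurable f₀)
    {M₀ : ℝ≥0∞} (hM₀ : M₀ ≠ ∞) (hb₀ : ∀ᵐ x, f₀ x ≤ M₀) (hN₀ : lpNrm volume s f₀ ≠ ∞)
    (hnot : ∃ T, ¬ BoundedUpTo α β p s f₀ T) :
    ∃ T > 0, (∀ t < T, BoundedUpTo α β p s f₀ t) ∧ ∀ M : ℝ≥0∞, M ≠ ∞ →
      ∀ᶠ t in 𝓝[<] T, ¬ ((∀ᵐ x, minSol β α p f₀ t x ≤ M) ∧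
        lpNrm volume s (minSol β α p f₀ t) ≤ M) := by
  obtain ⟨δ₀, hδ₀, h₀⟩ := exists_minSol_le_of_le (n := n) hα hαn hβ hβ2 hp hs1 hs2
    (M := M₀ + lpNrm volume s f₀ + 1) (by simp) (by finiteness)
  have hδmem : BoundedUpTo α β p s f₀ δ₀ :=
    ⟨2 * (M₀ + lpNrm volume s f₀ + 1), by finiteness, h₀ f₀ hf₀
      (hb₀.mono fun x hx => hx.trans (by rw [add_assoc]; exact le_add_right le_rfl))
      (by rw [add_comm M₀, add_assoc]; exact le_add_right le_rfl)⟩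
  obtain ⟨T₁, hT₁⟩ := hnot
  set S := {T : ℝ | BoundedUpTo α β p s f₀ T} with hS
  have hSb : BddAbove S := ⟨T₁, fun T hT => by
    by_contra h
    exact hT₁ (BoundedUpTo.mono hT (not_le.1 h).le)⟩
  have hT0 : 0 < sSup S := hδ₀.trans_le (le_csSup hSb hδmem)
  have hlt : ∀ t < sSup S, BoundedUpTo α β p s f₀ t := fun t ht => by
    obtain ⟨T, hT, htT⟩ := exists_lt_of_lt_csSup ⟨δ₀, hδmem⟩ ht
    exact BoundedUpTo.mono hT htT.le
  refine ⟨sSup S, hT0, hlt, fun M hM => ?_⟩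
  -- At a time within `δ` of the supremum, a bound by `M` would extend boundedness beyond the
  -- supremum.
  obtain ⟨δ, hδ, h⟩ := exists_boundedUpTo_add (n := n) hα hαn hβ hβ2 hp hs1 hs2 hf₀ hM
  filter_upwards [self_mem_nhdsWithin, nhdsWithin_le_nhds (lt_mem_nhds hT0),
    nhdsWithin_le_nhds (lt_mem_nhds (show sSup S - δ < sSup S by linarith))] with t ht1 ht2 ht3
  rintro ⟨h1, h2⟩
  have := le_csSup hSb (h t ht2 (hlt t ht1) h1 h2)
  linarith

/-- If the minimal solution is not bounded on `(0, T]` for some `T`, the maximal mild solution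
exists
and blows up in finite time. -/
lemma exists_isMaximalMildSolution_of_not_boundedUpTo (hα : 0 < α) (hαn : α < n) (hβ : 0 < β)
    (hβ2 : β ≤ 2) (hp : 1 < p) (hs1 : (n : ℝ) / (n - α) < s) (hs2 : s < n * (p - 1) / α)
    {u₀ : Euc n → ℝ} (hu₀ : Measurable u₀) (hpos : ∀ x, 0 ≤ u₀ x) {M₀ : ℝ≥0∞} (hM₀ : M₀ ≠ ∞)
    (hb₀ : ∀ᵐ x, ‖u₀ x‖ₑ ≤ M₀) (hN₀ : lpNrm volume s (fun x => ‖u₀ x‖ₑ) ≠ ∞)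
    (hnot : ∃ T, ¬ BoundedUpTo α β p s (fun x => ‖u₀ x‖ₑ) T) :
    ∃ (T : ℝ) (u : ℝ → Euc n → ℝ), 0 < T ∧
      IsMaximalMildSolution α β p s u₀ (ENNReal.ofReal T) u ∧
      Tendsto (fun t => eLpNorm (u t) ∞ volume + eLpNorm (u t) (ENNReal.ofReal s) volume)
        (𝓝[<] T) (𝓝 ∞) := by
  have hna : 0 < (n : ℝ) - α := by linarith
  have hs : 1 < s := lt_trans (by rw [one_lt_div hna]; linarith) hs1
  have hs0 : 0 < s := one_pos.trans hs
  have hp0 : 0 < p := by linarith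
  set f₀ : Euc n → ℝ≥0∞ := fun x => ‖u₀ x‖ₑ with hf₀
  have hf₀m : Measurable f₀ := hu₀.enorm
  obtain ⟨T, hT, hlt, hblow⟩ := exists_blowup_time (n := n) hα hαn hβ hβ2 hp hs1 hs2 hf₀m hM₀
    hb₀ hN₀ hnot
  set U := minSol β α p f₀ with hU
  have hUm : Measurable (Function.uncurry U) := measurable_minSol hβ hf₀m
  -- The minimal solution vanishes at `t = 0`, because `heatK β 0` does; the datum is inserted by
  -- hand.
  set u : ℝ → Euc n → ℝ := fun t x => if t ≤ 0 then u₀ x else (U t x).toReal with hu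
  have hum : Measurable (Function.uncurry u) :=
    Measurable.ite (measurableSet_le measurable_fst measurable_const) (hu₀.comp measurable_snd)
      hUm.ennreal_toReal
  have hfin : ∀ t, 0 < t → t < T → ∀ x, U t x ≠ ∞ := fun t ht htT x => by
    obtain ⟨M, hM, h⟩ := hlt t htT
    exact ne_top_of_le_ne_top hM ((h t ⟨ht, le_rfl⟩).1 x)
  have huU : ∀ t, 0 < t → t < T → ∀ x, ‖u t x‖ₑ = U t x := fun t ht htT x => by
    simp only [hu, not_le.2 ht, if_false]
    rw [Real.enorm_eq_ofReal ENNReal.toReal_nonneg, ENNReal.ofReal_toReal (hfin t ht htT x)]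
  have hTlt : ∀ t : ℝ, ENNReal.ofReal t < ENNReal.ofReal T → t < T := fun t ht =>
    (ENNReal.ofReal_lt_ofReal_iff hT).1 ht
  have hmild : IsMildSolution α β p s u₀ (ENNReal.ofReal T) u := by
    refine isMildSolution_of_eq hα hαn hβ hβ2 hp hs1 hs2 hu₀ hM₀ hb₀ hN₀ hum ?_ ?_ ?_
    · ext x; simp [hu]
    · intro t₁ ht₁
      obtain ⟨M, hM, h⟩ := hlt t₁ (hTlt t₁ ht₁)
      refine ⟨M, hM, fun t ht => ?_⟩
      simp_rw [huU t ht.1 (ht.2.trans_lt (hTlt t₁ ht₁))]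
      exact h t ht
    · intro t ht htT x
      have htT' := hTlt t htT
      have h1 : u t x = (U t x).toReal := by simp only [hu, not_le.2 ht, if_false]
      have h2 := minSol_eq (α := α) hβ hp0 hf₀m t x
      rw [← hU] at h2
      have h3 : conv (heatK β t) f₀ x ≠ ∞ := ne_top_of_le_ne_top (hfin t ht htT' x) (by
        rw [h2]; exact le_add_right le_rfl)
      have h4 : duhamel β α (fun τ y => U τ y ^ p) t x ≠ ∞ :=
        ne_top_of_le_ne_top (hfin t ht htT' x) (by rw [h2]; exact le_add_left le_rfl)
      have h5 : (fun y => ENNReal.ofReal (u₀ y)) = f₀ := by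
        ext y; rw [hf₀]; simp only; rw [Real.enorm_eq_ofReal (hpos y)]
      have h6 : (fun y => ENNReal.ofReal (-u₀ y)) = fun _ => 0 := by
        ext y; exact ENNReal.ofReal_of_nonpos (by linarith [hpos y])
      rw [h1, h2, ENNReal.toReal_add h3 h4, h5, h6, conv_const _ (measurable_heatK hβ t), mul_zero,
        ENNReal.toReal_zero, sub_zero]
      congr 2
      exact duhamel_congr (fun τ hτ y => by rw [huU τ hτ.1 (hτ.2.trans htT')]) x
  have hnear : ∀ᶠ t in 𝓝[<] T, 0 < t ∧ t < T := by
    filter_upwards [self_mem_nhdsWithin, nhdsWithin_le_nhds (lt_mem_nhds hT)] with t h1 h2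
    exact ⟨h2, h1⟩
  refine ⟨T, u, hT, ⟨hmild, fun T' v hv => ?_⟩, ?_⟩
  -- A mild solution living beyond `T` is bounded on `[0, T]`, but it coincides before `T` with `U`,
  -- which is not bounded near `T`.
  · have hle : T' ≤ ENNReal.ofReal T := by
      by_contra hcon
      rw [not_le] at hcon
      obtain ⟨M, hM, h⟩ := hv.exists_boundedBy hs hcon
      obtain ⟨t, ht, ht0, htT⟩ := ((hblow M hM).and hnear).exists
      have htT' : ENNReal.ofReal t < ENNReal.ofReal T := (ENNReal.ofReal_lt_ofReal_iff hT).2 htT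
      have hae := hmild.ae_eq hα hαn hβ hβ2 hp hs1 hs2 hv ht0.le htT' (htT'.trans hcon)
      have hb := h t ⟨ht0.le, htT.le⟩
      have hae' : (fun x => ‖v t x‖ₑ) =ᵐ[volume] U t := by
        filter_upwards [hae] with x hx
        rw [hx, huU t ht0 htT]
      refine ht ⟨?_, ?_⟩
      · filter_upwards [hb.2.1, hae'] with x h1 h2
        rwa [← h2]
      · rw [← lpNrm_congr_ae hae']
        exact hb.2.2
    exact ⟨hle, fun t ht htT => hmild.ae_eq hα hαn hβ hβ2 hp hs1 hs2 hv ht (htT.trans_le hle) htT⟩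
  · rw [ENNReal.tendsto_nhds_top_iff_nnreal]
    intro M
    filter_upwards [hblow M (by simp), hnear] with t ht hh
    by_contra hcon
    rw [not_lt] at hcon
    have hUt : (fun x => ‖u t x‖ₑ) = U t := funext (huU t hh.1 hh.2)
    refine ht ⟨?_, ?_⟩
    · have h1 : eLpNorm (u t) ∞ volume ≤ M := (le_add_right le_rfl).trans hcon
      rw [eLpNorm_exponent_top] at h1
      filter_upwards [ae_le_eLpNormEssSup (f := u t) (μ := volume)] with x hx
      rw [← huU t hh.1 hh.2]
      exact hx.trans h1
    · rw [← hUt, ← eLpNorm_eq_lpNrm hs0]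
      exact (le_add_left le_rfl).trans hcon

/-- If the minimal solution with datum `|u₀|` is bounded on `(0, T]` for all `T`, there is a global
mild solution with datum `u₀`. -/
lemma exists_isMaximalMildSolution_of_boundedUpTo (hα : 0 < α) (hαn : α < n) (hβ : 0 < β)
    (hβ2 : β ≤ 2) (hp : 1 < p) (hs1 : (n : ℝ) / (n - α) < s) (hs2 : s < n * (p - 1) / α)
    {u₀ : Euc n → ℝ} (hu₀ : Measurable u₀) {M₀ : ℝ≥0∞} (hM₀ : M₀ ≠ ∞)
    (hb₀ : ∀ᵐ x, ‖u₀ x‖ₑ ≤ M₀) (hN₀ : lpNrm volume s (fun x => ‖u₀ x‖ₑ) ≠ ∞)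
    (hbd : ∀ T, BoundedUpTo α β p s (fun x => ‖u₀ x‖ₑ) T) :
    ∃ u : ℝ → Euc n → ℝ, IsMaximalMildSolution α β p s u₀ ∞ u ∧
      ∀ t > 0, ∀ x, ‖u t x‖ₑ ≤ minSol β α p (fun y => ‖u₀ y‖ₑ) t x := by
  obtain ⟨u, hu, hle⟩ := exists_isMildSolution_of_minSol_le hα hαn hβ hβ2 hp hs1 hs2 hu₀ hM₀ hb₀ hN₀
    hbd
  exact ⟨u, ⟨hu, fun T' v hv => ⟨le_top, fun t ht htT =>
    hu.ae_eq hα hαn hβ hβ2 hp hs1 hs2 hv ht ENNReal.ofReal_lt_top htT⟩⟩, hle⟩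

end MaximalSolution

/-! ### Lower bounds for the minimal solution -/

section LowerBounds

variable {n : ℕ} {α β p : ℝ} {f₀ : Euc n → ℝ≥0∞}

lemma exists_setLIntegral_ball_ne_zero (hf₀ : Measurable f₀) (h : ∫⁻ x, f₀ x ≠ 0) :
    ∃ R : ℕ, ∫⁻ x in Metric.ball (0 : Euc n) R, f₀ x ≠ 0 := by
  by_contra! hcon
  refine h ((lintegral_eq_zero_iff hf₀).2 ?_)
  have h1 : ∀ R : ℕ, ∀ᵐ x ∂volume.restrict (Metric.ball (0 : Euc n) R), f₀ x = 0 := fun R =>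
    (lintegral_eq_zero_iff hf₀).1 (hcon R)
  have h2 := (ae_restrict_iUnion_iff (μ := volume) (fun R : ℕ => Metric.ball (0 : Euc n) R)
    (fun x => f₀ x = 0)).2 h1
  rwa [Metric.iUnion_ball_nat, Measure.restrict_univ] at h2

variable [NeZero n]

/-- The kernel at time `1` exceeds half its value at the origin on a ball of radius `ε`. Some ball
of radius `R` carries mass of `f₀`, and for large `t` the rescaled points `(x - y) / t ^ (1 / β)`
with `y` in it fall into the `ε`-ball. -/
lemma exists_le_conv_heatK_of_lintegral_ne_zero (hβ : 0 < β) (hf₀ : Measurable f₀)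
    (h : ∫⁻ x, f₀ x ≠ 0) :
    ∃ c > 0, ∃ ρ : ℝ, 0 < ρ ∧ ρ ≤ 1 ∧ ∃ t₀ ≥ (1 : ℝ), ∀ t ≥ t₀, ∀ x : Euc n,
      ‖x‖ < ρ * t ^ (1 / β) → ENNReal.ofReal (c * t ^ (-((n : ℝ) / β))) ≤ conv (heatK β t) f₀ x :=
          by
  have hc := continuous_fracHeatKernel (n := n) hβ one_pos
  have h0 := fracHeatKernel_zero_pos (n := n) hβ one_pos
  set κ := fracHeatKernel β 1 (0 : Euc n) / 2 with hκ
  have hκ0 : 0 < κ := by positivity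
  obtain ⟨ε, hε, hεK⟩ := Metric.eventually_nhds_iff.1
    ((hc.tendsto 0).eventually (lt_mem_nhds (show κ < _ by rw [hκ]; linarith)))
  obtain ⟨R, hR⟩ := exists_setLIntegral_ball_ne_zero hf₀ h
  -- Capped at `1`, since `f₀` is not assumed to have finite mass.
  set m := min (∫⁻ x in Metric.ball (0 : Euc n) R, f₀ x) 1 with hm
  have hmt : m ≠ ∞ := ne_top_of_le_ne_top ENNReal.one_ne_top (min_le_right _ _)
  have hm0 : m ≠ 0 := by simp [hm, hR]
  set ρ := min (ε / 2) 1 with hρ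
  have hρ0 : 0 < ρ := by positivity
  refine ⟨κ * m.toReal, mul_pos hκ0 (ENNReal.toReal_pos hm0 hmt), ρ, hρ0, min_le_right _ _,
    max 1 ((R / ρ) ^ β), le_max_left _ _, fun t ht x hx => ?_⟩
  have ht0 : 0 < t := one_pos.trans_le ((le_max_left _ _).trans ht)
  have hRt : (R : ℝ) ≤ ρ * t ^ (1 / β) := by
    have h1 : ((R / ρ) ^ β) ^ (1 / β) ≤ t ^ (1 / β) :=
      Real.rpow_le_rpow (by positivity) ((le_max_right _ _).trans ht) (by positivity)
    rw [← Real.rpow_mul (by positivity), mul_one_div_cancel hβ.ne', Real.rpow_one,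
      div_le_iff₀ hρ0] at h1
    linarith
  have htt : 0 < t ^ (1 / β) := by positivity
  have hker : ∀ y ∈ Metric.ball (0 : Euc n) R,
      ENNReal.ofReal (t ^ (-((n : ℝ) / β)) * κ) ≤ heatK β t (x - y) := by
    intro y hy
    rw [heatK]
    refine ENNReal.ofReal_le_ofReal (mul_le_mul_of_nonneg_left (le_of_lt (hεK ?_)) (by positivity))
    rw [dist_zero_right, norm_smul, Real.norm_of_nonneg (by positivity), Real.rpow_neg ht0.le,
      inv_mul_lt_iff₀ htt]
    rw [mem_ball_zero_iff] at hy
    calc ‖x - y‖ ≤ ‖x‖ + ‖y‖ := norm_sub_le _ _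
      _ < ρ * t ^ (1 / β) + ρ * t ^ (1 / β) := add_lt_add hx (hy.trans_le hRt)
      _ ≤ t ^ (1 / β) * ε := by
        have : ρ ≤ ε / 2 := min_le_left _ _
        nlinarith
  calc ENNReal.ofReal (κ * m.toReal * t ^ (-((n : ℝ) / β)))
      = ENNReal.ofReal (t ^ (-((n : ℝ) / β)) * κ) * m := by
        rw [show κ * m.toReal * t ^ (-((n : ℝ) / β)) = (t ^ (-((n :
            ℝ) / β)) * κ) * m.toReal by ring,
          ENNReal.ofReal_mul (by positivity), ENNReal.ofReal_toReal hmt]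
    _ ≤ ENNReal.ofReal (t ^ (-((n : ℝ) / β)) * κ) * ∫⁻ x in Metric.ball (0 : Euc n) R, f₀ x :=
        mul_le_mul' le_rfl (min_le_left _ _)
    _ = ∫⁻ y in Metric.ball (0 : Euc n) R, ENNReal.ofReal (t ^ (-((n : ℝ) / β)) * κ) * f₀ y := by
        rw [lintegral_const_mul _ hf₀]
    _ ≤ ∫⁻ y in Metric.ball (0 : Euc n) R, heatK β t (x - y) * f₀ y :=
        setLIntegral_mono' measurableSet_ball fun y hy => mul_le_mul' (hker y hy) le_rfl
    _ ≤ _ := setLIntegral_le_lintegral _ _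

/-- The heat flow averages the potential over points within `t ^ (1 / β)` of `x`, and these are
within `3 * t ^ (1 / β)` of every point of the source ball. The lower bound does not depend on `τ`.
-/
lemma exists_ofReal_mul_le_conv_forceK (hα : 0 < α) (hαn : α < n) (hβ : 0 < β) :
    ∃ c > 0, ∀ (f : Euc n → ℝ≥0∞) (h : ℝ≥0∞) (τ t r : ℝ) (x : Euc n), Measurable f → 0 ≤ τ → τ < t →
      ‖x‖ ≤ t ^ (1 / β) → 0 < r → r ≤ t ^ (1 / β) → (∀ y, ‖y‖ < r → h ≤ f y) →
      ENNReal.ofReal (c * (t ^ (-((n - α) / β)) * r ^ n)) * h ≤ conv (forceK β α (t - τ)) f x := by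
  have hA := rieszConstant_pos hα hαn
  have hna : 0 < (n : ℝ) - α := by linarith
  set c₁ := ∫⁻ x in Metric.ball (0 : Euc n) 1, heatK β 1 x with hc₁
  have hc₁0 : 0 < min c₁ 1 := lt_min (setLIntegral_heatK_ball_pos hβ) one_pos
  have hc₁t : min c₁ 1 ≠ ∞ := ne_top_of_le_ne_top ENNReal.one_ne_top (min_le_right _ _)
  set V := volume (Metric.ball (0 : Euc n) 1) with hV
  have hV0 : V ≠ 0 := (Metric.measure_ball_pos volume _ one_pos).ne'
  have hVt : V ≠ ∞ := measure_ball_lt_top.ne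
  refine ⟨(min c₁ 1).toReal * (rieszConstant n α * ((3 : ℝ) ^ ((n : ℝ) - α))⁻¹) * V.toReal,
    by have := ENNReal.toReal_pos hc₁0.ne' hc₁t
       have := ENNReal.toReal_pos hV0 hVt
       positivity, ?_⟩
  intro f h τ t r x hf hτ hτt hx hr hrt hfh
  have ht : 0 < t := by linarith
  rw [conv_forceK hβ _ hf]
  set B := rieszConstant n α * ((3 : ℝ) ^ ((n : ℝ) - α))⁻¹ * t ^ (-((n - α) / β)) with hB
  have hle : c₁ * (ENNReal.ofReal B * h * (ENNReal.ofReal (r ^ n) * V)) ≤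
      conv (heatK β (t - τ)) (conv (rieszK α) f) x := by
    refine le_conv_heatK hβ (by linarith) (ae_of_all _ fun y hy => ?_)
    refine le_trans ?_ (le_conv_rieszK hα hαn hfh y)
    rw [Measure.addHaar_ball volume _ hr.le, finrank_euclideanSpace_fin]
    gcongr ENNReal.ofReal ?_ * h * _
    have h1 : (t - τ) ^ (1 / β) ≤ t ^ (1 / β) :=
      Real.rpow_le_rpow (by linarith) (by linarith) (by positivity)
    have h2 : ‖y‖ + r ≤ 3 * t ^ (1 / β) := by
      have h3 : ‖y‖ ≤ ‖x‖ + ‖x - y‖ := by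
        calc ‖y‖ = ‖x - (x - y)‖ := by rw [sub_sub_cancel]
          _ ≤ _ := norm_sub_le _ _
      linarith
    have h4 : t ^ (-((n - α) / β)) = ((t ^ (1 / β)) ^ ((n : ℝ) - α))⁻¹ := by
      rw [← Real.rpow_mul ht.le, ← Real.rpow_neg ht.le]; congr 1; ring
    rw [h4, mul_assoc, ← mul_inv, ← Real.mul_rpow (by norm_num) (by positivity)]
    gcongr
  refine le_trans (le_of_eq ?_) ((mul_le_mul' (min_le_left c₁ 1) le_rfl).trans hle)
  rw [show (min c₁ 1).toReal * (rieszConstant n α * ((3 : ℝ) ^ ((n : ℝ) - α))⁻¹) * V.toReal *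
    (t ^ (-((n - α) / β)) * r ^ n) = (min c₁ 1).toReal * (B * (r ^ n * V.toReal)) by rw [hB]; ring,
    ENNReal.ofReal_mul ENNReal.toReal_nonneg, ENNReal.ofReal_mul (p := B) (by positivity),
    ENNReal.ofReal_mul (p := r ^ n) (by positivity), ENNReal.ofReal_toReal hc₁t,
        ENNReal.ofReal_toReal hVt]
  ring

lemma exists_le_duhamel_of_le (hα : 0 < α) (hαn : α < n) (hβ : 0 < β) :
    ∃ c > 0, ∀ (f : ℝ → Euc n → ℝ≥0∞) (h r : ℝ → ℝ) (a b t : ℝ) (x : Euc n),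
      Measurable (Function.uncurry f) → 0 ≤ a → b ≤ t → ‖x‖ ≤ t ^ (1 / β) →
      (∀ τ ∈ Set.Ioo a b, 0 < r τ ∧ r τ ≤ t ^ (1 / β) ∧
        ∀ y, ‖y‖ < r τ → ENNReal.ofReal (h τ) ≤ f τ y) →
      ENNReal.ofReal (c * t ^ (-((n - α) / β))) *
        ∫⁻ τ in Set.Ioo a b, ENNReal.ofReal (r τ ^ n * h τ) ≤ duhamel β α f t x := by
  obtain ⟨c, hc, hforce⟩ := exists_ofReal_mul_le_conv_forceK (n := n) hα hαn hβ
  refine ⟨c, hc, fun f h r a b t x hf ha hb hx hfr => ?_⟩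
  rw [← lintegral_const_mul' _ _ ENNReal.ofReal_ne_top]
  calc _ ≤ ∫⁻ τ in Set.Ioo a b, conv (forceK β α (t - τ)) (f τ) x := by
        refine setLIntegral_mono' measurableSet_Ioo fun τ hτ => ?_
        obtain ⟨h1, h2, h3⟩ := hfr τ hτ
        have ht : 0 < t := by linarith [hτ.1, hτ.2]
        refine le_trans (le_of_eq ?_) (hforce (f τ) (ENNReal.ofReal (h τ)) τ t (r τ) x
          (measurable_uncurry_apply hf τ) (by linarith [hτ.1]) (by linarith [hτ.2]) hx h1 h2 h3)
        rw [← ENNReal.ofReal_mul (by positivity), ← ENNReal.ofReal_mul (by positivity)]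
        congr 1; ring
    _ ≤ _ := lintegral_mono_set (Set.Ioo_subset_Ioo ha hb)

/-- The source in the fixed time window `(t₀, 2 t₀)` and a fixed ball already produces decay `t ^
(-(n - α) / β)` on the whole parabolic ball, slower than the linear rate `t ^ (-n / β)`. -/
lemma exists_le_minSol (hα : 0 < α) (hαn : α < n) (hβ : 0 < β) (hp : 1 < p)
    (hf₀ : Measurable f₀) (h : ∫⁻ x, f₀ x ≠ 0) :
    ∃ c > 0, ∃ t₁ ≥ (1 : ℝ), ∀ t ≥ t₁, ∀ x : Euc n, ‖x‖ ≤ t ^ (1 / β) →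
      ENNReal.ofReal (c * t ^ (-((n - α) / β))) ≤ minSol β α p f₀ t x := by
  have hp0 : 0 < p := by linarith
  obtain ⟨c, hc, ρ, hρ, hρ1, t₀, ht₀, hlow⟩ := exists_le_conv_heatK_of_lintegral_ne_zero
    (n := n) hβ hf₀ h
  obtain ⟨C, hC, hduh⟩ := exists_le_duhamel_of_le (n := n) hα hαn hβ
  have ht₀0 : 0 < t₀ := by linarith
  set r := ρ * t₀ ^ (1 / β) with hr
  set H := (c * (2 * t₀) ^ (-((n : ℝ) / β))) ^ p with hH
  refine ⟨C * (r ^ n * H * t₀), by positivity, 2 * t₀, by linarith, fun t ht x hx => ?_⟩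
  have ht0 : 0 < t := by linarith
  have hm := (measurable_minSol (α := α) (p := p) hβ hf₀).pow_const p
  have h1 := hduh (fun τ y => minSol β α p f₀ τ y ^ p) (fun _ => H) (fun _ => r) t₀ (2 * t₀) t x hm
    ht₀0.le ht hx ?_
  · rw [setLIntegral_const, Real.volume_Ioo, ← ENNReal.ofReal_mul (by positivity),
      ← ENNReal.ofReal_mul (by positivity)] at h1
    rw [minSol_eq hβ hp0 hf₀]
    refine le_trans (le_of_eq ?_) (h1.trans (le_add_left le_rfl))
    congr 1; ring
  · intro τ hτ
    refine ⟨by positivity, ?_, fun y hy => ?_⟩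
    · have h2 : t₀ ^ (1 / β) ≤ t ^ (1 / β) :=
        Real.rpow_le_rpow ht₀0.le (by linarith) (by positivity)
      have h3 : 0 < t₀ ^ (1 / β) := by positivity
      rw [hr]; nlinarith
    · have hτ0 : 0 < τ := ht₀0.trans hτ.1
      have h2 := hlow τ hτ.1.le y (hy.trans_le (by
        rw [hr]
        exact mul_le_mul_of_nonneg_left
          (Real.rpow_le_rpow ht₀0.le hτ.1.le (by positivity)) hρ.le))
      rw [hH, ← ENNReal.ofReal_rpow_of_nonneg (by positivity) hp0.le]
      refine ENNReal.rpow_le_rpow ?_ hp0.le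
      rw [minSol_eq hβ hp0 hf₀]
      refine le_trans (ENNReal.ofReal_le_ofReal ?_) (h2.trans (le_add_right le_rfl))
      refine mul_le_mul_of_nonneg_left ?_ hc.le
      exact Real.rpow_le_rpow_of_nonpos hτ0 hτ.2.le (by
        have : 0 ≤ (n : ℝ) / β := by positivity
        linarith)

lemma setLIntegral_ofReal_inv {a b : ℝ} (ha : 0 < a) (hab : a ≤ b) :
    ∫⁻ τ in Set.Ioo a b, ENNReal.ofReal τ⁻¹ = ENNReal.ofReal (Real.log (b / a)) := by
  have hint : IntervalIntegrable (fun τ : ℝ => τ⁻¹) volume a b :=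
    intervalIntegrable_inv_iff.2 (Or.inr (by rw [Set.uIcc_of_le hab]; exact fun h => by linarith
        [h.1]))
  rw [← integral_inv (by rw [Set.uIcc_of_le hab]; exact fun h => by linarith [h.1]),
    intervalIntegral.integral_of_le hab, integral_Ioc_eq_integral_Ioo,
    ofReal_integral_eq_lintegral_ofReal]
  · exact (intervalIntegrable_iff_integrableOn_Ioo_of_le hab).1 hint
  · refine (ae_restrict_iff' measurableSet_Ioo).2 (ae_of_all _ fun τ hτ => ?_)
    exact (inv_pos.2 (ha.trans hτ.1)).le

/-- With the preceding bound inserted on balls of radius `τ ^ (1 / β)`, the time integrand is a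
power of `τ` whose exponent `(n - p (n - α)) / β` is at least `-1`. As `τ ≥ 1`, its integral is at
least a logarithm. -/
lemma exists_log_le_minSol (hα : 0 < α) (hαn : α < n) (hβ : 0 < β) (hp : 1 < p)
    (hpF : p * (n - α) ≤ n + β) (hf₀ : Measurable f₀) (h : ∫⁻ x, f₀ x ≠ 0) :
    ∃ c > 0, ∃ t₁ ≥ (1 : ℝ), ∀ t ≥ t₁, ∀ x : Euc n, ‖x‖ ≤ t ^ (1 / β) →
      ENNReal.ofReal (c * t ^ (-((n - α) / β)) * Real.log (t / t₁)) ≤ minSol β α p f₀ t x := by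
  have hp0 : 0 < p := by linarith
  obtain ⟨c, hc, t₁, ht₁, hlow⟩ := exists_le_minSol (n := n) hα hαn hβ hp hf₀ h
  obtain ⟨C, hC, hduh⟩ := exists_le_duhamel_of_le (n := n) hα hαn hβ
  have ht₁0 : 0 < t₁ := by linarith
  refine ⟨C * c ^ p, by positivity, t₁, ht₁, fun t ht x hx => ?_⟩
  have ht0 : 0 < t := by linarith
  have hm := (measurable_minSol (α := α) (p := p) hβ hf₀).pow_const p
  have h1 := hduh (fun τ y => minSol β α p f₀ τ y ^ p) (fun τ => (c * τ ^ (-((n - α) / β))) ^ p)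
    (fun τ => τ ^ (1 / β)) t₁ t t x hm ht₁0.le le_rfl hx ?_
  · rw [minSol_eq hβ hp0 hf₀]
    refine le_trans ?_ (h1.trans (le_add_left le_rfl))
    have hlog : 0 ≤ Real.log (t / t₁) := Real.log_nonneg ((one_le_div ht₁0).2 ht)
    have h2 : ENNReal.ofReal (c ^ p) * ENNReal.ofReal (Real.log (t / t₁)) ≤
        ∫⁻ τ in Set.Ioo t₁ t, ENNReal.ofReal ((τ ^ (1 / β)) ^ n * (c * τ ^
            (-((n - α) / β))) ^ p) := by
      rw [← setLIntegral_ofReal_inv ht₁0 ht, ← lintegral_const_mul' _ _ ENNReal.ofReal_ne_top]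
      refine setLIntegral_mono' measurableSet_Ioo fun τ hτ => ?_
      have hτ0 : 0 < τ := ht₁0.trans hτ.1
      rw [← ENNReal.ofReal_mul (by positivity)]
      refine ENNReal.ofReal_le_ofReal ?_
      rw [Real.mul_rpow hc.le (by positivity), ← Real.rpow_natCast, ← Real.rpow_mul hτ0.le,
        ← Real.rpow_mul hτ0.le, mul_left_comm, ← Real.rpow_add hτ0, ← Real.rpow_neg_one τ]
      refine mul_le_mul_of_nonneg_left ?_ (by positivity)
      refine Real.rpow_le_rpow_of_exponent_le (by linarith [hτ.1]) ?_
      rw [show 1 / β * (n : ℝ) + -((n - α) / β) * p = (n - p * (n - α)) / β by ring, le_div_iff₀ hβ]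
      linarith
    refine le_trans (le_of_eq ?_) (mul_le_mul' le_rfl h2)
    rw [← ENNReal.ofReal_mul (by positivity), ← ENNReal.ofReal_mul (by positivity)]
    congr 1; ring
  · intro τ hτ
    have hτ0 : 0 < τ := ht₁0.trans hτ.1
    refine ⟨by positivity, Real.rpow_le_rpow hτ0.le hτ.2.le (by positivity), fun y hy => ?_⟩
    rw [← ENNReal.ofReal_rpow_of_nonneg (by positivity) hp0.le]
    exact ENNReal.rpow_le_rpow (hlow τ hτ.1.le y hy.le) hp0.le

end LowerBounds

/-! ### Unboundedness of the minimal solution for subcritical powers -/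

section Unbounded

variable {n : ℕ} {α β p : ℝ} {f₀ : Euc n → ℝ≥0∞}

/-- A solution of `J ≥ a + b ∫ J ^ p` is infinite at times beyond a multiple of `a ^ (1 - p) / b`.
-/
lemma eq_top_of_le_integral_inequality (hp : 1 < p) {J : ℝ → ℝ≥0∞} {a b L : ℝ} (ha : 0 < a)
    (hb : 0 < b)
    (hJ : ∀ τ ∈ Set.Ioc 0 L, ENNReal.ofReal a +
      ENNReal.ofReal b * ∫⁻ σ in Set.Ioo 0 τ, J σ ^ p ≤ J τ)
    (hL : 2 / b * a ^ (1 - p) * (1 - (2 : ℝ) ^ (1 - p))⁻¹ < L) : J L = ∞ := by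
  have hp0 : 0 < p := by linarith
  set q : ℝ := (2 : ℝ) ^ (1 - p) with hq
  have hq0 : 0 < q := by positivity
  have hq1 : q < 1 := Real.rpow_lt_one_of_one_lt_of_neg (by norm_num) (by linarith)
  -- By time `θ k` the function has reached `a * 2 ^ k`. The next doubling takes at most `2 / b * (a
  -- * 2 ^ k) ^ (1 - p)`, and these waiting times form a geometric series of ratio `2 ^ (1 - p) <
  -- 1`.
  set θ : ℕ → ℝ := fun k => 2 / b * a ^ (1 - p) * ∑ j ∈ Finset.range k, q ^ j with hθ
  have hθ0 : ∀ k, 0 ≤ θ k := fun k => by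
    have : 0 ≤ ∑ j ∈ Finset.range k, q ^ j := Finset.sum_nonneg fun _ _ => by positivity
    positivity
  have hθL : ∀ k, θ k < L := fun k => by
    refine lt_of_le_of_lt (mul_le_mul_of_nonneg_left ?_ (by positivity)) hL
    rw [← tsum_geometric_of_lt_one hq0.le hq1]
    exact (summable_geometric_of_lt_one hq0.le hq1).sum_le_tsum _ fun _ _ => by positivity
  have key : ∀ k, ∀ τ ∈ Set.Ioc (θ k) L, ENNReal.ofReal (a * 2 ^ k) ≤ J τ := by
    intro k
    induction k with
    | zero =>
      intro τ hτ
      simp only [hθ, Finset.range_zero, Finset.sum_empty, mul_zero] at hτ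
      refine le_trans ?_ (hJ τ hτ)
      rw [pow_zero, mul_one]; exact le_add_right le_rfl
    | succ k ih =>
      intro τ hτ
      have hstep : θ (k + 1) = θ k + 2 / b * a ^ (1 - p) * q ^ k := by
        simp only [hθ]; rw [Finset.sum_range_succ]; ring
      have hd : 0 < 2 / b * a ^ (1 - p) * q ^ k := by positivity
      have hτ0 : 0 < τ := (hθ0 (k + 1)).trans_lt hτ.1
      refine le_trans ?_ (hJ τ ⟨hτ0, hτ.2⟩)
      have h1 : ENNReal.ofReal ((a * 2 ^ k) ^ p) * ENNReal.ofReal (τ - θ k) ≤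
          ∫⁻ σ in Set.Ioo 0 τ, J σ ^ p := by
        calc _ = ∫⁻ _ in Set.Ioo (θ k) τ, ENNReal.ofReal ((a * 2 ^ k) ^ p) := by
              rw [setLIntegral_const, Real.volume_Ioo]
          _ ≤ ∫⁻ σ in Set.Ioo (θ k) τ, J σ ^ p := by
              refine setLIntegral_mono' measurableSet_Ioo fun σ hσ => ?_
              rw [← ENNReal.ofReal_rpow_of_nonneg (by positivity) hp0.le]
              exact ENNReal.rpow_le_rpow (ih σ ⟨hσ.1, hσ.2.le.trans hτ.2⟩) hp0.le
          _ ≤ _ := lintegral_mono_set (Set.Ioo_subset_Ioo (hθ0 k) le_rfl)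
      refine le_trans ?_ (add_le_add le_rfl (mul_le_mul' le_rfl h1))
      refine le_trans ?_ (le_add_left le_rfl)
      rw [← ENNReal.ofReal_mul (by positivity), ← ENNReal.ofReal_mul hb.le]
      refine ENNReal.ofReal_le_ofReal ?_
      have h2 : 2 / b * a ^ (1 - p) * q ^ k ≤ τ - θ k := by linarith [hτ.1]
      have h3 : q ^ k = ((2 : ℝ) ^ k) ^ (1 - p) := by
        rw [hq, ← Real.rpow_natCast, ← Real.rpow_natCast, ← Real.rpow_mul (by norm_num),
          ← Real.rpow_mul (by norm_num), mul_comm]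
      calc a * 2 ^ (k + 1) = 2 * (a * 2 ^ k) := by ring
        _ = 2 * ((a * 2 ^ k) ^ p * (a * 2 ^ k) ^ (1 - p)) := by
          rw [← Real.rpow_add (by positivity), add_sub_cancel, Real.rpow_one]
        _ = b * ((a * 2 ^ k) ^ p * (2 / b * a ^ (1 - p) * q ^ k)) := by
          rw [h3, Real.mul_rpow ha.le (by positivity) (z := 1 - p)]; field_simp
        _ ≤ _ := by gcongr
  refine ENNReal.eq_top_of_forall_nnreal_le fun r => ?_
  obtain ⟨k, hk⟩ := pow_unbounded_of_one_lt (r / a) (one_lt_two (α := ℝ))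
  refine le_trans ?_ (key k L ⟨hθL k, le_rfl⟩)
  rw [← ENNReal.ofReal_coe_nnreal]
  refine ENNReal.ofReal_le_ofReal ?_
  rw [div_lt_iff₀ ha] at hk
  linarith

variable [NeZero n]

/-- Apply `S_β(t - τ)` to the equation restarted at `t` and evaluate at the origin. The linear part
is independent of `τ`. In the Duhamel part the kernel is that of `S_β(t - σ) I_α`, at least a
multiple of `(t / 2) ^ (α / β)` times the heat kernel since `σ < t / 2`, and Jensen's inequality
takes the power `p` outside. -/
lemma exists_conv_heatK_minSol_integral_inequality (hα : 0 < α) (hαn : α < n) (hβ : 0 < β)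
    (hβ2 : β ≤ 2) (hp : 1 < p) (hf₀ : Measurable f₀) :
    ∃ c > 0, ∀ t > 0, ∀ τ ∈ Set.Ioc 0 (t / 2),
      conv (heatK β t) (minSol β α p f₀ t) 0 + ENNReal.ofReal (c * (t / 2) ^ (α / β)) *
        ∫⁻ σ in Set.Ioo 0 τ, conv (heatK β (t - σ)) (minSol β α p f₀ (t + σ)) 0 ^ p ≤
      conv (heatK β (t - τ)) (minSol β α p f₀ (t + τ)) 0 := by
  have hp0 : 0 < p := by linarith
  obtain ⟨c, hc0, hct, hforce⟩ := exists_mul_heatK_le_forceK (n := n) hα hαn hβ hβ2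
  refine ⟨c.toReal, ENNReal.toReal_pos hc0 hct, fun t ht τ hτ => ?_⟩
  have htτ : 0 < t - τ := by linarith [hτ.2]
  set U := minSol β α p f₀ with hU
  have hUm : Measurable (Function.uncurry U) := measurable_minSol hβ hf₀
  have hUt : ∀ t, Measurable (U t) := measurable_uncurry_apply hUm
  have hsplit : U (t + τ) = fun x => conv (heatK β τ) (U t) x +
      duhamel β α (fun σ y => U (t + σ) y ^ p) τ x :=
    funext fun x => minSol_add_time hβ hβ2 hp0 hf₀ ht hτ.1 x
  have hshift : Measurable (Function.uncurry fun σ y => U (t + σ) y ^ p) :=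
    (hUm.comp (f := fun z : ℝ × Euc n => (t + z.1, z.2)) (by fun_prop)).pow_const p
  rw [hsplit, conv_add (measurable_heatK hβ _) (measurable_conv (measurable_heatK hβ τ) (hUt t)),
    conv_heatK_conv_heatK hβ hβ2 htτ hτ.1 (hUt t), sub_add_cancel]
  refine add_le_add le_rfl ?_
  change _ ≤ conv (heatK β (t - τ)) (fun x => ∫⁻ σ in Set.Ioo 0 τ,
    conv (forceK β α (τ - σ)) (fun y => U (t + σ) y ^ p) x) 0
  rw [conv_lintegral (measurable_heatK hβ _) (measurable_conv_forceK_time hβ hshift τ),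
    ← lintegral_const_mul' _ _ ENNReal.ofReal_ne_top]
  refine setLIntegral_mono' measurableSet_Ioo fun σ hσ => ?_
  have hσt : 0 < t - σ := by linarith [hσ.2]
  have hpm : Measurable fun y => U (t + σ) y ^ p := (hUt _).pow_const p
  rw [conv_heatK_conv_forceK hβ hβ2 htτ (by linarith [hσ.2]) hpm,
    show t - τ + (τ - σ) = t - σ by ring]
  have hjensen : conv (heatK β (t - σ)) (U (t + σ)) 0 ^ p ≤
      conv (heatK β (t - σ)) (fun y => U (t + σ) y ^ p) 0 := by
    have hk := (measurable_heatK (n := n) hβ (t - σ))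
    have h1 := lintegral_mul_rpow_le (μ := volume) (k := fun y => heatK β (t - σ) (0 - y))
      (d := U (t + σ)) (s := p) (hk.comp (by fun_prop)) (hUt _) hp.le
    rwa [lintegral_sub_left_eq_self (heatK β (t - σ)) (0 : Euc n), lintegral_heatK hβ hβ2 hσt,
      ENNReal.one_rpow, one_mul] at h1
  calc ENNReal.ofReal (c.toReal * (t / 2) ^ (α / β)) * conv (heatK β (t - σ)) (U (t + σ)) 0 ^ p
      ≤ c * ENNReal.ofReal ((t - σ) ^ (α / β)) *
          conv (heatK β (t - σ)) (fun y => U (t + σ) y ^ p) 0 := by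
        refine mul_le_mul' ?_ hjensen
        rw [ENNReal.ofReal_mul ENNReal.toReal_nonneg, ENNReal.ofReal_toReal hct]
        refine mul_le_mul' le_rfl (ENNReal.ofReal_le_ofReal ?_)
        exact Real.rpow_le_rpow (by linarith) (by linarith [hσ.2, hτ.2]) (by positivity)
    _ = ∫⁻ y, c * ENNReal.ofReal ((t - σ) ^ (α / β)) * heatK β (t - σ) (0 - y) *
          U (t + σ) y ^ p := by
        rw [conv, ← lintegral_const_mul' _ _ (by finiteness)]
        congr 1; ext y; ring
    _ ≤ _ := lintegral_mono fun y => mul_le_mul' (hforce _ hσt _) le_rfl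

/-- For `p ≤ 1 + (β + α) / (n - α)` the minimal solution with a nontrivial datum is unbounded. -/
lemma exists_minSol_not_le (hα : 0 < α) (hαn : α < n) (hβ : 0 < β) (hβ2 : β ≤ 2) (hp : 1 < p)
    (hpF : p ≤ fujitaExponent n β α) (hf₀ : Measurable f₀) (h : ∫⁻ x, f₀ x ≠ 0) :
    ∃ t > 0, ∀ M : ℝ≥0∞, M ≠ ∞ → ¬ ∀ x, minSol β α p f₀ t x ≤ M := by
  have hna : 0 < (n : ℝ) - α := by linarith
  have hp1 : 0 < p - 1 := by linarith
  have hpF1 : (p - 1) * (n - α) ≤ β + α := by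
    rw [fujitaExponent] at hpF
    rw [← le_div_iff₀ hna]; linarith
  obtain ⟨c, hc, t₁, ht₁, hlow⟩ := exists_log_le_minSol (n := n) hα hαn hβ hp
    (by linarith) hf₀ h
  obtain ⟨B, hB, hineq⟩ := exists_conv_heatK_minSol_integral_inequality (n := n) (p := p)
    hα hαn hβ hβ2 hp hf₀
  set c₁ := ∫⁻ x in Metric.ball (0 : Euc n) 1, heatK β 1 x with hc₁
  have hc₁0 : 0 < min c₁ 1 := lt_min (setLIntegral_heatK_ball_pos hβ) one_pos
  have hc₁t : min c₁ 1 ≠ ∞ := ne_top_of_le_ne_top ENNReal.one_ne_top (min_le_right _ _)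
  set d := (min c₁ 1).toReal * c with hd
  have hd0 : 0 < d := mul_pos (ENNReal.toReal_pos hc₁0.ne' hc₁t) hc
  have ht₁0 : 0 < t₁ := by linarith
  set Q := (1 - (2 : ℝ) ^ (1 - p))⁻¹ with hQ
  have hQ0 : 0 < Q := inv_pos.2 (sub_pos.2
    (Real.rpow_lt_one_of_one_lt_of_neg (by norm_num) (by linarith)))
  -- Up to a nonnegative power of `t` this is `a ^ (p - 1) * b * t` for the `a` and `b` chosen
  -- below. Its growth comes from the logarithm alone, so the critical exponent is included.
  have hlim : Tendsto (fun t : ℝ => B * (2⁻¹ : ℝ) ^ (α / β) * (d * Real.log (t / t₁)) ^ (p - 1))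
      atTop atTop :=
    ((tendsto_rpow_atTop hp1).comp ((Real.tendsto_log_atTop.comp
      (tendsto_id.atTop_div_const ht₁0)).const_mul_atTop hd0)).const_mul_atTop (by positivity)
  obtain ⟨t, htbig, htt₁⟩ := ((hlim.eventually_gt_atTop (4 * Q)).and
    (eventually_gt_atTop (max t₁ 1))).exists
  have ht₁t : t₁ < t := (le_max_left _ _).trans_lt htt₁
  have ht1 : 1 < t := (le_max_right _ _).trans_lt htt₁
  have ht0 : 0 < t := by linarith
  have hlog : 0 < Real.log (t / t₁) := Real.log_pos ((one_lt_div ht₁0).2 ht₁t)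
  set a := d * t ^ (-((n - α) / β)) * Real.log (t / t₁) with ha
  have ha0 : 0 < a := by positivity
  set b := B * (t / 2) ^ (α / β) with hb
  have hb0 : 0 < b := by positivity
  have hJ0 : ENNReal.ofReal a ≤ conv (heatK β t) (minSol β α p f₀ t) 0 := by
    refine le_trans ?_ ((mul_le_mul' (min_le_left c₁ 1) le_rfl).trans (le_conv_heatK hβ ht0
      (f := minSol β α p f₀ t) (x := 0)
      (h := ENNReal.ofReal (c * t ^ (-((n - α) / β)) * Real.log (t / t₁)))
      (ae_of_all _ fun y hy => hlow t ht₁t.le y ?_)))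
    · rw [ha, hd, mul_assoc, mul_assoc, ENNReal.ofReal_mul ENNReal.toReal_nonneg,
        ENNReal.ofReal_toReal hc₁t, mul_assoc c]
    · rw [zero_sub, norm_neg] at hy; exact hy.le
  have htop := eq_top_of_le_integral_inequality hp (L := t / 2)
    (J := fun τ => conv (heatK β (t - τ)) (minSol β α p f₀ (t + τ)) 0) ha0 hb0
    (fun τ hτ => (add_le_add hJ0 le_rfl).trans (hineq t ht0 τ hτ)) ?_
  · refine ⟨t + t / 2, by linarith, fun M hM hle => hM (top_le_iff.1 ?_)⟩
    rw [← htop]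
    exact conv_heatK_le hβ hβ2 (by linarith) (ae_of_all _ hle) 0
  · have h1 : a ^ (p - 1) * b * t = B * (2⁻¹ : ℝ) ^ (α / β) * (d * Real.log (t / t₁)) ^ (p - 1) *
        t ^ (((β + α) - (p - 1) * (n - α)) / β) := by
      rw [ha, hb, show d * t ^ (-((n - α) / β)) * Real.log (t / t₁) =
        (d * Real.log (t / t₁)) * t ^ (-((n - α) / β)) by ring,
        Real.mul_rpow (by positivity) (by positivity), ← Real.rpow_mul ht0.le, div_eq_mul_inv t 2,
        Real.mul_rpow ht0.le (by norm_num),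
        show ((β + α) - (p - 1) * (n - α)) / β = -((n - α) / β) * (p - 1) + α / β + 1 by
          field_simp; ring, Real.rpow_add_one ht0.ne', Real.rpow_add ht0]
      ring
    have h2 : 4 * Q < a ^ (p - 1) * b * t := by
      rw [h1]
      refine htbig.trans_le (le_mul_of_one_le_right (by positivity) ?_)
      exact Real.one_le_rpow ht1.le (div_nonneg (by linarith) hβ.le)
    have h3 : a ^ (1 - p) = (a ^ (p - 1))⁻¹ := by rw [← Real.rpow_neg ha0.le, neg_sub]
    have h4 : 0 < a ^ (p - 1) := by positivity
    change 2 / b * a ^ (1 - p) * Q < t / 2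
    rw [h3, show 2 / b * (a ^ (p - 1))⁻¹ * Q = 2 * Q / (a ^ (p - 1) * b) by field_simp,
      div_lt_div_iff₀ (by positivity) two_pos]
    linarith

end Unbounded

/-! ### Global bounds for small data in the supercritical case -/

section CriticalExponents

variable {n : ℕ} {α β p : ℝ}

/-- In terms of `ρ = 1 / r` the conditions form an interval. The lower ends express `θ ≥ 0`, with
integrability of the force kernel, and `σ p < 1`; the upper ends express `r > q`, hence `θ < 1`, and
`r > p`. The interval is nonempty, and `q > 1`, because `p` exceeds the Fujita exponent. The
relation between `θ` and `σ` is an identity reflecting scaling. -/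
lemma exists_critical_exponents (hα : 0 < α) (hαn : α < n) (hβ : 0 < β) (hp : 1 < p)
    (hF : fujitaExponent n β α < p) :
    ∃ r σ θ : ℝ, 1 < scalingExponent n β α p ∧ scalingExponent n β α p < r ∧ p < r ∧
      α / n < (p - 1) / r ∧ σ = n / β * (1 / scalingExponent n β α p - 1 / r) ∧
      θ = (n * (p - 1) / r - α) / β ∧ 0 ≤ σ ∧ 0 ≤ θ ∧ θ < 1 ∧ σ * p < 1 ∧ θ + σ * (p - 1) = 1 := by
  have hn : (0 : ℝ) < n := hα.trans hαn
  have hna : 0 < (n : ℝ) - α := by linarith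
  have hp1 : 0 < p - 1 := by linarith
  have hp0 : 0 < p := by linarith
  have hβα : 0 < β + α := by linarith
  have hF1 : β + α < (p - 1) * (n - α) := by
    rw [fujitaExponent, ← lt_sub_iff_add_lt', div_lt_iff₀ hna] at hF
    exact hF
  set q := scalingExponent n β α p with hq
  have hqe : 1 / q = (β + α) / (n * (p - 1)) := by rw [hq, scalingExponent, one_div_div]
  have hq0 : 0 < q := by rw [hq, scalingExponent]; positivity
  obtain ⟨ρ, hρ1, hρ2⟩ : ∃ ρ, max (α / (n * (p - 1))) (1 / q - β / (n * p)) < ρ ∧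
      ρ < min (1 / q) (1 / p) := by
    refine exists_between (max_lt (lt_min ?_ ?_) (lt_min ?_ ?_))
    · rw [hqe]; gcongr; linarith
    · rw [div_lt_div_iff₀ (by positivity) hp0]; nlinarith
    · have : 0 < β / (n * p) := by positivity
      linarith
    · rw [hqe, sub_lt_iff_lt_add, div_add_div _ _ hp0.ne' (by positivity),
        div_lt_div_iff₀ (by positivity) (by positivity)]
      have h1 : p * (β + α) < (n + β) * (p - 1) := by nlinarith
      have h2 : 0 < n * p := by positivity
      nlinarith [mul_lt_mul_of_pos_left h1 h2]
  have hρa := (le_max_left _ _).trans_lt hρ1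
  have hρb := (le_max_right _ _).trans_lt hρ1
  have hρc := hρ2.trans_le (min_le_left _ _)
  have hρd := hρ2.trans_le (min_le_right _ _)
  have hρ0 : 0 < ρ := lt_trans (by positivity) hρa
  have h1 : α < n * (p - 1) * ρ := by
    rw [div_lt_iff₀ (by positivity)] at hρa; linarith
  have h2 : n * (p - 1) * ρ < β + α := by
    rw [hqe, lt_div_iff₀ (by positivity)] at hρc; linarith
  have hρi : 1 / ρ⁻¹ = ρ := by rw [one_div, inv_inv]
  refine ⟨ρ⁻¹, n / β * (1 / q - 1 / ρ⁻¹), (n * (p - 1) / ρ⁻¹ - α) / β, ?_, ?_, ?_, ?_, rfl, rfl,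
    ?_, ?_, ?_, ?_, ?_⟩
  · rw [hq, scalingExponent, one_lt_div hβα]
    nlinarith
  · rw [lt_inv_comm₀ hq0 hρ0, ← one_div]; exact hρc
  · rw [lt_inv_comm₀ hp0 hρ0, ← one_div]; exact hρd
  · rw [div_inv_eq_mul, div_lt_iff₀ hn]; linarith
  · rw [hρi]; have : 0 < 1 / q - ρ := by linarith
    positivity
  · rw [div_inv_eq_mul]; exact div_nonneg (by linarith) hβ.le
  · rw [div_inv_eq_mul, div_lt_one hβ]; linarith
  · rw [hρi]
    calc n / β * (1 / q - ρ) * p < n / β * (β / (n * p)) * p := by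
          gcongr; linarith
      _ = 1 := by field_simp
  · rw [hqe, one_div, inv_inv, div_inv_eq_mul]
    field_simp
    ring

lemma setLIntegral_rpow_neg_le {η t : ℝ} (hη : η < 1) (ht : 0 < t) :
    ∫⁻ τ in Set.Ioo 0 t, ENNReal.ofReal (τ ^ (-η)) = ENNReal.ofReal (t ^ (1 - η) / (1 - η)) := by
  have hint := intervalIntegral.intervalIntegrable_rpow' (a := 0) (b := t) (r := -η) (by linarith)
  have h := integral_rpow (a := 0) (b := t) (r := -η) (Or.inl (by linarith))
  rw [Real.zero_rpow (by linarith), sub_zero, intervalIntegral.integral_of_le ht.le,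
    integral_Ioc_eq_integral_Ioo, neg_add_eq_sub] at h
  rw [← h, ofReal_integral_eq_lintegral_ofReal]
  · exact (intervalIntegrable_iff_integrableOn_Ioo_of_le ht.le).1 hint
  · refine (ae_restrict_iff' measurableSet_Ioo).2 (ae_of_all _ fun τ hτ => ?_)
    exact Real.rpow_nonneg hτ.1.le _

/-- On each half of `(0, t)` one of the two singular factors is bounded by its value at `t / 2`, so
no Beta function is needed. -/
lemma exists_setLIntegral_rpow_mul_rpow_le {θ η : ℝ} (hθ0 : 0 ≤ θ) (hθ : θ < 1) (hη0 : 0 ≤ η)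
    (hη : η < 1) : ∃ c > 0, ∀ t > 0, ∫⁻ τ in Set.Ioo 0 t,
      ENNReal.ofReal ((t - τ) ^ (-θ) * τ ^ (-η)) ≤ ENNReal.ofReal (c * t ^ (1 - θ - η)) := by
  have hθ1 : 0 < 1 - θ := by linarith
  have hη1 : 0 < 1 - η := by linarith
  refine ⟨(2⁻¹ : ℝ) ^ (-θ) / (1 - η) + (2⁻¹ : ℝ) ^ (-η) / (1 - θ), by positivity, fun t ht => ?_⟩
  have hrefl : ∫⁻ τ in Set.Ioo 0 t, ENNReal.ofReal ((t - τ) ^ (-θ)) =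
      ∫⁻ τ in Set.Ioo 0 t, ENNReal.ofReal (τ ^ (-θ)) := by
    rw [← lintegral_indicator measurableSet_Ioo, ← lintegral_indicator measurableSet_Ioo,
      ← lintegral_sub_left_eq_self _ t]
    congr 1; ext τ
    by_cases h : τ ∈ Set.Ioo 0 t
    · rw [Set.indicator_of_mem h, Set.indicator_of_mem (by constructor <;> linarith [h.1, h.2]),
        sub_sub_cancel]
    · rw [Set.indicator_of_notMem h, Set.indicator_of_notMem]
      exact fun h' => h (by constructor <;> linarith [h'.1, h'.2])
  calc ∫⁻ τ in Set.Ioo 0 t, ENNReal.ofReal ((t - τ) ^ (-θ) * τ ^ (-η))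
      ≤ ∫⁻ τ in Set.Ioo 0 t, (ENNReal.ofReal ((2⁻¹ * t) ^ (-θ)) * ENNReal.ofReal (τ ^ (-η)) +
        ENNReal.ofReal ((2⁻¹ * t) ^ (-η)) * ENNReal.ofReal ((t - τ) ^ (-θ))) := by
        refine setLIntegral_mono' measurableSet_Ioo fun τ hτ => ?_
        have hτ0 : 0 < τ := hτ.1
        have htτ : 0 < t - τ := by linarith [hτ.2]
        rw [← ENNReal.ofReal_mul (by positivity), ← ENNReal.ofReal_mul (by positivity),
          ← ENNReal.ofReal_add (by positivity) (by positivity)]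
        refine ENNReal.ofReal_le_ofReal ?_
        rcases le_total τ (2⁻¹ * t) with h | h
        · refine le_add_of_le_of_nonneg (mul_le_mul_of_nonneg_right ?_ (by positivity))
              (by positivity)
          exact Real.rpow_le_rpow_of_nonpos (by positivity) (by linarith) (by linarith)
        · refine le_add_of_nonneg_of_le (by positivity) ?_
          rw [mul_comm]
          refine mul_le_mul_of_nonneg_right ?_ (by positivity)
          exact Real.rpow_le_rpow_of_nonpos (by positivity) h (by linarith)
    _ = ENNReal.ofReal ((2⁻¹ * t) ^ (-θ) * (t ^ (1 - η) / (1 - η)) +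
        (2⁻¹ * t) ^ (-η) * (t ^ (1 - θ) / (1 - θ))) := by
        rw [lintegral_add_left (by fun_prop), lintegral_const_mul' _ _ ENNReal.ofReal_ne_top,
          lintegral_const_mul' _ _ ENNReal.ofReal_ne_top, hrefl, setLIntegral_rpow_neg_le hη ht,
          setLIntegral_rpow_neg_le hθ ht, ← ENNReal.ofReal_mul (by positivity),
          ← ENNReal.ofReal_mul (by positivity), ← ENNReal.ofReal_add (by positivity)
              (by positivity)]
    _ = _ := by
        congr 1
        rw [Real.mul_rpow (by norm_num) ht.le, Real.mul_rpow (by norm_num) ht.le,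
          show 1 - θ - η = -θ + (1 - η) by ring, Real.rpow_add ht,
          show (2⁻¹ : ℝ) ^ (-η) * t ^ (-η) * (t ^ (1 - θ) / (1 - θ)) =
            (2⁻¹ : ℝ) ^ (-η) * (t ^ (-η) * t ^ (1 - θ)) / (1 - θ) by ring, ← Real.rpow_add ht,
          show -η + (1 - θ) = -θ + (1 - η) by ring, Real.rpow_add ht]
        ring

variable [NeZero n]

/-- Splitting `f = f ^ (1 - q/r) * f ^ (q/r)` puts the first factor in `L^b` and the second in
`L^r`, both norms being powers of the `L^q` norm of `f`. The decay is that of the heat kernel in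
`L^a`. -/
lemma exists_lpNrm_conv_heatK_le_rpow (hβ : 0 < β) (hβ2 : β ≤ 2) {q r : ℝ} (hq : 1 < q)
    (hqr : q < r) :
    ∃ c > 0, ∀ t > 0, ∀ f : Euc n → ℝ≥0∞, Measurable f → lpNrm volume r (conv (heatK β t) f) ≤
      ENNReal.ofReal (c * t ^ (-(n / β * (1 / q - 1 / r)))) * lpNrm volume q f := by
  have hq0 : 0 < q := by linarith
  have hr0 : 0 < r := by linarith
  have hqr' : 1 / r < 1 / q := one_div_lt_one_div_of_lt hq0 hqr
  have hq1 : 1 / q < 1 := by rw [div_lt_one hq0]; exact hq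
  have hr1 : 0 < 1 / r := by positivity
  set b := (1 / q - 1 / r)⁻¹ with hb
  have hb0 : 0 < 1 / q - 1 / r := by linarith
  set a := (1 - (1 / q - 1 / r))⁻¹ with ha
  have ha0 : 0 < 1 - (1 / q - 1 / r) := by linarith
  have hab : a.HolderConjugate b := by
    rw [Real.holderConjugate_iff]
    exact ⟨(one_lt_inv₀ ha0).2 (by linarith), by rw [ha, hb, inv_inv, inv_inv]; ring⟩
  have har : a ≤ r := by
    rw [ha, inv_le_comm₀ ha0 hr0, ← one_div]; linarith
  have hL := lpNrm_heatK_one_ne_top (n := n) hβ hβ2 hab.lt.le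
  set L := lpNrm volume a (heatK β 1 : Euc n → ℝ≥0∞) with hLdef
  refine ⟨L.toReal + 1, by positivity, fun t ht f hf => ?_⟩
  have hqr0 : 0 < q / r := by positivity
  have hqr1 : 0 < 1 - q / r := by rw [sub_pos, div_lt_one hr0]; exact hqr
  have hsplit : f = fun y => f y ^ (1 - q / r) * f y ^ (q / r) := by
    ext y
    rw [← ENNReal.rpow_add_of_nonneg _ _ hqr1.le hqr0.le, sub_add_cancel, ENNReal.rpow_one]
  have h1 := lpNrm_conv_mul_le (measurable_heatK hβ t) (hf.pow_const (1 - q / r))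
    (hf.pow_const (q / r)) hab har
  rw [← hsplit, lpNrm_rpow_left hqr1, lpNrm_rpow_left hqr0,
    show (1 - q / r) * b = q by
      rw [hb, show 1 - q / r = q * (1 / q - 1 / r) by field_simp, mul_assoc,
        mul_inv_cancel₀ hb0.ne', mul_one], show q / r * r = q by field_simp, mul_assoc,
    ← ENNReal.rpow_add_of_nonneg _ _ hqr1.le hqr0.le, sub_add_cancel, ENNReal.rpow_one,
    lpNrm_heatK hβ hab.lt.le ht] at h1
  refine h1.trans (mul_le_mul' ?_ le_rfl)
  rw [mul_comm (L.toReal + 1), ENNReal.ofReal_mul (by positivity),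
    show -((n : ℝ) / β) * (1 - 1 / a) = -(n / β * (1 / q - 1 / r)) by
      rw [one_div a, ha, inv_inv]; ring]
  refine mul_le_mul' le_rfl ?_
  rw [ENNReal.ofReal_add ENNReal.toReal_nonneg zero_le_one, ENNReal.ofReal_toReal hL]
  exact le_add_right le_rfl

/-- Hölder with `1 / b = (p - 1) / r` places `v ^ (p - 1)` in `L^b`. Then `p < r` gives `a ≤ r`, and
`α / n < (p - 1) / r` is the integrability of the force kernel in `L^a`. The remaining factor `v`
may be measured in `L^r` or in `L^∞`. -/
lemma exists_conv_forceK_rpow_le (hα : 0 < α) (hαn : α < n) (hβ : 0 < β) (hβ2 : β ≤ 2) (hp : 1 < p)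
    {r : ℝ} (hpr : p < r) (hr : α / n < (p - 1) / r) :
    ∃ c > 0, ∀ t > 0, ∀ v : Euc n → ℝ≥0∞, Measurable v →
      lpNrm volume r (conv (forceK β α t) (fun y => v y ^ p)) ≤
        ENNReal.ofReal (c * t ^ (-((n * (p - 1) / r - α) / β))) * lpNrm volume r v ^ p ∧
      ∀ N : ℝ≥0∞, (∀ y, v y ≤ N) → ∀ x, conv (forceK β α t) (fun y => v y ^ p) x ≤
        ENNReal.ofReal (c * t ^ (-((n * (p - 1) / r - α) / β))) * lpNrm volume r v ^ (p - 1) * N :=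
            by
  have hn : (0 : ℝ) < n := hα.trans hαn
  have hp1 : 0 < p - 1 := by linarith
  have hr0 : 0 < r := by linarith
  set b := r / (p - 1) with hb
  have hb0 : 0 < b := by positivity
  have hbi : b⁻¹ = (p - 1) / r := by rw [hb, inv_div]
  have hpr' : (p - 1) / r < 1 := by rw [div_lt_one hr0]; linarith
  set a := (1 - (p - 1) / r)⁻¹ with ha
  have ha0 : 0 < 1 - (p - 1) / r := by linarith
  have hpr0 : 0 < (p - 1) / r := by positivity
  have hab : a.HolderConjugate b := by
    rw [Real.holderConjugate_iff]
    exact ⟨(one_lt_inv₀ ha0).2 (by linarith), by rw [hbi, ha, inv_inv]; ring⟩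
  have har : a ≤ r := by
    rw [ha, inv_le_comm₀ ha0 hr0, ← one_div, le_sub_iff_add_le, ← add_div, div_le_one hr0]; linarith
  have han : n < a * (n - α) := by
    rw [ha, inv_mul_eq_div, lt_div_iff₀ ha0]
    have := (div_lt_iff₀ hn).1 hr
    nlinarith
  have hL := lpNrm_forceK_one_ne_top (n := n) hα hαn hβ hβ2 hab.lt.le han
  set L := lpNrm volume a (forceK β α 1 : Euc n → ℝ≥0∞) with hLdef
  refine ⟨L.toReal + 1, by positivity, fun t ht v hv => ?_⟩
  have hker : lpNrm volume a (forceK β α t : Euc n → ℝ≥0∞) ≤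
      ENNReal.ofReal ((L.toReal + 1) * t ^ (-((n * (p - 1) / r - α) / β))) := by
    rw [lpNrm_forceK hα hαn hβ hab.pos ht, mul_comm (L.toReal + 1), ENNReal.ofReal_mul
        (by positivity),
      show -(((n : ℝ) - α) / β) + n / (β * a) = -((n * (p - 1) / r - α) / β) by
        rw [show (n : ℝ) / (β * a) = n / β * a⁻¹ by rw [div_mul_eq_div_div, div_eq_mul_inv _ a],
          ha, inv_inv]
        field_simp; ring]
    refine mul_le_mul' le_rfl ?_
    rw [ENNReal.ofReal_add ENNReal.toReal_nonneg zero_le_one, ENNReal.ofReal_toReal hL]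
    exact le_add_right le_rfl
  have hvb : lpNrm volume b (fun y => v y ^ (p - 1)) = lpNrm volume r v ^ (p - 1) := by
    rw [lpNrm_rpow_left hp1, hb, mul_div_cancel₀ _ hp1.ne']
  have hfm := measurable_forceK (n := n) (α := α) hβ t
  have hsplit : (fun y => v y ^ p) = fun y => v y ^ (p - 1) * v y :=
    funext fun y => (rpow_sub_one_mul_self hp (v y)).symm
  rw [hsplit]
  constructor
  · refine (lpNrm_conv_mul_le hfm (hv.pow_const _) hv hab har).trans ?_
    rw [hvb, mul_assoc, rpow_sub_one_mul_self hp]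
    exact mul_le_mul' hker le_rfl
  · intro N hN x
    refine (conv_mul_le hfm (hv.pow_const _) hab (ae_of_all _ hN) x).trans ?_
    rw [hvb]
    exact mul_le_mul' (mul_le_mul' hker le_rfl) le_rfl

end CriticalExponents

/-! ### A priori bounds for the iterates with small data. -/

section GlobalBounds

variable {n : ℕ} {α β p s : ℝ} [NeZero n]

/-- A datum which is small in the scaling-invariant Lebesgue space yields iterates with decaying
`L^r` norm and with `L^∞` norm at most twice that of the datum. -/
lemma exists_picard_le_of_small (hα : 0 < α) (hαn : α < n) (hβ : 0 < β) (hβ2 : β ≤ 2) (hp : 1 < p)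
    (hF : fujitaExponent n β α < p) :
    ∃ r σ M ε : ℝ, p < r ∧ α / n < (p - 1) / r ∧ 0 ≤ σ ∧ 0 < M ∧ 0 < ε ∧
      ∀ f₀ : Euc n → ℝ≥0∞, Measurable f₀ →
        lpNrm volume (scalingExponent n β α p) f₀ ≤ ENNReal.ofReal ε → ∀ k, ∀ t > 0,
          lpNrm volume r (picard β α p f₀ k t) ≤ ENNReal.ofReal (M * t ^ (-σ)) ∧
          ∀ N : ℝ≥0∞, (∀ᵐ x, f₀ x ≤ N) → ∀ x, picard β α p f₀ k t x ≤ 2 * N := by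
  obtain ⟨r, σ, θ, hq1, hqr, hpr, hr, hσ, hθ, hσ0, hθ0, hθ1, hσp, hθσ⟩ :=
    exists_critical_exponents hα hαn hβ hp hF
  have hp0 : 0 < p := by linarith
  have hp1 : 0 < p - 1 := by linarith
  have hr1 : 1 < r := by linarith
  have hr0 : 0 < r := by linarith
  set q := scalingExponent n β α p with hq
  obtain ⟨c₁, hc₁, hheat⟩ := exists_lpNrm_conv_heatK_le_rpow (n := n) hβ hβ2 hq1 hqr
  obtain ⟨c₂, hc₂, hforce⟩ := exists_conv_forceK_rpow_le (n := n) hα hαn hβ hβ2 hp hpr hr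
  rw [← hσ] at hheat
  rw [← hθ] at hforce
  obtain ⟨c₃, hc₃, hbeta⟩ := exists_setLIntegral_rpow_mul_rpow_le (θ := θ) (η := σ * p) hθ0 hθ1
    (by positivity) hσp
  obtain ⟨c₄, hc₄, hbeta'⟩ := exists_setLIntegral_rpow_mul_rpow_le (θ := θ) (η := σ *
      (p - 1)) hθ0 hθ1
    (by positivity) (by nlinarith)
  set K := 2 * c₂ * (c₃ + c₄) with hK
  have hK0 : 0 < K := by positivity
  -- Chosen so that `K * M ^ (p - 1) = 1`: both Duhamel constants are then at most `1 / 2`. The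
  -- linear part supplies the other half of `M` through `ε = M / (2 * c₁)`.
  set M := (K⁻¹) ^ (1 / (p - 1)) with hM
  have hM0 : 0 < M := by positivity
  have hMK : K * M ^ (p - 1) = 1 := by
    rw [hM, ← Real.rpow_mul (by positivity), one_div_mul_cancel hp1.ne', Real.rpow_one,
      mul_inv_cancel₀ hK0.ne']
  have hMp : 0 < M ^ (p - 1) := by positivity
  have hM3 : c₂ * c₃ * M ^ (p - 1) ≤ 1 / 2 := by
    have : 0 < c₂ * c₄ * M ^ (p - 1) := by positivity
    rw [hK] at hMK; linarith
  have hM4 : c₂ * c₄ * M ^ (p - 1) ≤ 1 / 2 := by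
    have : 0 < c₂ * c₃ * M ^ (p - 1) := by positivity
    rw [hK] at hMK; linarith
  refine ⟨r, σ, M, M / (2 * c₁), hpr, hr, hσ0, hM0, by positivity, fun f₀ hf₀ hsmall k => ?_⟩
  induction k with
  | zero =>
    intro t ht
    refine ⟨?_, fun N _ x => zero_le⟩
    simp [picard, lpNrm, ENNReal.zero_rpow_of_pos hr0, ENNReal.zero_rpow_of_pos (inv_pos.2 hr0)]
  | succ k ih =>
    intro t ht
    have hm := measurable_picard (α := α) (p := p) hβ hf₀ k
    have hmp := hm.pow_const p
    constructor
    · have hstep : ∀ τ ∈ Set.Ioo 0 t, lpNrm volume r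
          (conv (forceK β α (t - τ)) (fun y => picard β α p f₀ k τ y ^ p)) ≤
          ENNReal.ofReal (c₂ * M ^ p) * ENNReal.ofReal ((t - τ) ^ (-θ) * τ ^ (-(σ * p))) := by
        intro τ hτ
        have hτ0 : 0 < τ := hτ.1
        have htτ : 0 < t - τ := by linarith [hτ.2]
        refine ((hforce (t - τ) htτ _ (measurable_uncurry_apply hm τ)).1.trans
          (mul_le_mul' le_rfl (ENNReal.rpow_le_rpow (ih τ hτ0).1 hp0.le))).trans (le_of_eq ?_)
        rw [ENNReal.ofReal_rpow_of_nonneg (by positivity) hp0.le, ← ENNReal.ofReal_mul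
            (by positivity),
          ← ENNReal.ofReal_mul (by positivity), Real.mul_rpow hM0.le (by positivity),
          ← Real.rpow_mul hτ0.le, neg_mul]
        congr 1; ring
      have hduh : lpNrm volume r (duhamel β α (fun τ y => picard β α p f₀ k τ y ^ p) t) ≤
          ENNReal.ofReal (M / 2 * t ^ (-σ)) := by
        have h1 := lpNrm_lintegral_le (μ := volume) (ν := volume.restrict (Set.Ioo 0 t)) hr1
          (measurable_conv_forceK_time (α := α) hβ hmp t)
          (w := fun τ => ENNReal.ofReal (c₂ * M ^ p) *
            ENNReal.ofReal ((t - τ) ^ (-θ) * τ ^ (-(σ * p)))) (by fun_prop)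
          ((ae_restrict_iff' measurableSet_Ioo).2 (ae_of_all _ fun τ hτ => by
            have hτ0 : 0 < τ := hτ.1
            have htτ : 0 < t - τ := by linarith [hτ.2]
            rw [← ENNReal.ofReal_mul (by positivity)]
            exact (ENNReal.ofReal_pos.2 (by positivity)).ne'))
          (ae_of_all _ fun τ => by finiteness)
          ((ae_restrict_iff' measurableSet_Ioo).2 (ae_of_all _ hstep))
        refine h1.trans ?_
        rw [lintegral_const_mul' _ _ ENNReal.ofReal_ne_top]
        refine (mul_le_mul' le_rfl (hbeta t ht)).trans ?_
        rw [← ENNReal.ofReal_mul (by positivity)]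
        refine ENNReal.ofReal_le_ofReal ?_
        rw [show 1 - θ - σ * p = -σ by linarith]
        have h2 : M ^ p = M ^ (p - 1) * M := by rw [← Real.rpow_add_one hM0.ne', sub_add_cancel]
        have h3 : 0 < t ^ (-σ) := by positivity
        calc c₂ * M ^ p * (c₃ * t ^ (-σ)) = (c₂ * c₃ * M ^ (p - 1)) * (M * t ^ (-σ)) := by
              rw [h2]; ring
          _ ≤ 1 / 2 * (M * t ^ (-σ)) := by gcongr
          _ = _ := by ring
      refine (lpNrm_add_le hr1.le (measurable_conv (measurable_heatK hβ t) hf₀)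
        (measurable_uncurry_apply (measurable_duhamel hβ hmp) t)).trans ?_
      refine (add_le_add ((hheat t ht f₀ hf₀).trans (mul_le_mul' le_rfl hsmall)) hduh).trans
        (le_of_eq ?_)
      rw [← ENNReal.ofReal_mul (by positivity), ← ENNReal.ofReal_add (by positivity)
          (by positivity)]
      congr 1; field_simp; ring
    -- Only one factor is measured in `L^∞`, the other `p - 1` in `L^r`, so the estimate is linear
    -- in `N` and no smallness of `N` is needed; the time integral is a constant since `θ + σ (p -
    -- 1) = 1`.
    · intro N hN x
      rw [picard_succ, two_mul]
      refine add_le_add (conv_heatK_le hβ hβ2 ht hN x) ?_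
      have hstep : ∀ τ ∈ Set.Ioo 0 t,
          conv (forceK β α (t - τ)) (fun y => picard β α p f₀ k τ y ^ p) x ≤
          ENNReal.ofReal (c₂ * M ^ (p - 1)) *
            ENNReal.ofReal ((t - τ) ^ (-θ) * τ ^ (-(σ * (p - 1)))) * (2 * N) := by
        intro τ hτ
        have hτ0 : 0 < τ := hτ.1
        have htτ : 0 < t - τ := by linarith [hτ.2]
        refine ((hforce (t - τ) htτ _ (measurable_uncurry_apply hm τ)).2 (2 * N)
          ((ih τ hτ0).2 N hN) x).trans (mul_le_mul' ?_ le_rfl)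
        refine (mul_le_mul' le_rfl (ENNReal.rpow_le_rpow (ih τ hτ0).1 hp1.le)).trans (le_of_eq ?_)
        rw [ENNReal.ofReal_rpow_of_nonneg (by positivity) hp1.le, ← ENNReal.ofReal_mul
            (by positivity),
          ← ENNReal.ofReal_mul (by positivity), Real.mul_rpow hM0.le (by positivity),
          ← Real.rpow_mul hτ0.le, neg_mul]
        congr 1; ring
      calc duhamel β α (fun τ y => picard β α p f₀ k τ y ^ p) t x
          ≤ ∫⁻ τ in Set.Ioo 0 t, ENNReal.ofReal (c₂ * M ^ (p - 1)) *
            ENNReal.ofReal ((t - τ) ^ (-θ) * τ ^ (-(σ * (p - 1)))) * (2 * N) :=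
            setLIntegral_mono' measurableSet_Ioo hstep
        _ ≤ ENNReal.ofReal (c₂ * M ^ (p - 1)) * ENNReal.ofReal (c₄ * t ^ (1 - θ - σ * (p - 1))) *
            (2 * N) := by
            rw [lintegral_mul_const _ (by fun_prop), lintegral_const_mul' _ _ ENNReal.ofReal_ne_top]
            exact mul_le_mul' (mul_le_mul' le_rfl (hbeta' t ht)) le_rfl
        _ ≤ ENNReal.ofReal (1 / 2) * (2 * N) := by
            refine mul_le_mul' ?_ le_rfl
            rw [← ENNReal.ofReal_mul (by positivity), show 1 - θ - σ * (p - 1) = 0 by linarith,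
              Real.rpow_zero, mul_one]
            exact ENNReal.ofReal_le_ofReal (by linarith)
        _ = N := by
            rw [← mul_assoc, one_div, ENNReal.ofReal_inv_of_pos two_pos, ENNReal.ofReal_ofNat,
              ENNReal.inv_mul_cancel (by simp) (by simp), one_mul]

/-- The exponential solves the linear Gronwall equation exactly, so the induction that uses it
closes without loss. -/
lemma setLIntegral_exp_le {D K t : ℝ} (hD : 0 ≤ D) (hK : 0 < K) (ht : 0 ≤ t) :
    ENNReal.ofReal D + ∫⁻ τ in Set.Ioo 0 t, ENNReal.ofReal (K * D * Real.exp (K * τ)) =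
      ENNReal.ofReal (D * Real.exp (K * t)) := by
  have hint : IntervalIntegrable (fun τ : ℝ => K * D * Real.exp (K * τ)) volume 0 t :=
    Continuous.intervalIntegrable (by fun_prop) _ _
  have h : ∫ τ in (0 : ℝ)..t, K * D * Real.exp (K * τ) = D * Real.exp (K * t) - D := by
    rw [intervalIntegral.integral_eq_sub_of_hasDerivAt (f := fun τ => D * Real.exp (K * τ))
      (fun τ _ => ?_) hint]
    · simp
    · exact (((hasDerivAt_id τ).const_mul K).exp.const_mul D).congr_deriv (by simp only [id]; ring)
  rw [intervalIntegral.integral_of_le ht, integral_Ioc_eq_integral_Ioo] at h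
  rw [← ofReal_integral_eq_lintegral_ofReal
    ((intervalIntegrable_iff_integrableOn_Ioo_of_le ht).1 hint)
    (ae_of_all _ fun τ => by positivity), h, ← ENNReal.ofReal_add hD]
  · rw [add_sub_cancel]
  · have : 1 ≤ Real.exp (K * t) := Real.one_le_exp (by positivity)
    nlinarith

/-- Local boundedness of the minimal solution in `L^s`, given bounds in `L^∞` and in `L^r` away from
the initial time. -/
lemma boundedUpTo_of_picard_le (hα : 0 < α) (hαn : α < n) (hβ : 0 < β) (hβ2 : β ≤ 2) (hp : 1 < p)
    (hs1 : (n : ℝ) / (n - α) < s) (hs2 : s < n * (p - 1) / α) {f₀ : Euc n → ℝ≥0∞}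
    (hf₀ : Measurable f₀) {N : ℝ≥0∞} (hN : N ≠ ∞) (hb₀ : ∀ᵐ x, f₀ x ≤ N)
    (hN₀ : lpNrm volume s f₀ ≠ ∞) (hsup : ∀ k, ∀ t > 0, ∀ x, picard β α p f₀ k t x ≤ 2 * N)
    {r : ℝ} (hr0 : 0 < r) (hr : α / n < (p - 1) / r)
    (hbr : ∀ δ > 0, ∃ M : ℝ≥0∞, M ≠ ∞ ∧ ∀ k, ∀ t ≥ δ, lpNrm volume r (picard β α p f₀ k t) ≤ M)
    (T : ℝ) : BoundedUpTo α β p s f₀ T := by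
  have hna : 0 < (n : ℝ) - α := by linarith
  have hs : 1 < s := lt_trans (by rw [one_lt_div hna]; linarith) hs1
  have hs0 : 0 < s := one_pos.trans hs
  have hp0 : 0 < p := by linarith
  have hp1 : 0 < p - 1 := by linarith
  set L := N + lpNrm volume s f₀ + 1 with hL
  have hLt : L ≠ ∞ := by finiteness
  obtain ⟨δ, hδ, hshort⟩ := exists_minSol_le_of_le (n := n) hα hαn hβ hβ2 hp hs1 hs2
    (M := L) (by simp [hL]) hLt
  obtain ⟨C, hC, -, hriesz⟩ := exists_conv_rieszK_rpow_le (n := n) hα hαn hp hs1 hs2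
  obtain ⟨a, b, hab, has, han, hb⟩ := exists_holder_exponents hα hαn hs1 hr
  obtain ⟨M, hM, hMb⟩ := hbr δ hδ
  have hb0 : 0 < b := hab.symm.pos
  have hrb : r ≤ (p - 1) * b := by
    rw [div_le_div_iff₀ hb0 hr0, one_mul] at hb; exact hb
  set P := 2 * N + M with hP
  have hPt : P ≠ ∞ := by finiteness
  set K' := (∫⁻ y : Euc n, rieszNear α y) * P ^ (p - 1) +
    lpNrm volume a (rieszFar α : Euc n → ℝ≥0∞) * P ^ (p - 1) + C * (2 * L) ^ p + 1 with hK'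
  have hK't : K' ≠ ∞ := by
    have h1 := lintegral_rieszNear_ne_top (n := n) hα hαn
    have h2 := lpNrm_rieszFar_ne_top (n := n) hα hαn hab.pos han
    have h3 : P ^ (p - 1) ≠ ∞ := ENNReal.rpow_ne_top_of_nonneg hp1.le hPt
    have h4 : (2 * L) ^ p ≠ ∞ := ENNReal.rpow_ne_top_of_nonneg hp0.le (by finiteness)
    finiteness
  set K := K'.toReal with hK
  have hK0 : 0 < K := ENNReal.toReal_pos (by simp [hK']) hK't
  have hKK : ENNReal.ofReal K = K' := ENNReal.ofReal_toReal hK't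
  set D := (lpNrm volume s f₀).toReal + 1 with hD
  have hD1 : 1 ≤ D := by rw [hD]; linarith [ENNReal.toReal_nonneg (a := lpNrm volume s f₀)]
  have hD0 : lpNrm volume s f₀ ≤ ENNReal.ofReal D := by
    rw [hD, ENNReal.ofReal_add ENNReal.toReal_nonneg zero_le_one, ENNReal.ofReal_toReal hN₀]
    exact le_add_right le_rfl
  have key : ∀ k, ∀ t > 0, lpNrm volume s (picard β α p f₀ k t) ≤
      ENNReal.ofReal (D * Real.exp (K * t)) := by
    intro k
    induction k with
    | zero =>
      intro t _
      simp [picard, lpNrm, ENNReal.zero_rpow_of_pos hs0, ENNReal.zero_rpow_of_pos (inv_pos.2 hs0)]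
    | succ k ih =>
      intro t ht
      have hm := measurable_picard (α := α) (p := p) hβ hf₀ k
      have hmp := hm.pow_const p
      have hstep : ∀ τ ∈ Set.Ioo 0 t, lpNrm volume s
          (conv (rieszK α) (fun y => picard β α p f₀ k τ y ^ p)) ≤
          ENNReal.ofReal (K * D * Real.exp (K * τ)) := by
        intro τ hτ
        have hτ0 : 0 < τ := hτ.1
        have hexp : 1 ≤ Real.exp (K * τ) := Real.one_le_exp (by positivity)
        have hmτ := measurable_uncurry_apply hm τ
        -- Up to `δ`, where no bound in `L^r` is available, the local theory bounds the force by a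
        -- constant. Beyond `δ`, the bounds in `L^r` and `L^∞` make the force linear in the `L^s`
        -- norm of the iterate. Since `D ≥ 1`, one majorant covers both.
        rcases le_or_gt τ δ with h | h
        · obtain ⟨h1, h2⟩ := hshort f₀ hf₀
            (hb₀.mono fun x hx => hx.trans (by rw [hL, add_assoc]; exact le_add_right le_rfl))
            (by rw [hL, add_comm N, add_assoc]; exact le_add_right le_rfl) τ ⟨hτ0, h⟩
          have h3 := (hriesz (2 * L) _ hmτ
            (ae_of_all _ fun x => (picard_le_minSol k τ x).trans (h1 x))
            ((lpNrm_mono hs0 (picard_le_minSol k τ)).trans h2)).2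
          refine h3.trans ?_
          have h4 : C * (2 * L) ^ p ≤ K' := by
            rw [hK', add_assoc]; exact le_add_left (le_add_right le_rfl)
          refine h4.trans ?_
          rw [← hKK]
          refine ENNReal.ofReal_le_ofReal ?_
          rw [mul_assoc]
          exact le_mul_of_one_le_right hK0.le (one_le_mul_of_one_le_of_one_le hD1 hexp)
        · have hle : ∀ x, picard β α p f₀ k τ x ≤ P := fun x =>
            (hsup k τ hτ0 x).trans (le_add_right le_rfl)
          have h1 := lpNrm_rpow_le_of_le hr0 hp hrb hmτ (ae_of_all _ hle)
            ((hMb k τ h.le).trans (le_add_left le_rfl))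
          have h2 := lpNrm_conv_rieszK_le (α := α) hab has (hmτ.pow_const (p - 1)) hmτ
            (M := P ^ (p - 1)) (ae_of_all _ fun x => ENNReal.rpow_le_rpow (hle x) hp1.le)
          simp_rw [rpow_sub_one_mul_self hp] at h2
          refine h2.trans ?_
          rw [mul_assoc, ENNReal.ofReal_mul hK0.le, hKK]
          refine mul_le_mul' ?_ (ih τ hτ0)
          rw [hK', add_assoc _ (C * (2 * L) ^ p)]
          exact le_add_right (add_le_add le_rfl (mul_le_mul' le_rfl h1))
      refine (lpNrm_add_le hs.le (measurable_conv (measurable_heatK hβ t) hf₀)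
        (measurable_uncurry_apply (measurable_duhamel hβ hmp) t)).trans ?_
      rw [← setLIntegral_exp_le (by linarith) hK0 ht.le]
      refine add_le_add ((lpNrm_conv_heatK_le hβ hβ2 ht hf₀ hs.le).trans hD0) ?_
      refine lpNrm_duhamel_le hβ hβ2 hmp hs (by fun_prop) (fun τ _ => ?_)
        (fun τ _ => ENNReal.ofReal_ne_top) hstep
      exact (ENNReal.ofReal_pos.2 (by positivity)).ne'
  refine ⟨2 * N + ENNReal.ofReal (D * Real.exp (K * T)), by finiteness, fun t ht => ⟨fun x =>
    iSup_le fun k => (hsup k t ht.1 x).trans (le_add_right le_rfl), ?_⟩⟩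
  refine (lpNrm_iSup_le hs0 (fun k => measurable_uncurry_apply (measurable_picard hβ hf₀ k) t)
    (fun x => monotone_picard hp0.le t x) fun k => (key k t ht.1).trans ?_).trans
        (le_add_left le_rfl)
  refine ENNReal.ofReal_le_ofReal (mul_le_mul_of_nonneg_left (Real.exp_le_exp.2 ?_) (by linarith))
  exact mul_le_mul_of_nonneg_left ht.2 hK0.le

/-- Global boundedness of the minimal solution for small data. -/
lemma exists_boundedUpTo_of_small (hα : 0 < α) (hαn : α < n) (hβ : 0 < β) (hβ2 : β ≤ 2) (hp : 1 < p)
    (hF : fujitaExponent n β α < p) :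
    ∃ ε : ℝ, 0 < ε ∧ ∀ f₀ : Euc n → ℝ≥0∞, Measurable f₀ →
      lpNrm volume (scalingExponent n β α p) f₀ ≤ ENNReal.ofReal ε → ∀ N : ℝ≥0∞, N ≠ ∞ →
      (∀ᵐ x, f₀ x ≤ N) → (∀ t > 0, ∀ x, minSol β α p f₀ t x ≤ 2 * N) ∧
      ∀ s : ℝ, (n : ℝ) / (n - α) < s → s < n * (p - 1) / α → lpNrm volume s f₀ ≠ ∞ → ∀ T,
        BoundedUpTo α β p s f₀ T := by
  obtain ⟨r, σ, M, ε, hpr, hr, hσ, hM, hε, h⟩ := exists_picard_le_of_small (n :=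
      n) hα hαn hβ hβ2 hp hF
  refine ⟨ε, hε, fun f₀ hf₀ hsmall N hN hb₀ => ?_⟩
  have hk := h f₀ hf₀ hsmall
  refine ⟨fun t ht x => iSup_le fun k => (hk k t ht).2 N hb₀ x, fun s hs1 hs2 hN₀ =>
    boundedUpTo_of_picard_le hα hαn hβ hβ2 hp hs1 hs2 hf₀ hN hb₀ hN₀
      (fun k t ht => (hk k t ht).2 N hb₀) (by linarith) hr fun δ hδ => ?_⟩
  refine ⟨ENNReal.ofReal (M * δ ^ (-σ)), ENNReal.ofReal_ne_top, fun k t ht =>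
    (hk k t (hδ.trans_le ht)).1.trans (ENNReal.ofReal_le_ofReal ?_)⟩
  exact mul_le_mul_of_nonneg_left (Real.rpow_le_rpow_of_nonpos hδ ht (by linarith)) hM.le

end GlobalBounds

/-! ### The main theorem -/

section Main

variable {n : ℕ} {α β p : ℝ}

lemma exists_ne_top_ae_enorm_le {u₀ : Euc n → ℝ} (h : MemLp u₀ ∞ volume) :
    ∃ M : ℝ≥0∞, M ≠ ∞ ∧ ∀ᵐ x, ‖u₀ x‖ₑ ≤ M :=
  ⟨eLpNorm u₀ ∞ volume, h.2.ne, by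
    rw [eLpNorm_exponent_top]; exact ae_le_eLpNormEssSup⟩

variable [NeZero n]

lemma exists_blowup_of_le_fujitaExponent (hα : 0 < α) (hαn : α < n) (hβ : 0 < β) (hβ2 : β ≤ 2)
    (hp : 1 < p) (hpF : p ≤ fujitaExponent n β α) {u₀ : Euc n → ℝ} (h1 : MemLp u₀ 1 volume)
    (htop : MemLp u₀ ∞ volume) (hpos : 0 ≤ᵐ[volume] u₀) (hint : 0 < ∫ x, u₀ x) {s : ℝ}
    (hs1 : (n : ℝ) / (n - α) < s) (hs2 : s < n * (p - 1) / α) :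
    ∃ (T : ℝ) (u : ℝ → Euc n → ℝ), 0 < T ∧
      IsMaximalMildSolution α β p s u₀ (ENNReal.ofReal T) u ∧
      Tendsto (fun t => eLpNorm (u t) ∞ volume + eLpNorm (u t) (ENNReal.ofReal s) volume)
        (𝓝[<] T) (𝓝 ∞) := by
  have hna : 0 < (n : ℝ) - α := by linarith
  have hs : 1 < s := lt_trans (by rw [one_lt_div hna]; linarith) hs1
  have hs0 : 0 < s := one_pos.trans hs
  -- A representative that is measurable and nonnegative everywhere; mild solutions depend only on
  -- the class of the datum.
  set v₀ : Euc n → ℝ := fun x => max (h1.1.mk u₀ x) 0 with hv₀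
  have hv₀m : Measurable v₀ := h1.1.stronglyMeasurable_mk.measurable.max measurable_const
  have hae : u₀ =ᵐ[volume] v₀ := by
    filter_upwards [h1.1.ae_eq_mk, hpos] with x hx hx0
    exact hx.trans (max_eq_left (hx0.trans_eq hx)).symm
  have hvpos : ∀ x, 0 ≤ v₀ x := fun x => le_max_right _ _
  have h1v := h1.ae_eq hae
  have htopv := htop.ae_eq hae
  obtain ⟨M₀, hM₀, hb₀⟩ := exists_ne_top_ae_enorm_le htopv
  have hN₁ : lpNrm volume 1 (fun x => ‖v₀ x‖ₑ) ≠ ∞ := by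
    rw [← eLpNorm_eq_lpNrm one_pos, ENNReal.ofReal_one]; exact h1v.2.ne
  have hN₀ : lpNrm volume s (fun x => ‖v₀ x‖ₑ) ≠ ∞ := by
    refine ne_top_of_le_ne_top ?_ (lpNrm_le_of_le_of_le one_pos hs.le hv₀m.enorm hb₀ le_rfl)
    refine ENNReal.mul_ne_top (ENNReal.rpow_ne_top_of_nonneg ?_ hM₀)
      (ENNReal.rpow_ne_top_of_nonneg (by positivity) hN₁)
    rw [sub_nonneg, div_le_one hs0]; exact hs.le
  have hmass : ∫⁻ x, ‖v₀ x‖ₑ ≠ 0 := by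
    intro h0
    rw [lintegral_eq_zero_iff hv₀m.enorm] at h0
    have h2 : u₀ =ᵐ[volume] 0 := hae.trans (h0.mono fun x hx => by simpa using hx)
    rw [integral_congr_ae h2] at hint
    simp at hint
  obtain ⟨T, hT, hTb⟩ := exists_minSol_not_le (n := n) hα hαn hβ hβ2 hp hpF hv₀m.enorm hmass
  obtain ⟨T', u, hT', hu, hblow⟩ := exists_isMaximalMildSolution_of_not_boundedUpTo hα hαn hβ hβ2 hp
    hs1 hs2 hv₀m hvpos hM₀ hb₀ hN₀ ⟨T, fun ⟨M, hM, h⟩ => hTb M hM (h T ⟨hT, le_rfl⟩).1⟩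
  exact ⟨T', u, hT', hu.congr_initial hae.symm, hblow⟩

lemma exists_global_of_fujitaExponent_lt (hα : 0 < α) (hαn : α < n) (hβ : 0 < β) (hβ2 : β ≤ 2)
    (hp : 1 < p) (hF : fujitaExponent n β α < p) :
    ∃ ε : ℝ, 0 < ε ∧ ∀ u₀ : Euc n → ℝ, MemLp u₀ ∞ volume →
      eLpNorm u₀ (ENNReal.ofReal (scalingExponent n β α p)) volume ≤ ENNReal.ofReal ε →
      ∀ s : ℝ, (n : ℝ) / (n - α) < s → s < n * (p - 1) / α →
        MemLp u₀ (ENNReal.ofReal s) volume →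
        ∃ u : ℝ → Euc n → ℝ, IsMaximalMildSolution α β p s u₀ ∞ u ∧
          ∃ M : ℝ≥0, ∀ t : ℝ, 0 < t → eLpNorm (u t) ∞ volume ≤ M := by
  have hn : (0 : ℝ) < n := hα.trans hαn
  have hna : 0 < (n : ℝ) - α := by linarith
  have hp1 : 0 < p - 1 := by linarith
  have hq0 : 0 < scalingExponent n β α p := by rw [scalingExponent]; positivity
  obtain ⟨ε, hε, h⟩ := exists_boundedUpTo_of_small (n := n) hα hαn hβ hβ2 hp hF
  refine ⟨ε, hε, fun u₀ htop hsmall s hs1 hs2 hsu => ?_⟩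
  have hs0 : 0 < s := lt_trans (by positivity) hs1
  set v₀ : Euc n → ℝ := htop.1.mk u₀ with hv₀
  have hv₀m : Measurable v₀ := htop.1.stronglyMeasurable_mk.measurable
  have hae : u₀ =ᵐ[volume] v₀ := htop.1.ae_eq_mk
  obtain ⟨M₀, hM₀, hb₀⟩ := exists_ne_top_ae_enorm_le (htop.ae_eq hae)
  have hN₀ : lpNrm volume s (fun x => ‖v₀ x‖ₑ) ≠ ∞ := by
    rw [← eLpNorm_eq_lpNrm hs0]; exact (hsu.ae_eq hae).2.ne
  rw [eLpNorm_congr_ae hae, eLpNorm_eq_lpNrm hq0] at hsmall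
  obtain ⟨hbd, hloc⟩ := h _ hv₀m.enorm hsmall M₀ hM₀ hb₀
  obtain ⟨u, hu, hle⟩ := exists_isMaximalMildSolution_of_boundedUpTo hα hαn hβ hβ2 hp hs1 hs2 hv₀m
    hM₀ hb₀ hN₀ (hloc s hs1 hs2 hN₀)
  refine ⟨u, hu.congr_initial hae.symm, (2 * M₀).toNNReal, fun t ht => ?_⟩
  rw [ENNReal.coe_toNNReal (by finiteness), eLpNorm_exponent_top]
  exact essSup_le_of_ae_le _ (ae_of_all _ fun x => (hle t ht x).trans (hbd t ht x))

end Main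

end

theorem theorem1p2 (n : ℕ) (hn : 1 ≤ n) (α β p : ℝ) (hα0 : 0 < α) (hαn : α < n)
    (hβ0 : 0 < β) (hβ2 : β ≤ 2) (hp : 1 < p) :
    ((n : ℝ) / (n - α) < p → p ≤ fujitaExponent n β α →
      ∀ u₀ : EuclideanSpace ℝ (Fin n) → ℝ,
        MemLp u₀ 1 volume → MemLp u₀ ∞ volume → 0 ≤ᵐ[volume] u₀ → 0 < ∫ x, u₀ x →
        ∀ s : ℝ, (n : ℝ) / (n - α) < s → s < n * (p - 1) / α →
          ∃ (T : ℝ) (u : ℝ → EuclideanSpace ℝ (Fin n) → ℝ), 0 < T ∧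
            IsMaximalMildSolution α β p s u₀ (ENNReal.ofReal T) u ∧
            Tendsto (fun t => eLpNorm (u t) ∞ volume + eLpNorm (u t) (ENNReal.ofReal s) volume)
              (𝓝[<] T) (𝓝 ∞)) ∧
    (fujitaExponent n β α < p →
      ∃ ε : ℝ, 0 < ε ∧ ∀ u₀ : EuclideanSpace ℝ (Fin n) → ℝ,
        MemLp u₀ (ENNReal.ofReal (scalingExponent n β α p)) volume → MemLp u₀ ∞ volume →
        eLpNorm u₀ (ENNReal.ofReal (scalingExponent n β α p)) volume ≤ ENNReal.ofReal ε →
        ∀ s : ℝ, (n : ℝ) / (n - α) < s → s < n * (p - 1) / α →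
          MemLp u₀ (ENNReal.ofReal s) volume →
          ∃ u : ℝ → EuclideanSpace ℝ (Fin n) → ℝ,
            IsMaximalMildSolution α β p s u₀ ∞ u ∧
            ∃ M : ℝ≥0, ∀ t : ℝ, 0 < t → eLpNorm (u t) ∞ volume ≤ M) := by
  have : NeZero n := ⟨by omega⟩
  refine ⟨fun _ hpF u₀ h1 htop hpos hint s hs1 hs2 =>
    exists_blowup_of_le_fujitaExponent hα0 hαn hβ0 hβ2 hp hpF h1 htop hpos hint hs1 hs2, fun hF =>
        ?_⟩
  obtain ⟨ε, hε, h⟩ := exists_global_of_fujitaExponent_lt (n := n) hα0 hαn hβ0 hβ2 hp hF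
  exact ⟨ε, hε, fun u₀ _ htop hsmall s hs1 hs2 hsu => h u₀ htop hsmall s hs1 hs2 hsu⟩
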